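/- Let $k$ be an algebraically closed field. A quasi-projective variety is a reduced (not necessarily irreducible) $k$-scheme that is isomorphic over $k$ to a locally closed subscheme of some projective space $\mathbb P^n_k$. For a scheme $W$, the cohomological dimension $\mathrm{cd}(W)$ is the least $n$ such that $H^t(W,\mathcal F)=0$ for all quasi-coherent sheaves $\mathcal F$ on $W$ and all $t>n$ (with $\mathrm{cd}(\emptyset)=-\infty$). For a subset $W\subseteq X$, $\mathrm{codim}_X(W)=\inf_{x\in W}\dim\mathcal O_{X,x}$ (with $\mathrm{codim}_X(\emptyset)=\infty$). A locally closed subset $W\subseteq X$, with its reduced scheme structure, is called a local complete intersection (lci) in $X$ if every point of $W$ has a neighbourhood in $X$ on which the ideal sheaf of $W$ is generated by $\mathrm{codim}_X(W)$ sections. Let $X$ be a quasi-projective variety over $k$, let $$\emptyset=Z_0\subseteq Z_1\subseteq\dots\subseteq Z_r=X\qquad(r\ge 1)$$ be closed subsets, and let $Y_1,\dots,Y_r$ be quasi-projective varieties over $k$. Assume that $(Z_\bullet,Y_\bullet)$ is an lci affine bundle stratification of $X$, that is: for $j=2,\dots,r$ the stratum $Z_j\setminus Z_{j-1}$ is lci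 in $X$; and for $j=1,\dots,r$ there is an affine morphism $f_j:Z_j\setminus Z_{j-1}\to Y_j$ over $k$, where $Z_j\setminus Z_{j-1}$ carries its reduced scheme structure. Then $$\mathrm{cd}(X\setminus Z_1)\ \le\ \max_{2\le j\le r}\bigl\{\mathrm{cd}(Y_j)+\mathrm{codim}_X(Z_j\setminus Z_{j-1})\bigr\},$$ where the maximum of the empty family is $-\infty$ and $-\infty+\infty=-\infty$. -/

import Mathlib

universe u

open CategoryTheory AlgebraicGeometry TopologicalSpace

noncomputable section

namespace CdLci

/-! ### Projective space and quasi-projective varieties -/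

attribute [local instance] MvPolynomial.gradedAlgebra

/-- The `n`-dimensional projective space `ℙⁿ = Proj k[x₀, …, xₙ]` over a field `k`. -/
def projectiveSpace (k : Type u) [Field k] (n : ℕ) : Scheme.{u} :=
  Proj (MvPolynomial.homogeneousSubmodule (Fin (n + 1)) k)

/-- The structure morphism `ℙⁿ ⟶ Spec k`. -/
def projectiveSpaceHom (k : Type u) [Field k] (n : ℕ) :
    projectiveSpace k n ⟶ Spec (.of k) :=
  Proj.toSpecZero (MvPolynomial.homogeneousSubmodule (Fin (n + 1)) k) ≫
    Spec.map (CommRingCat.ofHom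
      (algebraMap k (MvPolynomial.homogeneousSubmodule (Fin (n + 1)) k 0)))

/-- A `k`-scheme `s : X ⟶ Spec k` is a quasi-projective variety if it is reduced and is isomorphic,
over `k`, to a locally closed subscheme of some projective space `ℙⁿ`.
Varieties are not required to be irreducible. -/
structure IsQuasiProjectiveVariety (k : Type u) [Field k] {X : Scheme.{u}}
    (s : X ⟶ Spec (.of k)) : Prop where
  isReduced : AlgebraicGeometry.IsReduced X
  exists_immersion : ∃ (n : ℕ) (i : X ⟶ projectiveSpace k n),
    IsImmersion i ∧ i ≫ projectiveSpaceHom k n = s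

/-! ### Cohomological dimension -/

/-- Abelian sheaves on a topological space have enough injectives, so that their
`Ext`-groups (and hence sheaf cohomology) live in the universe `u`. -/
instance hasExtSheaf (X : TopCat.{u}) :
    HasExt.{u} (Sheaf (Opens.grothendieckTopology X) AddCommGrpCat.{u}) :=
  hasExt_of_enoughInjectives _

/-- The sheaf cohomology group `Hᵗ(X, F)` of (the abelian sheaf underlying) a sheaf of
`𝒪_X`-modules `F`. -/
def cohomology {X : Scheme.{u}} (F : X.Modules) (t : ℕ) : Type u :=
  Sheaf.H ((SheafOfModules.toSheaf X.ringCatSheaf).obj F) t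

/-- The cohomological dimension `cd(W)`: the least `n` such that `Hᵗ(W, F) = 0` for all
quasi-coherent sheaves `F` on `W` and all `t > n`. It takes values in `WithBot ℕ∞`, where it is
`⊥` if and only if `W` is empty. -/
def cd (W : Scheme.{u}) : WithBot ℕ∞ :=
  sInf {n | ∀ F : W.Modules, F.IsQuasicoherent →
    ∀ t : ℕ, n < (t : WithBot ℕ∞) → Subsingleton (cohomology F t)}

/-! ### Codimension, strata and local complete intersections -/

/-- The codimension of a subset `W` of `X`: the infimum over `x ∈ W` of the dimension of the local
ring `𝒪_{X,x}`, which is the coheight of `x` for the specialization order of `X`.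
The empty set has codimension `⊤`. -/
def codim {X : Scheme.{u}} (W : Set X) : ℕ∞ :=
  ⨅ x ∈ W, Order.coheight x

variable {X : Scheme.{u}} (A B : Closeds X)

/-- The open subset `X \ B` of the scheme `X`, for `B` closed. -/
def closedCompl : X.Opens := B.compl

/-- The ideal sheaf of `A \ B`, with its reduced structure, in the open subscheme `X \ B`. -/
def stratumIdeal : (closedCompl B).toScheme.IdealSheafData :=
  Scheme.IdealSheafData.vanishingIdeal
    (A.preimage (closedCompl B).ι.continuous)

/-- The locally closed subset `A \ B` of `X`, as a scheme with its reduced structure. -/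
def stratum : Scheme.{u} := (stratumIdeal A B).subscheme

/-- The inclusion of `A \ B` in `X`. -/
def stratumι : stratum A B ⟶ X :=
  (stratumIdeal A B).subschemeι ≫ (closedCompl B).ι

/-- `A \ B` is a local complete intersection in `X`: around each of its points, its ideal sheaf
is generated by `c` sections, where `c` is the codimension of `A \ B` in `X`. -/
def IsLci : Prop :=
  ∀ x : (closedCompl B).toScheme, x.1 ∈ A →
    ∃ V : (closedCompl B).toScheme.affineOpens, x ∈ V.1 ∧
      ∃ c : ℕ, (c : ℕ∞) = codim ((A : Set X) \ B) ∧
        ∃ g : Fin c → Γ((closedCompl B).toScheme, V.1),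
          (stratumIdeal A B).ideal V = Ideal.span (Set.range g)

end CdLci

open CdLci

/-- `(Z_•, Y_•)` is an lci affine bundle stratification of the `k`-scheme `s : X ⟶ Spec k`.
The filtration is `∅ = Z 0 ⊆ Z 1 ⊆ … ⊆ Z r = X`. The index `j : Fin r` stands for the `(j + 1)`-st
stratum `Z_{j+1} \ Z_j`, which maps to the variety `Y_{j+1}`, written `Y j` below, whose structure
morphism is `t j`. -/
structure IsLciAffineBundleStratification (k : Type u) [Field k] {X : Scheme.{u}}
    (s : X ⟶ Spec (.of k)) {r : ℕ} (Z : Fin (r + 1) → Closeds X)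
    (Y : Fin r → Scheme.{u}) (t : ∀ j, Y j ⟶ Spec (.of k)) : Prop where
  eq_bot : Z 0 = ⊥
  monotone : Monotone Z
  eq_top : Z (Fin.last r) = ⊤
  isQuasiProjectiveVariety : ∀ j, IsQuasiProjectiveVariety k (t j)
  isLci : ∀ j : Fin r, 1 ≤ (j : ℕ) → IsLci (Z j.succ) (Z j.castSucc)
  exists_isAffineHom : ∀ j : Fin r, ∃ f : stratum (Z j.succ) (Z j.castSucc) ⟶ Y j,
    f ≫ t j = stratumι (Z j.succ) (Z j.castSucc) ≫ s ∧ IsAffineHom f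

end

open CdLci

noncomputable section

namespace CdLci

open Opposite Limits Abelian

/-! ### Short exact sequences of abelian sheaves on a topological space -/

/-! Fix a quasi-coherent module on `X` and a degree `n` larger than the right-hand side. Its
cohomology in degree `n` over `X \ Z_j` is shown to vanish by descending induction on `j`, starting
from the empty set `X \ Z_r`. Testing modules on `X` is enough, since every quasi-coherent module on
an open subset extends by direct image (`subsingleton_cohomology_opens`).

The inductive step is `vanishes_closedCompl_of_stratum`, which rests on `vanishes_top_of_lci`. Let
`Z` be closed in a noetherian separated scheme `W`, locally cut out by `c` equations and affine over
`Y`, let `d = cd Y`, and let `j : U ⟶ W` be the inclusion of the complement. If `Hᵗ(U, F) = 0` and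
`t > d + c`, then `Hᵗ(W, F) = 0`. Two facts give this.

(1) A quasi-coherent module supported on `Z` has no cohomology in degrees above `d`
(`vanishes_of_support`). It is the increasing union of the submodules killed by powers of the ideal
of `Z`, and cohomology classes come from a member of the union (`Exhausts.exists_ext`). A filtration
reduces to modules killed by the ideal itself; these are direct images from `Z`
(`exists_lqc_descent`), and the affine morphism to `Y` preserves their cohomology.

(2) Locally `U` is a union of `c` affine open subsets, so `Rⁱj_* F|_U = 0` for `i ≥ max c 1`
(`LQC.vanishes_iSup`), while for `i ≥ 1` these sheaves are supported on `Z`. With (1), the Leray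
spectral sequence would give `Hᵗ(W, j_* F|_U) = 0`. In `vanishes_pushRes_complOpen` it is replaced
by dimension shifting along affine covers.

The kernel and cokernel of `F ⟶ j_* F|_U` are supported on `Z`, so (1) carries the vanishing from
`j_* F|_U` back to `F`.

Quasi-coherence is handled through localization of sections (`LQC`), and cohomology over `U` through
`Ext` out of `freeSheaf U`. Vanishing on affine open subsets (`LQC.vanishes_affine`) is proved along
the way. -/

/-- Sheaves of abelian groups on a topological space. -/
abbrev AbSheaf (T : TopCat.{u}) := Sheaf (Opens.grothendieckTopology T) AddCommGrpCat.{u}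

section AbSheaf

variable {T : TopCat.{u}}

/-- Restriction of sections of an abelian sheaf. -/
def res (F : AbSheaf T) {V U : Opens T} (h : V ≤ U) :
    F.obj.obj (op U) →+ F.obj.obj (op V) := (F.obj.map (homOfLE h).op).hom

/-- The action of a morphism of abelian sheaves on sections. -/
def secMap {F G : AbSheaf T} (φ : F ⟶ G) (U : Opens T) :
    F.obj.obj (op U) →+ G.obj.obj (op U) := (φ.hom.app (op U)).hom

@[simp]
lemma res_self (F : AbSheaf T) {U : Opens T} (x : F.obj.obj (op U)) : res F le_rfl x = x := by
  change F.obj.map (𝟙 _) x = x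
  rw [F.obj.map_id]; rfl

@[simp]
lemma res_res (F : AbSheaf T) {W V U : Opens T} (h : W ≤ V) (h' : V ≤ U) (x : F.obj.obj (op U)) :
    res F h (res F h' x) = res F (h.trans h') x := by
  change (F.obj.map _ ≫ F.obj.map _) x = _
  rw [← F.obj.map_comp]; rfl

lemma secMap_res {F G : AbSheaf T} (φ : F ⟶ G) {V U : Opens T} (h : V ≤ U)
    (x : F.obj.obj (op U)) : secMap φ V (res F h x) = res G h (secMap φ U x) :=
  congr($(φ.hom.naturality (homOfLE h).op) x)

lemma secMap_comp {F G H : AbSheaf T} (φ : F ⟶ G) (ψ : G ⟶ H) (U : Opens T)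
    (x : F.obj.obj (op U)) : secMap (φ ≫ ψ) U x = secMap ψ U (secMap φ U x) := rfl

lemma AbSheaf.hom_ext {F G : AbSheaf T} {φ ψ : F ⟶ G}
    (h : ∀ U x, secMap φ U x = secMap ψ U x) : φ = ψ := by
  apply Sheaf.hom_ext
  ext U x
  exact h U.unop x

lemma AbSheaf.eq_of_locally_eq (F : AbSheaf T) {ι : Type*} {U : Opens T} (V : ι → Opens T)
    (hV : ∀ i, V i ≤ U) (hU : U ≤ ⨆ i, V i) {x y : F.obj.obj (op U)}
    (h : ∀ i, res F (hV i) x = res F (hV i) y) : x = y :=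
  TopCat.Sheaf.eq_of_locally_eq' F V U (fun i ↦ homOfLE (hV i)) hU x y h

lemma AbSheaf.exists_glue (F : AbSheaf T) {ι : Type*} {U : Opens T} (V : ι → Opens T)
    (hV : ∀ i, V i ≤ U) (hU : U ≤ ⨆ i, V i) (s : ∀ i, F.obj.obj (op (V i)))
    (h : ∀ i j, res F (inf_le_left : V i ⊓ V j ≤ V i) (s i) =
      res F (inf_le_right : V i ⊓ V j ≤ V j) (s j)) :
    ∃ x : F.obj.obj (op U), ∀ i, res F (hV i) x = s i :=
  (TopCat.Sheaf.existsUnique_gluing' F V U (fun i ↦ homOfLE (hV i)) hU s h).exists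

/-- Short exact sequences of abelian sheaves, in terms of sections. -/
structure SES {F G H : AbSheaf T} (φ : F ⟶ G) (ψ : G ⟶ H) : Prop where
  inj : ∀ U x, secMap φ U x = 0 → x = 0
  zero : ∀ U x, secMap ψ U (secMap φ U x) = 0
  exact : ∀ U x, secMap ψ U x = 0 → ∃ y, secMap φ U y = x
  surj : ∀ U z, ∀ p ∈ U, ∃ (V : Opens T) (h : V ≤ U) (x : G.obj.obj (op V)),
    p ∈ V ∧ secMap ψ V x = res H h z

lemma SES.w {F G H : AbSheaf T} {φ : F ⟶ G} {ψ : G ⟶ H} (h : SES φ ψ) : φ ≫ ψ = 0 :=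
  AbSheaf.hom_ext fun U x ↦ h.zero U x

lemma injective_secMap_of_mono {F G : AbSheaf T} (φ : F ⟶ G) [Mono φ] (U : Opens T) :
    Function.Injective (secMap φ U) := by
  have : Mono ((sheafToPresheaf _ _).map φ) := inferInstance
  have := (NatTrans.mono_iff_mono_app _).mp this (op U)
  exact (AddCommGrpCat.mono_iff_injective _).mp this

lemma mono_of_injective_secMap {F G : AbSheaf T} (φ : F ⟶ G)
    (h : ∀ U x, secMap φ U x = 0 → x = 0) : Mono φ := by
  refine ⟨fun a b hab ↦ AbSheaf.hom_ext fun U x ↦ ?_⟩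
  rw [← sub_eq_zero]
  apply h
  rw [map_sub, ← secMap_comp, ← secMap_comp, hab, sub_self]

lemma epi_iff_locally_surjective {F G : AbSheaf T} (φ : F ⟶ G) :
    Epi φ ↔ ∀ U z, ∀ p ∈ U, ∃ (V : Opens T) (h : V ≤ U) (x : F.obj.obj (op V)),
      p ∈ V ∧ secMap φ V x = res G h z := by
  rw [← Sheaf.isLocallySurjective_iff_epi']
  refine (TopCat.Presheaf.isLocallySurjective_iff φ.hom).trans ?_
  constructor
  · intro H U z p hp
    obtain ⟨V, h, ⟨x, hx⟩, hpV⟩ := H U z p hp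
    exact ⟨V, h, x, hpV, hx⟩
  · intro H U z p hp
    obtain ⟨V, h, x, hpV, hx⟩ := H U z p hp
    exact ⟨V, h, ⟨x, hx⟩, hpV⟩

lemma SES.of_shortExact {S : ShortComplex (AbSheaf T)} (hS : S.ShortExact) : SES S.f S.g where
  inj U x hx := by
    have := hS.mono_f
    exact injective_secMap_of_mono S.f U (hx.trans (map_zero _).symm)
  zero U x := by rw [← secMap_comp, S.zero]; rfl
  exact U x hx := TopCat.Sheaf.sections_exact_of_left_exact hS.exact hS.mono_f x hx
  surj := (epi_iff_locally_surjective S.g).mp hS.epi_g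

/-- Lifting a morphism of abelian sheaves along a sectionwise kernel. -/
def kernelLift {F G H W : AbSheaf T} {φ : F ⟶ G} {ψ : G ⟶ H}
    (inj : ∀ U x, secMap φ U x = 0 → x = 0)
    (exact : ∀ U x, secMap ψ U x = 0 → ∃ y, secMap φ U y = x) (k : W ⟶ G)
    (hk : k ≫ ψ = 0) : W ⟶ F := by
  have key (U : Opens T) (x) : ∃ y, secMap φ U y = secMap k U x :=
    exact U _ (by rw [← secMap_comp, hk]; rfl)
  have inj' (U : Opens T) : Function.Injective (secMap φ U) :=
    (injective_iff_map_eq_zero _).mpr (inj U)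
  choose l hl using key
  refine ⟨⟨fun U ↦ AddCommGrpCat.ofHom
    (AddMonoidHom.mk' (l U.unop) fun a b ↦ inj' _ (by simp [hl])), fun U V i ↦ ?_⟩⟩
  ext x
  apply inj' V.unop
  have h₁ : l V.unop (res W (leOfHom i.unop) x) = l V.unop (W.obj.map i x) := rfl
  have h₂ := secMap_res φ (leOfHom i.unop) (l U.unop x)
  rw [hl, ← secMap_res, ← hl] at h₂
  exact h₂.symm

lemma secMap_kernelLift {F G H W : AbSheaf T} {φ : F ⟶ G} {ψ : G ⟶ H}
    (inj : ∀ U x, secMap φ U x = 0 → x = 0)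
    (exact : ∀ U x, secMap ψ U x = 0 → ∃ y, secMap φ U y = x) (k : W ⟶ G)
    (hk : k ≫ ψ = 0) : kernelLift inj exact k hk ≫ φ = k := by
  refine AbSheaf.hom_ext fun U x ↦ ?_
  have key : ∃ y, secMap φ U y = secMap k U x := exact U _ (by rw [← secMap_comp, hk]; rfl)
  exact key.choose_spec

lemma SES.shortExact {F G H : AbSheaf T} {φ : F ⟶ G} {ψ : G ⟶ H} (h : SES φ ψ) :
    (ShortComplex.mk φ ψ h.w).ShortExact := by
  have hm : Mono φ := mono_of_injective_secMap φ h.inj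
  refine .mk' ?_ hm ((epi_iff_locally_surjective ψ).mpr h.surj)
  apply ShortComplex.exact_of_f_is_kernel
  exact KernelFork.IsLimit.ofι' φ h.w fun k hk ↦
    ⟨kernelLift h.inj h.exact k hk, secMap_kernelLift h.inj h.exact k hk⟩

/-! ### Cohomology over open subsets -/

/-- The abelian sheaf representing sections over `U`. -/
abbrev freeSheaf (U : Opens T) : AbSheaf T :=
  (presheafToSheaf (Opens.grothendieckTopology T) AddCommGrpCat.{u}).obj
    (yoneda.obj U ⋙ AddCommGrpCat.free)

/-- The map between the sheaves representing sections, for an inclusion of open subsets. -/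
abbrev freeSheafMap {V U : Opens T} (h : V ≤ U) : freeSheaf V ⟶ freeSheaf U :=
  (presheafToSheaf (Opens.grothendieckTopology T) AddCommGrpCat.{u}).map
    (Functor.whiskerRight (yoneda.map (homOfLE h)) AddCommGrpCat.free)

/-- The universal property of the sheaf representing sections over `U`. -/
def freeSheafEquiv (U : Opens T) (F : AbSheaf T) : (freeSheaf U ⟶ F) ≃ F.obj.obj (op U) :=
  ((sheafificationAdjunction _ _).homEquiv _ F).trans
    (((AddCommGrpCat.adj.whiskerRight (Opens T)ᵒᵖ).homEquiv (yoneda.obj U) F.obj).trans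
      (yonedaEquiv (F := F.obj ⋙ forget AddCommGrpCat)))

lemma freeSheafEquiv_comp (U : Opens T) {F G : AbSheaf T} (a : freeSheaf U ⟶ F) (φ : F ⟶ G) :
    freeSheafEquiv U G (a ≫ φ) = secMap φ U (freeSheafEquiv U F a) := by
  simp only [freeSheafEquiv, Equiv.trans_apply]
  rw [Adjunction.homEquiv_naturality_right, Adjunction.homEquiv_naturality_right,
    yonedaEquiv_comp]
  rfl

lemma freeSheafEquiv_map {V U : Opens T} (h : V ≤ U) {F : AbSheaf T} (a : freeSheaf U ⟶ F) :
    freeSheafEquiv V F (freeSheafMap h ≫ a) = res F h (freeSheafEquiv U F a) := by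
  simp only [freeSheafEquiv, Equiv.trans_apply]
  rw [Adjunction.homEquiv_naturality_left]
  erw [Adjunction.homEquiv_naturality_left]
  exact (yonedaEquiv_naturality (F := F.obj ⋙ forget AddCommGrpCat) _ (homOfLE h)).symm

end AbSheaf

section AbSheaf

variable {T : TopCat.{u}}

/-- The vanishing of the cohomology group `Hⁿ(U, F)`. -/
def Vanishes (n : ℕ) (U : Opens T) (F : AbSheaf T) : Prop :=
  Subsingleton (Ext (freeSheaf U) F n)

lemma vanishes_iff {n : ℕ} {U : Opens T} {F : AbSheaf T} :
    Vanishes n U F ↔ ∀ x : Ext (freeSheaf U) F n, x = 0 :=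
  ⟨fun h _ ↦ h.elim _ _, fun h ↦ ⟨fun x y ↦ (h x).trans (h y).symm⟩⟩

lemma Vanishes.of_iso {n : ℕ} {U : Opens T} {F G : AbSheaf T} (e : F ≅ G) (h : Vanishes n U F) :
    Vanishes n U G := by
  rw [vanishes_iff] at *
  intro x
  have : (x.comp (Ext.mk₀ e.inv) (add_zero n)).comp (Ext.mk₀ e.hom) (add_zero n) = x := by simp
  rw [← this, h (x.comp _ _), Ext.zero_comp]

section

variable {F G H : AbSheaf T} {φ : F ⟶ G} {ψ : G ⟶ H} (h : SES φ ψ) {U : Opens T} {n : ℕ}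
include h

lemma SES.surjective_of_vanishes (hF : Vanishes 1 U F) : Function.Surjective (secMap ψ U) := by
  intro z
  obtain ⟨x, hx⟩ := Ext.covariant_sequence_exact₃ (freeSheaf U) h.shortExact
    (Ext.mk₀ ((freeSheafEquiv U H).symm z)) rfl (vanishes_iff.mp hF _)
  obtain ⟨a, rfl⟩ := Ext.homEquiv₀.symm.surjective x
  refine ⟨freeSheafEquiv U G a, ?_⟩
  rw [← freeSheafEquiv_comp]
  apply (freeSheafEquiv U H).symm.injective
  rw [Equiv.symm_apply_apply]
  apply (Ext.mk₀_bijective _ _).injective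
  rw [← hx, ← Ext.mk₀_comp_mk₀]
  rfl

lemma SES.vanishes_one_left (hs : Function.Surjective (secMap ψ U)) (hG : Vanishes 1 U G) :
    Vanishes 1 U F := by
  rw [vanishes_iff]
  intro x
  obtain ⟨y, rfl⟩ := Ext.covariant_sequence_exact₁ (freeSheaf U) h.shortExact x
    (vanishes_iff.mp hG _) (zero_add 1)
  obtain ⟨b, rfl⟩ := (Ext.mk₀_bijective _ _).surjective y
  obtain ⟨s, hs⟩ := hs (freeSheafEquiv U H b)
  have : b = (freeSheafEquiv U G).symm s ≫ ψ := by
    apply (freeSheafEquiv U H).injective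
    rw [freeSheafEquiv_comp, Equiv.apply_symm_apply, hs]
  rw [this, ← Ext.mk₀_comp_mk₀]
  have := h.shortExact.comp_extClass
  dsimp at this
  rw [Ext.comp_assoc _ _ _ (zero_add 0) (zero_add 1) (by rfl), this, Ext.comp_zero]

lemma SES.vanishes_left (hH : Vanishes n U H) (hG : Vanishes (n + 1) U G) :
    Vanishes (n + 1) U F := by
  rw [vanishes_iff]
  intro x
  obtain ⟨y, rfl⟩ := Ext.covariant_sequence_exact₁ (freeSheaf U) h.shortExact x
    (vanishes_iff.mp hG _) rfl
  rw [vanishes_iff.mp hH y, Ext.zero_comp]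

lemma SES.vanishes_mid (hF : Vanishes n U F) (hH : Vanishes n U H) : Vanishes n U G := by
  rw [vanishes_iff]
  intro x
  obtain ⟨y, rfl⟩ := Ext.covariant_sequence_exact₂ (freeSheaf U) h.shortExact x
    (vanishes_iff.mp hH _)
  rw [vanishes_iff.mp hF y, Ext.zero_comp]

lemma SES.vanishes_right (hG : Vanishes n U G) (hF : Vanishes (n + 1) U F) :
    Vanishes n U H := by
  rw [vanishes_iff]
  intro x
  obtain ⟨y, rfl⟩ := Ext.covariant_sequence_exact₃ (freeSheaf U) h.shortExact x
    rfl (vanishes_iff.mp hF _)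
  rw [vanishes_iff.mp hG y, Ext.zero_comp]

end

/-! ### Flasque sheaves -/

/-- Flasque abelian sheaves. -/
def IsFlasque (F : AbSheaf T) : Prop :=
  ∀ ⦃V U : Opens T⦄ (h : V ≤ U), Function.Surjective (res F h)

lemma IsFlasque.isFlasque {F : AbSheaf T} (hF : IsFlasque F) : TopCat.Sheaf.IsFlasque F where
  epi i := (AddCommGrpCat.epi_iff_surjective _).mpr (hF (leOfHom i.unop))

instance freeSheafMap_mono {V U : Opens T} (h : V ≤ U) : Mono (freeSheafMap h) := by
  have : Mono (Functor.whiskerRight (yoneda.map (homOfLE h)) AddCommGrpCat.free.{u}) := by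
    apply +allowSynthFailures NatTrans.mono_of_mono_app
  infer_instance

/-- A section over `V` is a morphism out of `freeSheaf V`, which embeds in `freeSheaf U`;
injectivity extends the morphism. -/
lemma isFlasque_of_injective (F : AbSheaf T) [Injective F] : IsFlasque F := by
  intro V U h x
  refine ⟨freeSheafEquiv U F (Injective.factorThru ((freeSheafEquiv V F).symm x)
    (freeSheafMap h)), ?_⟩
  rw [← freeSheafEquiv_map, Injective.comp_factorThru, Equiv.apply_symm_apply]

lemma exists_ses_injective (F : AbSheaf T) :
    ∃ (I Q : AbSheaf T) (φ : F ⟶ I) (ψ : I ⟶ Q), SES φ ψ ∧ Injective I := by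
  let φ := Injective.ι F
  have hφ : Mono φ := inferInstance
  have hψ : Epi (cokernel.π φ) := inferInstance
  exact ⟨_, _, φ, cokernel.π φ, SES.of_shortExact
    (S := ShortComplex.mk φ (cokernel.π φ) (cokernel.condition φ))
    (.mk' (ShortComplex.exact_of_g_is_cokernel _ (cokernelIsCokernel φ)) hφ hψ), inferInstance⟩

lemma SES.surjective_of_isFlasque {F G H : AbSheaf T} {φ : F ⟶ G} {ψ : G ⟶ H} (h : SES φ ψ)
    (hF : IsFlasque F) (U : Opens T) : Function.Surjective (secMap ψ U) := by
  have := hF.isFlasque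
  exact (AddCommGrpCat.epi_iff_surjective _).mp
    (TopCat.Sheaf.IsFlasque.epi_of_shortExact (U := U) h.shortExact)

lemma SES.isFlasque_right {F G H : AbSheaf T} {φ : F ⟶ G} {ψ : G ⟶ H} (h : SES φ ψ)
    (hF : IsFlasque F) (hG : IsFlasque G) : IsFlasque H := by
  intro V U hVU z
  obtain ⟨y, rfl⟩ := h.surjective_of_isFlasque hF V z
  obtain ⟨x, rfl⟩ := hG hVU y
  exact ⟨secMap ψ U x, (secMap_res _ _ _).symm⟩

lemma vanishes_of_injective (F : AbSheaf T) [Injective F] {n : ℕ} (hn : 1 ≤ n) (U : Opens T) :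
    Vanishes n U F := by
  obtain ⟨m, rfl⟩ := Nat.exists_eq_add_of_le' hn
  exact vanishes_iff.mpr fun x ↦ Ext.eq_zero_of_injective x

lemma IsFlasque.vanishes {F : AbSheaf T} (hF : IsFlasque F) {n : ℕ} (hn : 1 ≤ n)
    (U : Opens T) : Vanishes n U F := by
  induction n, hn using Nat.le_induction generalizing F with
  | base =>
    obtain ⟨I, Q, φ, ψ, h, _⟩ := exists_ses_injective F
    exact h.vanishes_one_left (h.surjective_of_isFlasque hF U) (vanishes_of_injective I le_rfl U)
  | succ n hn ih =>
    obtain ⟨I, Q, φ, ψ, h, _⟩ := exists_ses_injective F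
    exact h.vanishes_left (ih (h.isFlasque_right hF (isFlasque_of_injective I)))
      (vanishes_of_injective I (by omega) U)

lemma exists_ses_isFlasque (F : AbSheaf T) :
    ∃ (I Q : AbSheaf T) (φ : F ⟶ I) (ψ : I ⟶ Q), SES φ ψ ∧ IsFlasque I := by
  obtain ⟨I, Q, φ, ψ, h, _⟩ := exists_ses_injective F
  exact ⟨I, Q, φ, ψ, h, isFlasque_of_injective I⟩

/-- With a flasque middle term, vanishing in any positive degree reduces to surjectivity on
sections. The comparison results below transport only this property. -/
lemma SES.vanishes_one_iff {F G H : AbSheaf T} {φ : F ⟶ G} {ψ : G ⟶ H} (h : SES φ ψ)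
    (hG : IsFlasque G) (U : Opens T) : Vanishes 1 U F ↔ Function.Surjective (secMap ψ U) :=
  ⟨h.surjective_of_vanishes, fun hs ↦ h.vanishes_one_left hs (hG.vanishes le_rfl U)⟩

lemma SES.vanishes_succ_iff {F G H : AbSheaf T} {φ : F ⟶ G} {ψ : G ⟶ H} (h : SES φ ψ)
    (hG : IsFlasque G) (U : Opens T) {n : ℕ} (hn : 1 ≤ n) :
    Vanishes (n + 1) U F ↔ Vanishes n U H :=
  ⟨h.vanishes_right (hG.vanishes hn U), fun hs ↦ h.vanishes_left hs (hG.vanishes (by omega) U)⟩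

/-! ### Comparison of cohomology along a functor between open subsets -/

section Comparison

variable {T' : TopCat.{u}} (θ : Opens T ⥤ Opens T')
  [θ.IsContinuous (Opens.grothendieckTopology T) (Opens.grothendieckTopology T')]

/-- The functor on abelian sheaves given by precomposition with a continuous functor between open
subsets. -/
abbrev pull : AbSheaf T' ⥤ AbSheaf T :=
  θ.sheafPushforwardContinuous AddCommGrpCat.{u} (Opens.grothendieckTopology T)
    (Opens.grothendieckTopology T')

lemma isFlasque_pull {F : AbSheaf T'} (hF : IsFlasque F) : IsFlasque ((pull θ).obj F) :=
  fun _ _ h ↦ hF (leOfHom (θ.map (homOfLE h)))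

/-- A class of abelian sheaves, stable under passing to the quotient by an embedding in a flasque
sheaf, on which `pull θ` is exact, has the same cohomology before and after `pull θ`. -/
lemma vanishes_pull_iff (P : AbSheaf T' → Prop)
    (hP : ∀ {F I Q : AbSheaf T'} {φ : F ⟶ I} {ψ : I ⟶ Q}, SES φ ψ → IsFlasque I → P F →
      P Q ∧ ∀ (U : Opens T) (z : Q.obj.obj (op (θ.obj U))), ∀ p ∈ U,
        ∃ (V : Opens T) (h : V ≤ U) (x : I.obj.obj (op (θ.obj V))),
          p ∈ V ∧ secMap ψ _ x = res Q (leOfHom (θ.map (homOfLE h))) z)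
    {F : AbSheaf T'} (hF : P F) {n : ℕ} (hn : 1 ≤ n) (U : Opens T) :
    Vanishes n U ((pull θ).obj F) ↔ Vanishes n (θ.obj U) F := by
  have ses {F I Q : AbSheaf T'} {φ : F ⟶ I} {ψ : I ⟶ Q} (h : SES φ ψ) (hI : IsFlasque I)
      (hF : P F) : SES ((pull θ).map φ) ((pull θ).map ψ) :=
    ⟨fun U x hx ↦ h.inj _ _ hx, fun U x ↦ h.zero _ _, fun U x hx ↦ h.exact _ _ hx,
      (hP h hI hF).2⟩
  induction n, hn using Nat.le_induction generalizing F with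
  | base =>
    obtain ⟨I, Q, φ, ψ, h, hI⟩ := exists_ses_isFlasque F
    rw [h.vanishes_one_iff hI, (ses h hI hF).vanishes_one_iff (isFlasque_pull θ hI)]
    rfl
  | succ n hn ih =>
    obtain ⟨I, Q, φ, ψ, h, hI⟩ := exists_ses_isFlasque F
    rw [h.vanishes_succ_iff hI _ hn, (ses h hI hF).vanishes_succ_iff (isFlasque_pull θ hI) _ hn]
    exact ih (hP h hI hF).1

/-- If the cohomology of `F` vanishes over `θ V` for all `V` in a basis of open subsets, then `F`
and `pull θ F` have the same cohomology. -/
lemma vanishes_pull_iff_of_basis (B : Set (Opens T))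
    (hB : ∀ (U : Opens T), ∀ p ∈ U, ∃ V ∈ B, p ∈ V ∧ V ≤ U)
    {F : AbSheaf T'} (hF : ∀ V ∈ B, ∀ n, 1 ≤ n → Vanishes n (θ.obj V) F)
    {n : ℕ} (hn : 1 ≤ n) (U : Opens T) :
    Vanishes n U ((pull θ).obj F) ↔ Vanishes n (θ.obj U) F := by
  refine vanishes_pull_iff θ (fun F ↦ ∀ V ∈ B, ∀ n, 1 ≤ n → Vanishes n (θ.obj V) F)
    (fun {F I Q φ ψ} h hI hF ↦ ⟨fun V hV n hn ↦ ?_, fun U z p hp ↦ ?_⟩) hF hn U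
  · exact (h.vanishes_succ_iff hI _ hn).mp (hF V hV (n + 1) (by omega))
  · obtain ⟨V, hV, hpV, hVU⟩ := hB U p hp
    obtain ⟨x, hx⟩ := h.surjective_of_vanishes (hF V hV 1 le_rfl)
      (res Q (leOfHom (θ.map (homOfLE hVU))) z)
    exact ⟨V, hVU, x, hpV, hx⟩

end Comparison

end AbSheaf

section AbSheaf

variable {T : TopCat.{u}}

/-! ### Restriction of cohomology classes -/

/-- Restriction of cohomology classes to a smaller open subset. -/
def resExt {V U : Opens T} (h : V ≤ U) {F : AbSheaf T} {n : ℕ} (x : Ext (freeSheaf U) F n) :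
    Ext (freeSheaf V) F n :=
  (Ext.mk₀ (freeSheafMap h)).comp x (zero_add n)

lemma resExt_comp {V U : Opens T} (h : V ≤ U) {F G : AbSheaf T} {n m k : ℕ}
    (x : Ext (freeSheaf U) F n) (y : Ext F G m) (hk : n + m = k) :
    resExt h (x.comp y hk) = (resExt h x).comp y hk :=
  (Ext.comp_assoc _ _ _ (zero_add n) hk (by omega)).symm

lemma freeSheafMap_comp {W V U : Opens T} (h : W ≤ V) (h' : V ≤ U) :
    freeSheafMap h ≫ freeSheafMap h' = freeSheafMap (h.trans h') := by
  rw [← Functor.map_comp, ← Functor.whiskerRight_comp, ← Functor.map_comp]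
  rfl

lemma resExt_resExt {W V U : Opens T} (h : W ≤ V) (h' : V ≤ U) {F : AbSheaf T} {n : ℕ}
    (x : Ext (freeSheaf U) F n) : resExt h (resExt h' x) = resExt (h.trans h') x := by
  simp only [resExt]
  rw [← Ext.comp_assoc _ _ _ (zero_add 0) (zero_add n) (by omega), Ext.mk₀_comp_mk₀,
    freeSheafMap_comp]

@[simp]
lemma resExt_zero {V U : Opens T} (h : V ≤ U) {F : AbSheaf T} {n : ℕ} :
    resExt h (0 : Ext (freeSheaf U) F n) = 0 := Ext.comp_zero ..

section

variable {F G H : AbSheaf T} {φ : F ⟶ G} {ψ : G ⟶ H} (h : SES φ ψ) {U V : Opens T}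

/-- The connecting map from sections to first cohomology. -/
def SES.conn (z : H.obj.obj (op U)) : Ext (freeSheaf U) F 1 :=
  (Ext.mk₀ ((freeSheafEquiv U H).symm z)).comp h.shortExact.extClass (zero_add 1)

lemma SES.exists_conn_eq (x : Ext (freeSheaf U) F 1)
    (hx : x.comp (Ext.mk₀ φ) (add_zero 1) = 0) : ∃ z, h.conn z = x := by
  obtain ⟨y, rfl⟩ := Ext.covariant_sequence_exact₁ (freeSheaf U) h.shortExact x hx (zero_add 1)
  obtain ⟨b, rfl⟩ := (Ext.mk₀_bijective _ _).surjective y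
  exact ⟨freeSheafEquiv U H b, by rw [SES.conn, Equiv.symm_apply_apply]⟩

lemma SES.conn_eq_zero_iff (z : H.obj.obj (op U)) :
    h.conn z = 0 ↔ ∃ y, secMap ψ U y = z := by
  constructor
  · intro hz
    obtain ⟨x, hx⟩ := Ext.covariant_sequence_exact₃ (freeSheaf U) h.shortExact
      (Ext.mk₀ ((freeSheafEquiv U H).symm z)) (zero_add 1) hz
    obtain ⟨a, rfl⟩ := (Ext.mk₀_bijective _ _).surjective x
    refine ⟨freeSheafEquiv U G a, ?_⟩
    rw [← freeSheafEquiv_comp]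
    apply (freeSheafEquiv U H).symm.injective
    rw [Equiv.symm_apply_apply]
    apply (Ext.mk₀_bijective _ _).injective
    rw [← hx, ← Ext.mk₀_comp_mk₀]
  · rintro ⟨s, rfl⟩
    have : (freeSheafEquiv U H).symm (secMap ψ U s) = (freeSheafEquiv U G).symm s ≫ ψ := by
      apply (freeSheafEquiv U H).injective
      rw [freeSheafEquiv_comp, Equiv.apply_symm_apply, Equiv.apply_symm_apply]
    rw [SES.conn, this, ← Ext.mk₀_comp_mk₀]
    have := h.shortExact.comp_extClass
    dsimp at this
    rw [Ext.comp_assoc _ _ _ (zero_add 0) (zero_add 1) (by rfl), this, Ext.comp_zero]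

lemma SES.resExt_conn (hVU : V ≤ U) (z : H.obj.obj (op U)) :
    resExt hVU (h.conn z) = h.conn (res H hVU z) := by
  rw [SES.conn, resExt_comp, SES.conn, resExt, Ext.mk₀_comp_mk₀]
  congr 2
  apply (freeSheafEquiv V H).injective
  rw [freeSheafEquiv_map, Equiv.apply_symm_apply, Equiv.apply_symm_apply]

end

/-- Cohomology classes of positive degree vanish locally. -/
lemma exists_resExt_eq_zero {F : AbSheaf T} {n : ℕ} (hn : 1 ≤ n) {U : Opens T}
    (x : Ext (freeSheaf U) F n) {p : T} (hp : p ∈ U) :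
    ∃ (V : Opens T) (h : V ≤ U), p ∈ V ∧ resExt h x = 0 := by
  induction n, hn using Nat.le_induction generalizing F with
  | base =>
    obtain ⟨I, Q, φ, ψ, h, hI⟩ := exists_ses_isFlasque F
    obtain ⟨z, rfl⟩ := h.exists_conn_eq x (vanishes_iff.mp (hI.vanishes le_rfl U) _)
    obtain ⟨V, hV, y, hpV, hy⟩ := h.surj U z p hp
    exact ⟨V, hV, hpV, by rw [h.resExt_conn, h.conn_eq_zero_iff]; exact ⟨y, hy⟩⟩
  | succ n hn ih =>
    obtain ⟨I, Q, φ, ψ, h, hI⟩ := exists_ses_isFlasque F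
    obtain ⟨y, rfl⟩ := Ext.covariant_sequence_exact₁ (freeSheaf U) h.shortExact x
      (vanishes_iff.mp (hI.vanishes (by omega) U) _) rfl
    obtain ⟨V, hV, hpV, hy⟩ := ih y
    exact ⟨V, hV, hpV, by rw [resExt_comp, hy, Ext.zero_comp]⟩

/-- If the cohomology of `F` over `θ W` vanishes in degrees `1 ≤ s < n` for all `W` in a basis, and
`θ U = θ V` with `V ≤ U`, then the restriction map `Hⁿ(U, pull θ F) → Hⁿ(V, pull θ F)` is
injective. -/
lemma eq_zero_of_resExt_pull_eq_zero {T' : TopCat.{u}} (θ : Opens T ⥤ Opens T')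
    [θ.IsContinuous (Opens.grothendieckTopology T) (Opens.grothendieckTopology T')]
    (B : Set (Opens T)) (hB : ∀ (U : Opens T), ∀ p ∈ U, ∃ V ∈ B, p ∈ V ∧ V ≤ U)
    {F : AbSheaf T'} {n : ℕ} (hn : 1 ≤ n)
    (hF : ∀ V ∈ B, ∀ s, 1 ≤ s → s < n → Vanishes s (θ.obj V) F) {V U : Opens T} (hVU : V ≤ U)
    (hθ : θ.obj U ≤ θ.obj V) (x : Ext (freeSheaf U) ((pull θ).obj F) n)
    (hx : resExt hVU x = 0) : x = 0 := by
  induction n, hn using Nat.le_induction generalizing F with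
  | base =>
    obtain ⟨I, Q, φ, ψ, h, hI⟩ := exists_ses_isFlasque F
    let ψ' := Abelian.factorThruImage ((pull θ).map ψ)
    let ι' := Abelian.image.ι ((pull θ).map ψ)
    -- In degree 1 nothing ensures that `pull θ` keeps `ψ` locally surjective, so its target is
    -- replaced by the image of `(pull θ).map ψ`.
    have hfac (W : Opens T) (y) : secMap ι' W (secMap ψ' W y) = secMap ((pull θ).map ψ) W y := by
      rw [← secMap_comp, Abelian.image.fac]
    have hι (W : Opens T) : Function.Injective (secMap ι' W) := injective_secMap_of_mono ι' W
    have hψ' : Epi ψ' := inferInstance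
    have h' : SES ((pull θ).map φ) ψ' := by
      refine ⟨fun W y hy ↦ h.inj _ _ hy, fun W y ↦ hι W ?_, fun W y hy ↦ h.exact _ _ ?_,
        (epi_iff_locally_surjective ψ').mp hψ'⟩
      · rw [hfac, map_zero]
        exact h.zero _ _
      · have := hfac W y
        rw [hy, map_zero] at this
        exact this.symm
    obtain ⟨z, rfl⟩ := h'.exists_conn_eq x
      (vanishes_iff.mp ((isFlasque_pull θ hI).vanishes le_rfl U) _)
    rw [h'.resExt_conn, h'.conn_eq_zero_iff] at hx
    obtain ⟨e, he⟩ := hx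
    -- The lift of `z` found over `V` is extended to `U`.
    obtain ⟨e, rfl⟩ := isFlasque_pull θ hI hVU e
    rw [h'.conn_eq_zero_iff]
    refine ⟨e, ?_⟩
    rw [secMap_res] at he
    apply hι
    have he' := congr(secMap ι' V $he)
    rw [secMap_res, secMap_res] at he'
    -- Since `θ U = θ V`, restriction of sections of `pull θ Q` from `U` to `V` loses nothing, so
    -- the extended lift maps to `z` over `U` too.
    have key (q : Q.obj.obj (op (θ.obj U))) :
        res Q hθ (res ((pull θ).obj Q) hVU q) = q := by
      have : res Q hθ (res Q (leOfHom (θ.map (homOfLE hVU))) q) = q := by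
        rw [res_res, res_self]
      exact this
    have := congr(res Q hθ $he')
    exact (key _).symm.trans (this.trans (key _))
  | succ n hn ih =>
    obtain ⟨I, Q, φ, ψ, h, hI⟩ := exists_ses_isFlasque F
    have h' : SES ((pull θ).map φ) ((pull θ).map ψ) := by
      refine ⟨fun W y hy ↦ h.inj _ _ hy, fun W y ↦ h.zero _ _, fun W y hy ↦ h.exact _ _ hy,
        fun W z p hp ↦ ?_⟩
      obtain ⟨W', hW', hpW', hle⟩ := hB W p hp
      obtain ⟨y, hy⟩ := h.surjective_of_vanishes (hF W' hW' 1 le_rfl (by omega))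
        (res Q (leOfHom (θ.map (homOfLE hle))) z)
      exact ⟨W', hle, y, hpW', hy⟩
    obtain ⟨y, rfl⟩ := Ext.covariant_sequence_exact₁ (freeSheaf U) h'.shortExact x
      (vanishes_iff.mp ((isFlasque_pull θ hI).vanishes (by omega) U) _) rfl
    rw [resExt_comp] at hx
    obtain ⟨w, hw⟩ := Ext.covariant_sequence_exact₃ (freeSheaf V) h'.shortExact _ rfl hx
    rw [vanishes_iff.mp ((isFlasque_pull θ hI).vanishes hn V) w, Ext.zero_comp] at hw
    rw [ih (fun V hV s hs hsn ↦ (h.vanishes_succ_iff hI _ hs).mp (hF V hV _ (by omega) (by omega)))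
      y hw.symm, Ext.zero_comp]

/-! ### Open embeddings, Mayer–Vietoris, and cohomology of the whole space -/

/-- Cohomology of the restriction of an abelian sheaf along an open embedding. -/
lemma vanishes_restrict_iff {T' : TopCat.{u}} (j : T ⟶ T') (hj : Topology.IsOpenEmbedding j)
    [hj.isOpenMap.functor.IsContinuous (Opens.grothendieckTopology T)
      (Opens.grothendieckTopology T')] (F : AbSheaf T') {n : ℕ} (hn : 1 ≤ n) (U : Opens T) :
    Vanishes n U ((pull hj.isOpenMap.functor).obj F) ↔
      Vanishes n (hj.isOpenMap.functor.obj U) F := by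
  refine vanishes_pull_iff _ (fun _ ↦ True) (fun {F I Q φ ψ} h hI _ ↦ ⟨trivial, ?_⟩) trivial hn U
  intro U z p hp
  obtain ⟨V, hV, x, hpV, hx⟩ := h.surj _ z (j p) ⟨p, hp, rfl⟩
  have h₁ : hj.isOpenMap.functor.obj ((Opens.map j).obj V) ≤ V := by
    rintro _ ⟨q, hq, rfl⟩; exact hq
  have h₂ : (Opens.map j).obj V ≤ U := by
    intro q hq
    obtain ⟨q', hq', h⟩ := hV hq
    rwa [← hj.injective h]
  refine ⟨(Opens.map j).obj V, h₂, res I h₁ x, hpV, ?_⟩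
  rw [secMap_res, hx, res_res]

lemma vanishes_sup {U V : Opens T} {F : AbSheaf T} {n : ℕ} (hU : Vanishes (n + 1) U F)
    (hV : Vanishes (n + 1) V F) (hUV : Vanishes n (U ⊓ V) F) : Vanishes (n + 1) (U ⊔ V) F := by
  let S := Opens.mayerVietorisSquare U V
  have h₁ : Subsingleton (Ext (freeSheaf U) F (n + 1)) := hU
  have h₂ : Subsingleton (Ext (freeSheaf V) F (n + 1)) := hV
  refine vanishes_iff.mpr fun x ↦ ?_
  have h₃ : Subsingleton (Ext (freeSheaf U ⊞ freeSheaf V) F (n + 1)) :=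
    Ext.biprodAddEquiv.toEquiv.subsingleton
  obtain ⟨y, hy⟩ := Ext.contravariant_sequence_exact₃ S.shortComplex_shortExact F x
    (h₃.elim _ _) (add_comm 1 n)
  have hy0 : y = 0 := vanishes_iff.mp hUV y
  subst hy0
  exact hy.symm.trans (Ext.comp_zero ..)

/-- The constant sheaf `ℤ`, which defines `Sheaf.H`, and `freeSheaf ⊤` both corepresent global
sections. Hence they are isomorphic. -/
lemma subsingleton_H_iff_vanishes (F : AbSheaf T) (n : ℕ) :
    Subsingleton (F.H n) ↔ Vanishes n ⊤ F := by
  let Z := (constantSheaf (Opens.grothendieckTopology T) AddCommGrpCat.{u}).obj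
    (AddCommGrpCat.of (ULift ℤ))
  let e (G : AbSheaf T) : (Z ⟶ G) ≃ (freeSheaf ⊤ ⟶ G) :=
    (((constantSheafAdj (Opens.grothendieckTopology T) AddCommGrpCat.{u}
      isTerminalTop).homAddEquiv _ G).trans (AddCommGrpCat.uliftZMultiplesAddEquiv _)).toEquiv.trans
      (freeSheafEquiv ⊤ G).symm
  have he {G G' : AbSheaf T} (a : Z ⟶ G) (φ : G ⟶ G') : e G' (a ≫ φ) = e G a ≫ φ := by
    apply (freeSheafEquiv ⊤ G').injective
    rw [freeSheafEquiv_comp]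
    simp only [e, Equiv.trans_apply, Equiv.apply_symm_apply]
    rfl
  let i : freeSheaf ⊤ ⟶ Z := e Z (𝟙 Z)
  let j : Z ⟶ freeSheaf ⊤ := (e _).symm (𝟙 _)
  have hij : i ≫ j = 𝟙 _ := by rw [← he, Category.id_comp, Equiv.apply_symm_apply]
  have hji : j ≫ i = 𝟙 _ := by
    apply (e _).injective
    rw [he, Equiv.apply_symm_apply, Category.id_comp]
  constructor
  · intro h
    refine vanishes_iff.mpr fun x ↦ ?_
    have h0 : (Ext.mk₀ j).comp x (zero_add n) = 0 := h.elim _ _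
    have := congr((Ext.mk₀ i).comp $h0 (zero_add n))
    rwa [Ext.mk₀_comp_mk₀_assoc, hij, Ext.mk₀_id_comp, Ext.comp_zero] at this
  · intro h
    refine subsingleton_of_forall_eq 0 fun x ↦ ?_
    have h0 : (Ext.mk₀ i).comp x (zero_add n) = 0 := h.elim _ _
    have := congr((Ext.mk₀ j).comp $h0 (zero_add n))
    rwa [Ext.mk₀_comp_mk₀_assoc, hji, Ext.mk₀_id_comp, Ext.comp_zero] at this

lemma vanishes_zero_iff {U : Opens T} {F : AbSheaf T} :
    Vanishes 0 U F ↔ Subsingleton (F.obj.obj (op U)) :=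
  (Equiv.subsingleton_congr Ext.homEquiv₀).trans
    (Equiv.subsingleton_congr (freeSheafEquiv U F))

end AbSheaf

/-! ### Sheaves of modules on schemes -/

/-- The forgetful functor from sheaves of modules to abelian sheaves. -/
abbrev abF (X : Scheme.{u}) : X.Modules ⥤ AbSheaf X.toTopCat :=
  SheafOfModules.toSheaf X.ringCatSheaf

instance (X : Scheme.{u}) : (abF X).Faithful :=
  inferInstanceAs (SheafOfModules.toSheaf X.ringCatSheaf).Faithful

instance (X : Scheme.{u}) : (abF X).Additive :=
  inferInstanceAs (SheafOfModules.toSheaf X.ringCatSheaf).Additive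

instance (X : Scheme.{u}) : PreservesFiniteLimits (abF X) :=
  inferInstanceAs (PreservesFiniteLimits (SheafOfModules.toSheaf X.ringCatSheaf))

section Modules

variable {X : Scheme.{u}}

/-- The abelian sheaf underlying a sheaf of modules. -/
abbrev ab (M : X.Modules) : AbSheaf X.toTopCat := (abF X).obj M

/-- The sections of a sheaf of modules over an open subset. -/
abbrev Sec (M : X.Modules) (U : X.Opens) : Type u := (ab M).obj.obj (op U)

/-- The map induced on sections by a morphism of sheaves of modules. -/
abbrev homSec {M N : X.Modules} (φ : M ⟶ N) (U : X.Opens) : Sec M U →+ Sec N U :=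
  secMap ((abF X).map φ) U

instance moduleSec (M : X.Modules) (U : X.Opens) : Module Γ(X, U) (Sec M U) :=
  inferInstanceAs (Module Γ(X, U) Γ(M, U))

/-- Restriction of regular functions. -/
def resO {V U : X.Opens} (h : V ≤ U) : Γ(X, U) →+* Γ(X, V) := (X.presheaf.map (homOfLE h).op).hom

@[simp]
lemma resO_resO {W V U : X.Opens} (h : W ≤ V) (h' : V ≤ U) (r : Γ(X, U)) :
    resO h (resO h' r) = resO (h.trans h') r := by
  change (X.presheaf.map _ ≫ X.presheaf.map _) r = _
  rw [← X.presheaf.map_comp]; rfl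

@[simp]
lemma resO_self {U : X.Opens} (r : Γ(X, U)) : resO le_rfl r = r := by
  change X.presheaf.map (𝟙 _) r = r
  rw [X.presheaf.map_id]; rfl

lemma basicOpen_resO {V U : X.Opens} (h : V ≤ U) (r : Γ(X, U)) :
    X.basicOpen (resO h r) = V ⊓ X.basicOpen r := X.basicOpen_res r (homOfLE h).op

lemma res_smul (M : X.Modules) {V U : X.Opens} (h : V ≤ U) (r : Γ(X, U)) (x : Sec M U) :
    res (ab M) h (r • x) = resO h r • res (ab M) h x := M.map_smul (homOfLE h) r x

lemma homSec_smul {M N : X.Modules} (φ : M ⟶ N) {U : X.Opens} (r : Γ(X, U)) (x : Sec M U) :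
    homSec φ U (r • x) = r • homSec φ U x := φ.app_smul r x

lemma homSec_comp {M N P : X.Modules} (φ : M ⟶ N) (ψ : N ⟶ P) (U : X.Opens) (x : Sec M U) :
    homSec (φ ≫ ψ) U x = homSec ψ U (homSec φ U x) := rfl

lemma Modules.hom_ext {M N : X.Modules} {φ ψ : M ⟶ N} (h : ∀ U x, homSec φ U x = homSec ψ U x) :
    φ = ψ :=
  (abF X).map_injective (AbSheaf.hom_ext h)

/-- A morphism of abelian sheaves which is linear on sections is a morphism of sheaves of
modules. -/
lemma exists_hom_of_linear {M N : X.Modules} (φ : ab M ⟶ ab N)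
    (h : ∀ (U : X.Opens) (r : Γ(X, U)) (x : Sec M U), secMap φ U (r • x) = r • secMap φ U x) :
    ∃ ψ : M ⟶ N, (abF X).map ψ = φ :=
  ⟨⟨PresheafOfModules.homMk φ.hom fun U r m ↦ h U.unop r m⟩, rfl⟩

lemma exists_affine_mem_le {U : X.Opens} {p : X} (hp : p ∈ U) :
    ∃ V : X.Opens, IsAffineOpen V ∧ p ∈ V ∧ V ≤ U := by
  obtain ⟨V, hV, hpV, h⟩ := Opens.isBasis_iff_nbhd.mp X.isBasis_affineOpens hp
  exact ⟨V, hV, hpV, h⟩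

/-- A family of submodules of sections, defined by a local condition, is a subsheaf. -/
lemma exists_subsheaf (M : X.Modules) (p : ∀ U : X.Opens, Submodule Γ(X, U) (Sec M U))
    (hres : ∀ {V U : X.Opens} (h : V ≤ U) (x : Sec M U), x ∈ p U → res (ab M) h x ∈ p V)
    (hloc : ∀ {U : X.Opens} (x : Sec M U), (∀ q ∈ U, ∃ (V : X.Opens) (h : V ≤ U), q ∈ V ∧
      res (ab M) h x ∈ p V) → x ∈ p U) :
    ∃ (N : X.Modules) (ι : N ⟶ M), (∀ U x, homSec ι U x = 0 → x = 0) ∧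
      ∀ U m, m ∈ p U ↔ ∃ x, homSec ι U x = m := by
  let P : PresheafOfModules.Submodule M.val :=
    { obj U := p U.unop
      map {U V} f x hx := hres (leOfHom f.unop) x hx }
  have hP : TopCat.Presheaf.IsSheaf (X := X.toTopCat) P.toPresheafOfModules.presheaf := by
    rw [TopCat.Presheaf.isSheaf_iff_isSheafUniqueGluing]
    intro ι U s hs
    obtain ⟨x, hx, hx'⟩ := TopCat.Sheaf.existsUnique_gluing (ab M) U
      (fun i ↦ Subtype.val (p := (· ∈ p (U i))) (s i))
      (fun i j ↦ congr_arg (Subtype.val (p := (· ∈ p (U i ⊓ U j)))) (hs i j))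
    have hxp : x ∈ p (iSup U) := by
      apply hloc
      intro q hq
      obtain ⟨i, hi⟩ := Opens.mem_iSup.mp hq
      refine ⟨U i, le_iSup U i, hi, ?_⟩
      rw [show res (ab M) (le_iSup U i) x = _ from hx i]
      exact (s i : p (U i)).2
    refine ⟨(⟨x, hxp⟩ : p (iSup U)), fun i ↦ Subtype.ext (hx i), fun y hy ↦ ?_⟩
    exact Subtype.ext (hx' _ fun i ↦ congr_arg (Subtype.val (p := (· ∈ p (U i)))) (hy i))
  let N : X.Modules := ⟨P.toPresheafOfModules, hP⟩
  let ι : N ⟶ M := ⟨P.ι⟩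
  exact ⟨N, ι, fun U x hx ↦ Subtype.ext hx, fun U m ↦
    ⟨fun hm ↦ ⟨(⟨m, hm⟩ : p U), rfl⟩, by rintro ⟨x, rfl⟩; exact (x : p U).2⟩⟩

lemma injective_homSec_of_mono {M N : X.Modules} (φ : M ⟶ N) [Mono φ] (U : X.Opens) (x : Sec M U)
    (hx : homSec φ U x = 0) : x = 0 := by
  have : Mono ((abF X).map φ) := inferInstance
  exact injective_secMap_of_mono ((abF X).map φ) U (hx.trans (map_zero _).symm)

lemma mono_of_injective_homSec {M N : X.Modules} (φ : M ⟶ N)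
    (h : ∀ U x, homSec φ U x = 0 → x = 0) : Mono φ :=
  (abF X).mono_of_mono_map (mono_of_injective_secMap _ h)

/-- The local image of `φ` is a submodule `I` of `N` through which `φ` factors. Since `φ` is epi,
the cokernel of `I ⟶ N` is zero, so `I` is all of `N`. -/
lemma locally_surjective_of_epi {M N : X.Modules} (φ : M ⟶ N) [Epi φ] (U : X.Opens) (z : Sec N U)
    (q : X) (hq : q ∈ U) : ∃ (V : X.Opens) (h : V ≤ U) (x : Sec M V), q ∈ V ∧
      homSec φ V x = res (ab N) h z := by
  let p (U : X.Opens) : Submodule Γ(X, U) (Sec N U) :=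
    { carrier := {z | ∀ q ∈ U, ∃ (V : X.Opens) (h : V ≤ U) (x : Sec M V), q ∈ V ∧
        homSec φ V x = res (ab N) h z}
      add_mem' := by
        intro z w hz hw q hq
        obtain ⟨V, hV, x, hqV, hx⟩ := hz q hq
        obtain ⟨V', hV', x', hqV', hx'⟩ := hw q hq
        refine ⟨V ⊓ V', inf_le_left.trans hV, res _ inf_le_left x + res _ inf_le_right x',
          ⟨hqV, hqV'⟩, ?_⟩
        rw [map_add, secMap_res, secMap_res, hx, hx', res_res, res_res, map_add]
      zero_mem' := fun q hq ↦ ⟨U, le_rfl, 0, hq, by simp⟩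
      smul_mem' := by
        intro r z hz q hq
        obtain ⟨V, hV, x, hqV, hx⟩ := hz q hq
        exact ⟨V, hV, resO hV r • x, hqV, by rw [homSec_smul, hx, res_smul]⟩ }
  obtain ⟨I, ι, hι, hp⟩ := exists_subsheaf N p
    (fun {V U} h z hz q hq ↦ by
      obtain ⟨W, hW, x, hqW, hx⟩ := hz q (h hq)
      refine ⟨V ⊓ W, inf_le_left, res _ inf_le_right x, ⟨hq, hqW⟩, ?_⟩
      rw [secMap_res, hx, res_res, res_res])
    (fun {U} z hz q hq ↦ by
      obtain ⟨V, hV, hqV, h⟩ := hz q hq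
      obtain ⟨W, hW, x, hqW, hx⟩ := h q hqV
      exact ⟨W, hW.trans hV, x, hqW, by rw [hx, res_res]⟩)
  have hfac (U : X.Opens) (x : Sec M U) : ∃ y, homSec ι U y = homSec φ U x :=
    (hp U _).mp fun q hq ↦ ⟨U, le_rfl, x, hq, by rw [res_self]⟩
  have hmono : Mono ι := mono_of_injective_homSec ι hι
  have : cokernel.π ι = 0 := by
    rw [← cancel_epi φ, comp_zero]
    refine Modules.hom_ext fun U x ↦ ?_
    obtain ⟨y, hy⟩ := hfac U x
    rw [homSec_comp, ← hy, ← homSec_comp, cokernel.condition]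
    rfl
  have hepi : Epi ι := Abelian.epi_of_cokernel_π_eq_zero ι this
  have hiso : IsIso ι := isIso_of_mono_of_epi ι
  refine (hp U z).mpr ⟨homSec (inv ι) U z, ?_⟩ q hq
  rw [← homSec_comp, IsIso.inv_hom_id]
  rfl

lemma SES.of_modules {S : ShortComplex X.Modules} (hS : S.ShortExact) :
    SES ((abF X).map S.f) ((abF X).map S.g) := by
  have hm := hS.mono_f
  have he := hS.epi_g
  have hex := (((Functor.preservesFiniteLimits_tfae (abF X)).out 1 3 rfl rfl).mpr
    inferInstance S ⟨hS.exact, hm⟩)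
  refine ⟨fun U x hx ↦ injective_homSec_of_mono S.f U x hx, fun U x ↦ ?_, fun U x hx ↦ ?_,
    fun U z p hp ↦ locally_surjective_of_epi S.g U z p hp⟩
  · rw [← homSec_comp, S.zero]; rfl
  · exact TopCat.Sheaf.sections_exact_of_left_exact hex.1 hex.2 x hx

lemma ses_cokernel {M N : X.Modules} (φ : M ⟶ N) (h : ∀ U x, homSec φ U x = 0 → x = 0) :
    SES ((abF X).map φ) ((abF X).map (cokernel.π φ)) := by
  have hφ : Mono φ := mono_of_injective_homSec φ h
  have hψ : Epi (cokernel.π φ) := inferInstance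
  exact SES.of_modules (S := ShortComplex.mk φ (cokernel.π φ) (cokernel.condition φ))
    (.mk' (ShortComplex.exact_of_g_is_cokernel _ (cokernelIsCokernel φ)) hφ hψ)

/-- Every morphism of sheaves of modules factors through its image. -/
lemma exists_ses_image {M N : X.Modules} (φ : M ⟶ N) :
    ∃ (K I C : X.Modules) (k : K ⟶ M) (e : M ⟶ I) (i : I ⟶ N) (c : N ⟶ C),
      SES ((abF X).map k) ((abF X).map e) ∧ SES ((abF X).map i) ((abF X).map c) ∧ e ≫ i = φ := by
  have hk : Mono (kernel.ι φ) := inferInstance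
  have h₁ := ses_cokernel (kernel.ι φ) (fun U ↦ injective_homSec_of_mono _ U)
  have hi : Mono (Abelian.factorThruCoimage φ) := inferInstance
  have h₂ := ses_cokernel (Abelian.factorThruCoimage φ) (fun U ↦ injective_homSec_of_mono _ U)
  exact ⟨_, _, _, _, _, _, _, h₁, h₂, Abelian.coimage.fac φ⟩

end Modules

/-! ### Quasi-coherence through localization of sections. -/

section LQC

variable {X : Scheme.{u}}

/-- The sections of `M` over affine open subsets localize well. This is quasi-coherence, expressed
in terms of elements. -/
structure LQC (M : X.Modules) : Prop where
  ext : ∀ {U : X.Opens}, IsAffineOpen U → ∀ (f : Γ(X, U)) {V : X.Opens}, V = X.basicOpen f →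
    ∀ (h : V ≤ U) (s : Sec M V), ∃ (n : ℕ) (t : Sec M U), res (ab M) h t = resO h f ^ n • s
  tors : ∀ {U : X.Opens}, IsAffineOpen U → ∀ (f : Γ(X, U)) {V : X.Opens}, V = X.basicOpen f →
    ∀ (h : V ≤ U) (t : Sec M U), res (ab M) h t = 0 → ∃ n : ℕ, f ^ n • t = 0

/-- Quasi-compactness of an affine open subset in algebraic form: a finite cover is encoded by
finitely many functions generating the unit ideal. -/
lemma exists_basicOpen_cover {U : X.Opens} (hU : IsAffineOpen U) (P : ∀ V : X.Opens, V ≤ U → Prop)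
    (hP : ∀ {V W : X.Opens} (hWV : W ≤ V) (hV : V ≤ U), P V hV → P W (hWV.trans hV))
    (h : ∀ p ∈ U, ∃ (V : X.Opens) (hV : V ≤ U), p ∈ V ∧ P V hV) :
    ∃ s : Finset Γ(X, U), Ideal.span (s : Set Γ(X, U)) = ⊤ ∧
      ∀ g ∈ s, P (X.basicOpen g) (X.basicOpen_le g) := by
  let S : Set Γ(X, U) := {g | P (X.basicOpen g) (X.basicOpen_le g)}
  have hS : Ideal.span S = ⊤ := by
    rw [← hU.iSup_basicOpen_eq_self_iff]
    refine le_antisymm (iSup_le fun g ↦ X.basicOpen_le _) fun p hp ↦ ?_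
    obtain ⟨V, hV, hpV, hPV⟩ := h p hp
    obtain ⟨g, hg, hpg⟩ := hU.exists_basicOpen_le ⟨p, hpV⟩ hp
    exact Opens.mem_iSup.mpr ⟨⟨g, hP hg hV hPV⟩, hpg⟩
  obtain ⟨s, hs, hs'⟩ := Submodule.mem_span_finite_of_mem_span
    (show (1 : Γ(X, U)) ∈ Ideal.span S by rw [hS]; trivial)
  exact ⟨s, (Ideal.eq_top_iff_one _).mpr hs', fun g hg ↦ hs hg⟩

lemma le_iSup_basicOpen {U : X.Opens} (hU : IsAffineOpen U) {s : Finset Γ(X, U)}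
    (hs : Ideal.span (s : Set Γ(X, U)) = ⊤) : U ≤ ⨆ g : s, X.basicOpen g.1 :=
  (hU.iSup_basicOpen_eq_self_iff.mpr hs).ge

lemma exists_forall_of_finset {α : Type*} (s : Finset α) (P : α → ℕ → Prop)
    (hP : ∀ a n m, n ≤ m → P a n → P a m) (h : ∀ a ∈ s, ∃ n, P a n) : ∃ n, ∀ a ∈ s, P a n := by
  classical
  choose! n hn using h
  exact ⟨s.sup n, fun a ha ↦ hP a _ _ (Finset.le_sup ha) (hn a ha)⟩

lemma SES.exists_lift_cover {F E G : X.Modules} {φ : F ⟶ E} {ψ : E ⟶ G}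
    (h : SES ((abF X).map φ) ((abF X).map ψ)) {U : X.Opens} (hU : IsAffineOpen U) (z : Sec G U) :
    ∃ s : Finset Γ(X, U), Ideal.span (s : Set Γ(X, U)) = ⊤ ∧
      ∀ g ∈ s, ∃ x, homSec ψ (X.basicOpen g) x = res (ab G) (X.basicOpen_le g) z :=
  exists_basicOpen_cover hU (fun W hW ↦ ∃ x, homSec ψ W x = res (ab G) hW z)
    (fun {W W'} hle hW ⟨x, hx⟩ ↦ ⟨res _ hle x, by rw [secMap_res, hx, res_res]⟩)
    (fun p hp ↦ by
      obtain ⟨W, hW, x, hpW, hx⟩ := h.surj U z p hp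
      exact ⟨W, hW, hpW, x, hx⟩)

section Quotient

variable {F E G : X.Modules} {φ : F ⟶ E} {ψ : E ⟶ G} (h : SES ((abF X).map φ) ((abF X).map ψ))
  (hF : LQC F) (hE : LQC E)
include h hF hE

/-- On a small basic open subset `z` lifts to a section `x` of `E`. Where `f` is invertible `x`
comes from `F`; a power of `f` extends that section of `F`, and a further power makes it agree with
the multiple of `x`. So a power of `f` kills `z` there, and one exponent serves the finite cover. -/
lemma SES.lqc_tors {U : X.Opens} (hU : IsAffineOpen U) (f : Γ(X, U)) {V : X.Opens}
    (hV : V = X.basicOpen f) (hVU : V ≤ U) (z : Sec G U) (hz : res (ab G) hVU z = 0) :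
    ∃ n : ℕ, f ^ n • z = 0 := by
  obtain ⟨s, hs, hs'⟩ := h.exists_lift_cover hU z
  obtain ⟨n, hn⟩ := exists_forall_of_finset s
    (fun g n ↦ res (ab G) (X.basicOpen_le g) (f ^ n • z) = 0)
    (fun g n m hnm hn ↦ by
      obtain ⟨k, rfl⟩ := Nat.exists_eq_add_of_le' hnm
      rw [pow_add, mul_smul, res_smul, hn, smul_zero])
    (fun g hg ↦ by
      obtain ⟨x, hx⟩ := hs' g hg
      have hg' : IsAffineOpen (X.basicOpen g) := hU.basicOpen g
      have hgU := X.basicOpen_le g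
      let f' := resO hgU f
      let W := X.basicOpen f'
      have hWV : W ≤ V := by rw [hV, show W = _ from basicOpen_resO _ _]; exact inf_le_right
      have hWg : W ≤ X.basicOpen g := X.basicOpen_le f'
      obtain ⟨y, hy⟩ := h.exact W (res _ hWg x) (by
        rw [secMap_res, hx, res_res, ← res_res (ab G) hWV hVU, hz, map_zero])
      obtain ⟨n, y', hy'⟩ := hF.ext hg' f' rfl hWg y
      obtain ⟨m, hm⟩ := hE.tors hg' f' rfl hWg (f' ^ n • x - homSec φ _ y') (by
        rw [map_sub, res_smul, map_pow, ← secMap_res, hy', homSec_smul, hy, sub_self])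
      refine ⟨m + n, ?_⟩
      have := congr(homSec ψ _ $hm)
      rw [homSec_smul, map_sub, h.zero, sub_zero, homSec_smul, hx, map_zero] at this
      rw [pow_add, mul_smul, res_smul, res_smul, map_pow, map_pow]
      exact this)
  refine ⟨n, AbSheaf.eq_of_locally_eq (ab G) (fun g : s ↦ X.basicOpen g.1)
    (fun g ↦ X.basicOpen_le _) (le_iSup_basicOpen hU hs) fun g ↦ ?_⟩
  rw [hn g.1 g.2, map_zero]

/-- On affine open subsets, the quotient of quasi-coherent modules is computed on sections. -/
lemma SES.lqc_surjective {U : X.Opens} (hU : IsAffineOpen U) :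
    Function.Surjective (homSec ψ U) := by
  intro z
  -- The functions `a` for which `a • z` lifts form an ideal. It contains a power of each `g` such
  -- that `z` lifts over `D(g)`; these `g` generate the unit ideal, hence so do their powers.
  let I : Ideal Γ(X, U) :=
    { carrier := {a | ∃ x, homSec ψ U x = a • z}
      add_mem' := by
        rintro a b ⟨x, hx⟩ ⟨y, hy⟩
        exact ⟨x + y, by rw [map_add, hx, hy, add_smul]⟩
      zero_mem' := ⟨0, by rw [map_zero, zero_smul]⟩
      smul_mem' := by
        rintro a b ⟨x, hx⟩
        exact ⟨a • x, by rw [homSec_smul, hx, smul_smul, smul_eq_mul]⟩ }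
  obtain ⟨s, hs, hs'⟩ := h.exists_lift_cover hU z
  obtain ⟨n, hn⟩ := exists_forall_of_finset s (fun g n ↦ g ^ n ∈ I)
    (fun g n m hnm hn ↦ I.pow_mem_of_pow_mem hn hnm)
    (fun g hg ↦ by
      obtain ⟨x, hx⟩ := hs' g hg
      obtain ⟨n, t, ht⟩ := hE.ext hU g rfl (X.basicOpen_le g) x
      obtain ⟨m, hm⟩ := h.lqc_tors hF hE hU g rfl (X.basicOpen_le g) (homSec ψ U t - g ^ n • z) (by
        rw [map_sub, ← secMap_res, ht, homSec_smul, hx, res_smul, map_pow, sub_self])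
      refine ⟨m + n, g ^ m • t, ?_⟩
      rw [smul_sub, sub_eq_zero] at hm
      rw [homSec_smul, hm, smul_smul, pow_add])
  have hI : I = ⊤ := by
    rw [eq_top_iff, ← Ideal.span_pow_eq_top _ hs n, Ideal.span_le]
    rintro _ ⟨g, hg, rfl⟩
    exact hn g hg
  obtain ⟨x, hx⟩ := (Ideal.eq_top_iff_one I).mp hI
  exact ⟨x, by rw [hx, one_smul]⟩

lemma SES.lqc : LQC G where
  tors hU f V hV hVU t ht := h.lqc_tors hF hE hU f hV hVU t ht
  ext {U} hU f V hV hVU s := by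
    have hVa : IsAffineOpen V := hV ▸ hU.basicOpen f
    obtain ⟨x, rfl⟩ := h.lqc_surjective hF hE hVa s
    obtain ⟨n, t, ht⟩ := hE.ext hU f hV hVU x
    exact ⟨n, homSec ψ U t, by rw [← secMap_res, ht, homSec_smul]⟩

end Quotient

lemma LQC.of_kernel {F E G : X.Modules} {φ : F ⟶ E} {ψ : E ⟶ G}
    (inj : ∀ U x, homSec φ U x = 0 → x = 0)
    (zero : ∀ U x, homSec ψ U (homSec φ U x) = 0)
    (exact : ∀ U x, homSec ψ U x = 0 → ∃ y, homSec φ U y = x) (hE : LQC E) (hG : LQC G) :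
    LQC F where
  tors {U} hU f V hV hVU t ht := by
    obtain ⟨n, hn⟩ := hE.tors hU f hV hVU (homSec φ U t) (by rw [← secMap_res, ht, map_zero])
    exact ⟨n, inj U _ (by rw [homSec_smul, hn])⟩
  ext {U} hU f V hV hVU s := by
    obtain ⟨n, t, ht⟩ := hE.ext hU f hV hVU (homSec φ V s)
    obtain ⟨m, hm⟩ := hG.tors hU f hV hVU (homSec ψ U t) (by
      rw [← secMap_res, ht, homSec_smul, zero, smul_zero])
    obtain ⟨y, hy⟩ := exact U (f ^ m • t) (by rw [homSec_smul, hm])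
    refine ⟨m + n, y, ?_⟩
    rw [← sub_eq_zero]
    apply inj
    rw [map_sub, secMap_res, hy, res_smul, ht, homSec_smul, map_pow, smul_smul, pow_add, sub_self]

/-! ### Finite direct sums -/

lemma homSec_sum {M N : X.Modules} {ι : Type*} (s : Finset ι) (φ : ι → (M ⟶ N)) (U : X.Opens)
    (x : Sec M U) : homSec (∑ i ∈ s, φ i) U x = ∑ i ∈ s, homSec (φ i) U x := by
  classical
  induction s using Finset.induction_on with
  | empty => simp only [Finset.sum_empty]; rfl
  | insert a s ha ih => rw [Finset.sum_insert ha, Finset.sum_insert ha, ← ih]; rfl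

section Biproduct

instance (X : Scheme.{u}) : HasFiniteBiproducts X.Modules := Abelian.hasFiniteBiproducts

variable {ι : Type} [Fintype ι] (M : ι → X.Modules)

lemma biproduct_sec_total (U : X.Opens) (x : Sec (⨁ M) U) :
    ∑ i, homSec (biproduct.ι M i) U (homSec (biproduct.π M i) U x) = x := by
  have := congr(homSec $(biproduct.total (f := M)) U x)
  rw [homSec_sum] at this
  exact this

lemma biproduct_sec_ext {U : X.Opens} {x y : Sec (⨁ M) U}
    (h : ∀ i, homSec (biproduct.π M i) U x = homSec (biproduct.π M i) U y) : x = y := by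
  rw [← biproduct_sec_total M U x, ← biproduct_sec_total M U y]
  simp only [h]

lemma exists_biproduct_sec {U : X.Opens} (s : ∀ i, Sec (M i) U) :
    ∃ x : Sec (⨁ M) U, ∀ i, homSec (biproduct.π M i) U x = s i := by
  classical
  refine ⟨∑ i, homSec (biproduct.ι M i) U (s i), fun j ↦ ?_⟩
  rw [map_sum, Finset.sum_eq_single j]
  · rw [← homSec_comp, biproduct.ι_π_self]; rfl
  · intro i _ hij
    rw [← homSec_comp, biproduct.ι_π_ne _ hij]; rfl
  · simp

lemma LQC.biproduct {M : ι → X.Modules} (h : ∀ i, LQC (M i)) : LQC (⨁ M) := by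
  refine ⟨fun {U} hU f V hV hVU s ↦ ?_, fun {U} hU f V hV hVU t ht ↦ ?_⟩
  · obtain ⟨n, hn⟩ := exists_forall_of_finset Finset.univ
      (fun i n ↦ ∃ t : Sec (M i) U, res _ hVU t = resO hVU f ^ n • homSec (biproduct.π M i) V s)
      (fun i n m hnm ⟨t, ht⟩ ↦ by
        obtain ⟨k, rfl⟩ := Nat.exists_eq_add_of_le' hnm
        exact ⟨f ^ k • t, by rw [res_smul, ht, map_pow, smul_smul, pow_add]⟩)
      (fun i _ ↦ (h i).ext hU f hV hVU _)
    choose t ht using fun i ↦ hn i (Finset.mem_univ i)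
    obtain ⟨x, hx⟩ := exists_biproduct_sec M t
    refine ⟨n, x, biproduct_sec_ext M fun i ↦ ?_⟩
    rw [secMap_res, hx, ht, homSec_smul]
  · obtain ⟨n, hn⟩ := exists_forall_of_finset Finset.univ
      (fun i n ↦ f ^ n • homSec (biproduct.π M i) U t = 0)
      (fun i n m hnm hn ↦ by
        obtain ⟨k, rfl⟩ := Nat.exists_eq_add_of_le' hnm
        rw [pow_add, mul_smul, hn, smul_zero])
      (fun i _ ↦ (h i).tors hU f hV hVU _ (by rw [← secMap_res, ht, map_zero]))
    refine ⟨n, biproduct_sec_ext M fun i ↦ ?_⟩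
    rw [homSec_smul, hn i (Finset.mem_univ i), map_zero]

lemma eq_zero_of_comp_biproduct_π {U : X.Opens} {n : ℕ} (x : Abelian.Ext (freeSheaf U) (ab (⨁ M)) n)
    (h : ∀ i, x.comp (Abelian.Ext.mk₀ ((abF X).map (biproduct.π M i))) (add_zero n) = 0) : x = 0 := by
  have key : 𝟙 (ab (⨁ M)) =
      ∑ i, (abF X).map (biproduct.π M i) ≫ (abF X).map (biproduct.ι M i) := by
    rw [← (abF X).map_id, ← biproduct.total, Functor.map_sum]
    simp only [Functor.map_comp]
  have : x = x.comp (Abelian.Ext.mk₀ (𝟙 (ab (⨁ M)))) (add_zero n) := by simp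
  rw [this, key, Abelian.Ext.mk₀_sum, Abelian.Ext.comp_sum]
  refine Finset.sum_eq_zero fun i _ ↦ ?_
  rw [← Abelian.Ext.mk₀_comp_mk₀, ← Abelian.Ext.comp_assoc _ _ _ (add_zero n) (add_zero 0) (by omega), h,
    Abelian.Ext.zero_comp]

lemma vanishes_biproduct {U : X.Opens} {n : ℕ} (h : ∀ i, Vanishes n U (ab (M i))) :
    Vanishes n U (ab (⨁ M)) :=
  vanishes_iff.mpr fun x ↦ eq_zero_of_comp_biproduct_π M x fun i ↦ vanishes_iff.mp (h i) _

end Biproduct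

end LQC

/-- A functor between lattices of open subsets is continuous as soon as it preserves covers and
binary intersections. -/
lemma isContinuous_of_opens {T T' : TopCat.{u}} (θ : Opens T ⥤ Opens T')
    (hinf : ∀ U V : Opens T, θ.obj U ⊓ θ.obj V ≤ θ.obj (U ⊓ V))
    (hcov : ∀ (U : Opens T), ∀ p ∈ θ.obj U, ∃ q ∈ U, ∀ V : Opens T, q ∈ V → p ∈ θ.obj V) :
    θ.IsContinuous (Opens.grothendieckTopology T) (Opens.grothendieckTopology T') := by
  refine Functor.isContinuous_of_coverPreserving ⟨?_⟩ ⟨?_⟩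
  · intro ℱ Z S x hx Y₁ Y₂ A f₁ f₂ g₁ g₂ hg₁ hg₂ e
    have hA : A ≤ θ.obj (Y₁ ⊓ Y₂) := (le_inf (leOfHom f₁) (leOfHom f₂)).trans (hinf _ _)
    have h := hx (homOfLE inf_le_left : Y₁ ⊓ Y₂ ⟶ Y₁) (homOfLE inf_le_right) hg₁ hg₂ rfl
    have h' := congr(ℱ.obj.map (homOfLE hA).op $h)
    change (ℱ.obj.map _ ≫ ℱ.obj.map _) _ = (ℱ.obj.map _ ≫ ℱ.obj.map _) _ at h'
    rw [← ℱ.obj.map_comp, ← ℱ.obj.map_comp] at h'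
    exact h'
  · intro U S hS p hp
    obtain ⟨q, hq, h⟩ := hcov U p hp
    obtain ⟨V, f, hf, hqV⟩ := hS q hq
    exact ⟨θ.obj V, θ.map f, ⟨V, f, 𝟙 _, hf, by simp⟩, h V hqV⟩

/-! ### Direct image of the restriction to an open subset. -/

section PushRes

/-- Intersection with `W`, as a functor. -/
def interFunctor {T : TopCat.{u}} (W : Opens T) : Opens T ⥤ Opens T :=
  Monotone.functor (f := fun V ↦ W ⊓ V) fun _ _ h ↦ inf_le_inf_left W h

instance {T : TopCat.{u}} (W : Opens T) : (interFunctor W).IsContinuous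
    (Opens.grothendieckTopology T) (Opens.grothendieckTopology T) :=
  isContinuous_of_opens _ (fun U V ↦ (inf_inf_distrib_left W U V).ge)
    fun _ p hp ↦ ⟨p, hp.2, fun _ hV ↦ ⟨hp.1, hV⟩⟩

variable {X : Scheme.{u}}

instance modulePushRes (W : X.Opens) (F : X.Modules) (V : (X.Opens)ᵒᵖ) :
    Module (X.ringCatSheaf.obj.obj V) (((pull (interFunctor W)).obj (ab F)).obj.obj V) :=
  Module.compHom (Sec F (W ⊓ V.unop)) (resO (inf_le_right : W ⊓ V.unop ≤ V.unop))

/-- The direct image of the restriction of `F` to the open subset `W`: its sections over `V` are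
the sections of `F` over `W ⊓ V`. -/
def pushRes (W : X.Opens) (F : X.Modules) : X.Modules :=
  ⟨PresheafOfModules.ofPresheaf (R := X.ringCatSheaf.obj) ((pull (interFunctor W)).obj (ab F)).obj
    (fun {V V'} f r x ↦ by
      refine (res_smul F (leOfHom ((interFunctor W).map f.unop)) _ x).trans ?_
      refine congrArg (fun a : Γ(X, W ⊓ V'.unop) ↦
        a • res (ab F) (inf_le_inf_left W (leOfHom f.unop)) x) ?_
      exact (resO_resO _ _ r).trans
        (resO_resO (inf_le_right : W ⊓ V'.unop ≤ V'.unop) (leOfHom f.unop) r).symm), ((pull (interFunctor W)).obj (ab F)).property⟩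

variable (W : X.Opens) (F : X.Modules)

/-- Sections of `pushRes W F` over `V` are sections of `F` over `W ⊓ V`. -/
def secPush (V : X.Opens) : Sec (pushRes W F) V ≃+ Sec F (W ⊓ V) := AddEquiv.refl _

lemma secPush_res {V U : X.Opens} (h : V ≤ U) (x : Sec (pushRes W F) U) :
    secPush W F V (res _ h x) = res (ab F) (inf_le_inf_left W h) (secPush W F U x) := rfl

lemma secPush_smul {V : X.Opens} (r : Γ(X, V)) (x : Sec (pushRes W F) V) :
    secPush W F V (r • x) = resO (inf_le_right : W ⊓ V ≤ V) r • secPush W F V x := rfl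

lemma exists_toPushRes : ∃ φ : F ⟶ pushRes W F, ∀ U x,
    secPush W F U (homSec φ U x) = res (ab F) inf_le_right x := by
  let φ : ab F ⟶ ab (pushRes W F) :=
    ⟨{ app U := (ab F).obj.map (homOfLE (inf_le_right : W ⊓ U.unop ≤ U.unop)).op
       naturality U V f := by
        exact ((ab F).obj.map_comp f (homOfLE inf_le_right).op).symm.trans
          ((ab F).obj.map_comp (homOfLE (inf_le_right : W ⊓ U.unop ≤ U.unop)).op
            ((interFunctor W).map f.unop).op) }⟩
  obtain ⟨ψ, hψ⟩ := exists_hom_of_linear (M := F) (N := pushRes W F) φ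
    (fun U r x ↦ res_smul F inf_le_right r x)
  exact ⟨ψ, fun U x ↦ by rw [homSec, hψ]; rfl⟩

end PushRes

/-! ### Restriction along open immersions and direct images. -/

section Restrict

variable {X Y : Scheme.{u}} (j : Y ⟶ X) [IsOpenImmersion j] (F : X.Modules)

/-- Sections of the restriction of `F` along an open immersion. -/
def secRestrict (V : Y.Opens) : Sec (F.restrict j) V ≃+ Sec F (j ''ᵁ V) := AddEquiv.refl _

lemma secRestrict_res {V U : Y.Opens} (h : V ≤ U) (x : Sec (F.restrict j) U) :
    secRestrict j F V (res _ h x) =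
      res (ab F) (j.opensFunctor.monotone h) (secRestrict j F U x) := rfl

lemma secRestrict_smul {V : Y.Opens} (r : Γ(Y, V)) (x : Sec (F.restrict j) V) :
    secRestrict j F V (r • x) = (j.appIso V).inv r • secRestrict j F V x := rfl

variable {F} in
lemma LQC.restrict (hF : LQC F) : LQC (F.restrict j) := by
  refine ⟨fun {U} hU f V hV h s ↦ ?_, fun {U} hU f V hV h t ht ↦ ?_⟩
  · obtain ⟨n, t, ht⟩ := hF.ext (hU.image_of_isOpenImmersion j) ((j.appIso U).inv f)
      (V := j ''ᵁ V) (by rw [hV, Scheme.image_basicOpen]) (j.opensFunctor.monotone h)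
      (secRestrict j F V s)
    refine ⟨n, (secRestrict j F U).symm t, (secRestrict j F V).injective ?_⟩
    rw [secRestrict_res, secRestrict_smul, AddEquiv.apply_symm_apply, ht, map_pow]
    congr 2
    exact congr($(j.appIso_inv_naturality (homOfLE h).op) f).symm
  · obtain ⟨n, hn⟩ := hF.tors (hU.image_of_isOpenImmersion j) ((j.appIso U).inv f)
      (V := j ''ᵁ V) (by rw [hV, Scheme.image_basicOpen]) (j.opensFunctor.monotone h)
      (secRestrict j F U t) (by rw [← secRestrict_res j F h, ht, map_zero])
    exact ⟨n, (secRestrict j F U).injective (by rw [secRestrict_smul, map_pow, hn, map_zero])⟩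

lemma vanishes_restrict {n : ℕ} (hn : 1 ≤ n) (U : Y.Opens) :
    Vanishes n U (ab (F.restrict j)) ↔ Vanishes n (j ''ᵁ U) (ab F) := by
  have : j.isOpenEmbedding.isOpenMap.functor.IsContinuous (Opens.grothendieckTopology Y)
      (Opens.grothendieckTopology X) :=
    inferInstanceAs (j.opensFunctor.IsContinuous (Opens.grothendieckTopology Y)
      (Opens.grothendieckTopology X))
  exact vanishes_restrict_iff j.base j.isOpenEmbedding (ab F) hn U

end Restrict

section Pushforward

variable {X Y : Scheme.{u}} (f : Y ⟶ X) (F : Y.Modules)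

/-- Sections of the direct image of `F`. -/
def secPushforward (V : X.Opens) :
    Sec ((Scheme.Modules.pushforward f).obj F) V ≃+ Sec F (f ⁻¹ᵁ V) := AddEquiv.refl _

lemma secPushforward_res {V U : X.Opens} (h : V ≤ U)
    (x : Sec ((Scheme.Modules.pushforward f).obj F) U) :
    secPushforward f F V (res _ h x) = res (ab F) (f.preimage_mono h) (secPushforward f F U x) :=
  rfl

lemma secPushforward_smul {V : X.Opens} (r : Γ(X, V))
    (x : Sec ((Scheme.Modules.pushforward f).obj F) V) :
    secPushforward f F V (r • x) = f.app V r • secPushforward f F V x := rfl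

end Pushforward

/-! ### Localization of sections over arbitrary open subsets of a noetherian scheme. -/

section Noetherian

lemma exists_affineOpen_basis {X : Scheme.{u}} (U : X.Opens) (p : X) (hp : p ∈ U) :
    ∃ V ∈ {V : X.Opens | IsAffineOpen V}, p ∈ V ∧ V ≤ U := by
  obtain ⟨V, h₁, h₂, h₃⟩ := exists_affine_mem_le hp
  exact ⟨V, h₁, h₂, h₃⟩

variable {X : Scheme.{u}} [NoetherianSpace X]

/-- Open subsets of a noetherian scheme have finite covers by small members of a basis. -/
lemma exists_finite_cover {B : Set X.Opens}
    (hB : ∀ (U : X.Opens), ∀ p ∈ U, ∃ V ∈ B, p ∈ V ∧ V ≤ U)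
    (O : X.Opens) (P : ∀ V : X.Opens, V ≤ O → Prop)
    (hP : ∀ {V W : X.Opens} (hWV : W ≤ V) (hV : V ≤ O), P V hV → P W (hWV.trans hV))
    (h : ∀ p ∈ O, ∃ (V : X.Opens) (hV : V ≤ O), p ∈ V ∧ P V hV) :
    ∃ (n : ℕ) (D : Fin n → X.Opens) (hD : ∀ i, D i ≤ O), (∀ i, D i ∈ B) ∧
      (∀ i, P (D i) (hD i)) ∧ O ≤ ⨆ i, D i := by
  have (p : O) : ∃ (V : X.Opens) (hV : V ≤ O), V ∈ B ∧ p.1 ∈ V ∧ P V hV := by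
    obtain ⟨V, hV, hpV, hPV⟩ := h p.1 p.2
    obtain ⟨W, hW, hpW, hWV⟩ := hB V p.1 hpV
    exact ⟨W, hWV.trans hV, hW, hpW, hP hWV hV hPV⟩
  choose V hVO hV hpV hPV using this
  obtain ⟨s, hs⟩ := (NoetherianSpace.isCompact (O : Set X)).elim_finite_subcover
    (fun p : O ↦ (V p : Set X)) (fun p ↦ (V p).isOpen)
    fun p hp ↦ Set.mem_iUnion.mpr ⟨⟨p, hp⟩, hpV ⟨p, hp⟩⟩
  let e := s.equivFin
  refine ⟨s.card, fun i ↦ V (e.symm i), fun i ↦ hVO _, fun i ↦ hV _, fun i ↦ hPV _,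
    fun p hp ↦ ?_⟩
  obtain ⟨q, hq, hpq⟩ := Set.mem_iUnion₂.mp (hs hp)
  exact Opens.mem_iSup.mpr ⟨e ⟨q, hq⟩, by simpa using hpq⟩

lemma exists_finite_cover' {B : Set X.Opens}
    (hB : ∀ (U : X.Opens), ∀ p ∈ U, ∃ V ∈ B, p ∈ V ∧ V ≤ U) (O : X.Opens) :
    ∃ (n : ℕ) (D : Fin n → X.Opens), (∀ i, D i ≤ O) ∧ (∀ i, D i ∈ B) ∧ O ≤ ⨆ i, D i := by
  obtain ⟨n, D, hD, hD', -, h⟩ := exists_finite_cover hB O (fun _ _ ↦ True)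
    (fun _ _ _ ↦ trivial) fun p hp ↦ ⟨O, le_rfl, hp, trivial⟩
  exact ⟨n, D, hD, hD', h⟩

lemma exists_affine_cover (O : X.Opens) : ∃ (n : ℕ) (D : Fin n → X.Opens), (∀ i, D i ≤ O) ∧
    (∀ i, IsAffineOpen (D i)) ∧ O ≤ ⨆ i, D i :=
  exists_finite_cover' exists_affineOpen_basis O

section Basis

variable {F : X.Modules} {B : Set X.Opens}
  (hB : ∀ (U : X.Opens), ∀ p ∈ U, ∃ V ∈ B, p ∈ V ∧ V ≤ U)
  (htors : ∀ U ∈ B, ∀ (f : Γ(X, U)) {V : X.Opens}, V = X.basicOpen f →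
    ∀ (h : V ≤ U) (t : Sec F U), res (ab F) h t = 0 → ∃ n : ℕ, f ^ n • t = 0)
include hB htors

/-- The basis `B` is arbitrary because the result is applied both to affine open subsets and to the
traces of affine open subsets on a closed subscheme. -/
lemma tors_of_basis {O : X.Opens} (f : Γ(X, O)) {V : X.Opens} (hV : V = X.basicOpen f)
    (h : V ≤ O) (t : Sec F O) (ht : res (ab F) h t = 0) : ∃ n : ℕ, f ^ n • t = 0 := by
  obtain ⟨N, D, hD, hD', hO⟩ := exists_finite_cover' hB O
  obtain ⟨n, hn⟩ := exists_forall_of_finset Finset.univ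
    (fun i n ↦ res (ab F) (hD i) (f ^ n • t) = 0)
    (fun g n m hnm hn ↦ by
      obtain ⟨k, rfl⟩ := Nat.exists_eq_add_of_le' hnm
      rw [pow_add, mul_smul, res_smul, hn, smul_zero])
    (fun i _ ↦ by
      obtain ⟨n, hn⟩ := htors _ (hD' i) (resO (hD i) f) (V := D i ⊓ V)
        (by rw [hV, basicOpen_resO]) inf_le_left (res _ (hD i) t)
        (by rw [res_res, ← res_res _ inf_le_right h, ht, map_zero])
      exact ⟨n, by rw [res_smul, map_pow, hn]⟩)
  exact ⟨n, AbSheaf.eq_of_locally_eq (ab F) D hD hO fun i ↦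
    by rw [hn i (Finset.mem_univ i), map_zero]⟩

lemma ext_of_basis (hext : ∀ U ∈ B, ∀ (f : Γ(X, U)) {V : X.Opens}, V = X.basicOpen f →
    ∀ (h : V ≤ U) (s : Sec F V), ∃ (n : ℕ) (t : Sec F U), res (ab F) h t = resO h f ^ n • s)
    {O : X.Opens} (f : Γ(X, O)) {V : X.Opens} (hV : V = X.basicOpen f)
    (h : V ≤ O) (s : Sec F V) :
    ∃ (n : ℕ) (t : Sec F O), res (ab F) h t = resO h f ^ n • s := by
  obtain ⟨N, D, hD, hD', hO⟩ := exists_finite_cover' hB O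
  obtain ⟨n, hn⟩ := exists_forall_of_finset Finset.univ
    (fun i n ↦ ∃ t : Sec F (D i), res (ab F) inf_le_left t =
      res (ab F) (inf_le_right : D i ⊓ V ≤ V) (resO h f ^ n • s))
    (fun i n m hnm ⟨t, ht⟩ ↦ by
      obtain ⟨k, rfl⟩ := Nat.exists_eq_add_of_le' hnm
      refine ⟨resO (hD i) f ^ k • t, ?_⟩
      rw [pow_add, mul_smul, res_smul, res_smul _ _ (_ ^ k), ht]
      simp only [map_pow, resO_resO])
    (fun i _ ↦ by
      obtain ⟨n, t, ht⟩ := hext _ (hD' i) (resO (hD i) f) (V := D i ⊓ V)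
        (by rw [hV, basicOpen_resO]) inf_le_left (res _ inf_le_right s)
      exact ⟨n, t, by rw [ht, res_smul]; simp only [map_pow, resO_resO]⟩)
  choose t ht using fun i ↦ hn i (Finset.mem_univ i)
  -- Two local extensions differ on an overlap by a section killed by a power of `f`. The overlap
  -- need not belong to `B`, but `tors_of_basis` holds over every open subset.
  obtain ⟨m, hm⟩ := exists_forall_of_finset Finset.univ
    (fun (i : Fin N × Fin N) m ↦ resO (inf_le_left.trans (hD i.1)) f ^ m •
      (res (ab F) (inf_le_left : D i.1 ⊓ D i.2 ≤ _) (t i.1) - res (ab F) inf_le_right (t i.2)) = 0)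
    (fun g n m hnm hn ↦ by
      obtain ⟨k, rfl⟩ := Nat.exists_eq_add_of_le' hnm
      rw [pow_add, mul_smul, hn, smul_zero])
    (fun i _ ↦ tors_of_basis hB htors _ (V := D i.1 ⊓ D i.2 ⊓ V)
      (by rw [hV, basicOpen_resO]) inf_le_left _ (by
        rw [map_sub, res_res, res_res,
          ← res_res _ (le_inf (inf_le_left.trans inf_le_left) inf_le_right) inf_le_left (t i.1),
          ← res_res _ (le_inf (inf_le_left.trans inf_le_right) inf_le_right) inf_le_left (t i.2),
          ht, ht, res_res, res_res, sub_self]))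
  obtain ⟨x, hx⟩ := AbSheaf.exists_glue (ab F) D hD hO (fun i ↦ resO (hD i) f ^ m • t i)
    (fun i k ↦ by
      have := hm (i, k) (Finset.mem_univ _)
      rw [smul_sub, sub_eq_zero] at this
      rw [res_smul, res_smul]
      simpa only [map_pow, resO_resO] using this)
  refine ⟨m + n, x, AbSheaf.eq_of_locally_eq (ab F) (fun i ↦ D i ⊓ V) (fun i ↦ inf_le_right)
    ?_ fun i ↦ ?_⟩
  · rw [← iSup_inf_eq]
    exact le_inf (h.trans hO) le_rfl
  · rw [res_res, ← res_res _ inf_le_left (hD i), hx, res_smul, ht, pow_add, mul_smul,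
      res_smul _ _ (_ ^ m)]
    simp only [map_pow, resO_resO]

end Basis

variable {F : X.Modules} (hF : LQC F)
include hF

lemma LQC.tors_of_noetherian {O : X.Opens} (f : Γ(X, O)) {V : X.Opens} (hV : V = X.basicOpen f)
    (h : V ≤ O) (t : Sec F O) (ht : res (ab F) h t = 0) : ∃ n : ℕ, f ^ n • t = 0 :=
  tors_of_basis exists_affineOpen_basis (fun _ hU f _ ↦ hF.tors hU f) f hV h t ht

lemma LQC.ext_of_noetherian {O : X.Opens} (f : Γ(X, O)) {V : X.Opens} (hV : V = X.basicOpen f)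
    (h : V ≤ O) (s : Sec F V) :
    ∃ (n : ℕ) (t : Sec F O), res (ab F) h t = resO h f ^ n • s :=
  ext_of_basis exists_affineOpen_basis (fun _ hU f _ ↦ hF.tors hU f)
    (fun _ hU f _ ↦ hF.ext hU f) f hV h s

/-- The direct image of a quasi-coherent module on a noetherian scheme is quasi-coherent. -/
lemma LQC.pushforward {Y : Scheme.{u}} (f : X ⟶ Y) :
    LQC ((Scheme.Modules.pushforward f).obj F) := by
  refine ⟨fun {U} hU g V hV h s ↦ ?_, fun {U} hU g V hV h t ht ↦ ?_⟩
  · obtain ⟨n, t, ht⟩ := hF.ext_of_noetherian (f.app U g) (V := f ⁻¹ᵁ V)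
      (by rw [hV, Scheme.preimage_basicOpen]) (f.preimage_mono h) (secPushforward f F V s)
    refine ⟨n, (secPushforward f F U).symm t, (secPushforward f F V).injective ?_⟩
    rw [secPushforward_res, secPushforward_smul, AddEquiv.apply_symm_apply, ht, map_pow]
    congr 2
    exact congr($(f.naturality (homOfLE h).op) g).symm
  · obtain ⟨n, hn⟩ := hF.tors_of_noetherian (f.app U g) (V := f ⁻¹ᵁ V)
      (by rw [hV, Scheme.preimage_basicOpen]) (f.preimage_mono h) (secPushforward f F U t)
      (by rw [← secPushforward_res f F h, ht, map_zero])
    exact ⟨n, (secPushforward f F U).injective (by rw [secPushforward_smul, map_pow, hn, map_zero])⟩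

lemma LQC.pushRes (W : X.Opens) : LQC (pushRes W F) := by
  refine ⟨fun {U} hU g V hV h s ↦ ?_, fun {U} hU g V hV h t ht ↦ ?_⟩
  · obtain ⟨n, t, ht⟩ := hF.ext_of_noetherian (resO (inf_le_right : W ⊓ U ≤ U) g) (V := W ⊓ V)
      (by rw [hV, basicOpen_resO, inf_assoc, inf_eq_right.mpr (X.basicOpen_le g)])
      (inf_le_inf_left W h) (secPush W F V s)
    refine ⟨n, (secPush W F U).symm t, (secPush W F V).injective ?_⟩
    rw [secPush_res, secPush_smul, AddEquiv.apply_symm_apply, ht]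
    simp only [map_pow, resO_resO]
  · obtain ⟨n, hn⟩ := hF.tors_of_noetherian (resO (inf_le_right : W ⊓ U ≤ U) g) (V := W ⊓ V)
      (by rw [hV, basicOpen_resO, inf_assoc, inf_eq_right.mpr (X.basicOpen_le g)])
      (inf_le_inf_left W h) (secPush W F U t) (by rw [← secPush_res W F h, ht, map_zero])
    exact ⟨n, (secPush W F U).injective (by rw [secPush_smul, map_pow, hn, map_zero])⟩

end Noetherian

/-! ### The first step of the Čech resolution. -/

section Cech

variable {X : Scheme.{u}} (F : X.Modules)

/-- The restriction map from `F` to `pushRes W F`. -/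
def toPushRes (W : X.Opens) : F ⟶ pushRes W F := (exists_toPushRes W F).choose

lemma secPush_toPushRes (W : X.Opens) {U : X.Opens} (x : Sec F U) :
    secPush W F U (homSec (toPushRes F W) U x) = res (ab F) inf_le_right x :=
  (exists_toPushRes W F).choose_spec U x

variable {N : ℕ} (D : Fin N → X.Opens)

/-- The restriction map from `F` to the sum of the `pushRes (D i) F`. -/
def cechMap : F ⟶ ⨁ fun i ↦ pushRes (D i) F := biproduct.lift fun i ↦ toPushRes F (D i)

lemma eq_zero_of_cechMap {U : X.Opens} {x : Sec F U} (hx : homSec (cechMap F D) U x = 0)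
    (i : Fin N) : res (ab F) (inf_le_right : D i ⊓ U ≤ U) x = 0 := by
  have := congr(homSec (biproduct.π _ i) U $hx)
  rw [← homSec_comp, cechMap, biproduct.lift_π, map_zero] at this
  rw [← secPush_toPushRes, this, map_zero]

lemma injective_cechMap (h : ⊤ ≤ ⨆ i, D i) (U : X.Opens) (x : Sec F U)
    (hx : homSec (cechMap F D) U x = 0) : x = 0 := by
  refine AbSheaf.eq_of_locally_eq (ab F) (fun i ↦ D i ⊓ U) (fun i ↦ inf_le_right) ?_ fun i ↦ ?_
  · rw [← iSup_inf_eq]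
    exact le_inf (le_top.trans h) le_rfl
  · rw [eq_zero_of_cechMap F D hx, map_zero]

/-- The `i`-th component of the image of `x` is a class with coefficients in `pushRes (D i) F`. It
dies over `D i` because `x` does, and restriction from `U` to `D i` is injective on such classes
because both meet `D i` in the same open subset. -/
lemma comp_cechMap_eq_zero {n : ℕ} (hn : 1 ≤ n)
    (hF : ∀ (i : Fin N) (V : X.Opens), IsAffineOpen V → ∀ s, 1 ≤ s → s < n →
      Vanishes s (D i ⊓ V) (ab F))
    {U : X.Opens} (hU : ∀ i, D i ≤ U) (x : Abelian.Ext (freeSheaf U) (ab F) n)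
    (hx : ∀ i, resExt (hU i) x = 0) :
    x.comp (Abelian.Ext.mk₀ ((abF X).map (cechMap F D))) (add_zero n) = 0 := by
  refine eq_zero_of_comp_biproduct_π _ _ fun i ↦ ?_
  rw [Abelian.Ext.comp_assoc _ _ _ (add_zero n) (add_zero 0) (by omega), Abelian.Ext.mk₀_comp_mk₀,
    ← Functor.map_comp, cechMap, biproduct.lift_π]
  refine eq_zero_of_resExt_pull_eq_zero (interFunctor (D i)) {V | IsAffineOpen V}
    (fun U p hp ↦ ?_) (F := ab F) hn (hF i) (hU i) (le_inf inf_le_left inf_le_left) _ ?_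
  · obtain ⟨V, h₁, h₂, h₃⟩ := exists_affine_mem_le hp
    exact ⟨V, h₁, h₂, h₃⟩
  · have := resExt_comp (hU i) x (Abelian.Ext.mk₀ ((abF X).map (toPushRes F (D i)))) (add_zero n)
    rw [hx, Abelian.Ext.zero_comp] at this
    exact this

end Cech

/-! ### Vanishing of higher cohomology on affine schemes. -/

section Affine

lemma noetherianSpace_opens {X : Scheme.{u}} [NoetherianSpace X] (U : X.Opens) :
    NoetherianSpace U.toScheme :=
  U.ι.isOpenEmbedding.isInducing.noetherianSpace

lemma vanishes_affine_iff_top {X : Scheme.{u}} (F : X.Modules) {n : ℕ} (hn : 1 ≤ n) (U : X.Opens) :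
    Vanishes n U (ab F) ↔ Vanishes n ⊤ (ab (F.restrict U.ι)) := by
  rw [vanishes_restrict _ _ hn, Scheme.Opens.ι_image_top]

/-- A class of degree `n` dies on a finite affine cover, hence in the sum of the `pushRes (D i) F`,
hence comes from degree `n - 1` of the cokernel of `cechMap`. That cokernel is again quasi-coherent,
so induction applies; for `n = 1` the claim is surjectivity on sections, which `SES.lqc_surjective`
proves without cohomology. -/
lemma vanishes_top_of_isAffine {n : ℕ} (hn : 1 ≤ n) {X : Scheme.{u}} [IsAffine X]
    [NoetherianSpace X] {F : X.Modules} (hF : LQC F) : Vanishes n ⊤ (ab F) := by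
  induction n using Nat.strong_induction_on generalizing X F with
  | _ n ih =>
  have ih' (s : ℕ) (hs : 1 ≤ s) (hsn : s < n) (V : X.Opens) (hV : IsAffineOpen V) :
      Vanishes s V (ab F) := by
    rw [vanishes_affine_iff_top _ hs]
    have : IsAffine V.toScheme := hV
    have := noetherianSpace_opens V
    exact ih s hsn hs (hF.restrict V.ι)
  refine vanishes_iff.mpr fun x ↦ ?_
  obtain ⟨N, D, hD, hD', hx, hcov⟩ := exists_finite_cover exists_affineOpen_basis (⊤ : X.Opens)
    (fun V hV ↦ resExt hV x = 0) (fun h h' hx ↦ by rw [← resExt_resExt h h', hx, resExt_zero])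
    (fun p hp ↦ exists_resExt_eq_zero hn x hp)
  have h0 := comp_cechMap_eq_zero F D hn
    (fun i V hV s hs hsn ↦ ih' s hs hsn _ ((hD' i).inf hV)) hD x hx
  have hses := ses_cokernel (cechMap F D) (injective_cechMap F D hcov)
  have hC : LQC (⨁ fun i ↦ pushRes (D i) F) := LQC.biproduct fun i ↦ hF.pushRes (D i)
  obtain rfl | hn1 := hn.eq_or_lt
  · obtain ⟨z, rfl⟩ := hses.exists_conn_eq x h0
    rw [hses.conn_eq_zero_iff]
    exact hses.lqc_surjective hF hC (isAffineOpen_top X) z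
  · obtain ⟨m, rfl⟩ := Nat.exists_eq_add_of_lt hn1
    obtain ⟨y, rfl⟩ := Abelian.Ext.covariant_sequence_exact₁ (freeSheaf ⊤) hses.shortExact x h0
      (n₀ := 1 + m) rfl
    rw [vanishes_iff.mp (ih (1 + m) (by omega) (by omega) (hses.lqc hF hC)) y,
      Abelian.Ext.zero_comp]

variable {X : Scheme.{u}} [NoetherianSpace X] {F : X.Modules} (hF : LQC F)
include hF

/-- Quasi-coherent modules have no higher cohomology over affine open subsets. -/
theorem LQC.vanishes_affine {n : ℕ} (hn : 1 ≤ n) {U : X.Opens} (hU : IsAffineOpen U) :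
    Vanishes n U (ab F) := by
  rw [vanishes_affine_iff_top _ hn]
  have : IsAffine U.toScheme := hU
  have := noetherianSpace_opens U
  exact vanishes_top_of_isAffine hn (hF.restrict U.ι)

lemma LQC.vanishes_bot (n : ℕ) : Vanishes n ⊥ (ab F) := by
  obtain rfl | hn := Nat.eq_zero_or_pos n
  · rw [vanishes_zero_iff]
    exact ⟨fun x y ↦ AbSheaf.eq_of_locally_eq (ab F) (ι := Empty) (fun _ ↦ ⊥) (fun _ ↦ le_rfl)
      (by simp) nofun⟩
  · exact hF.vanishes_affine hn (isAffineOpen_bot X)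

variable [X.IsSeparated]

/-- Cohomology over an open subset of the direct image of the restriction to an affine open
subset. -/
lemma LQC.vanishes_pushRes {W : X.Opens} (hW : IsAffineOpen W) {n : ℕ} (hn : 1 ≤ n) (U : X.Opens) :
    Vanishes n U (ab (CdLci.pushRes W F)) ↔ Vanishes n (W ⊓ U) (ab F) :=
  vanishes_pull_iff_of_basis (interFunctor W) {V : X.Opens | IsAffineOpen V}
    (fun U p hp ↦ exists_affineOpen_basis U p hp)
    (fun _ hV _ hn ↦ hF.vanishes_affine hn (hW.inf hV)) hn U

end Affine

/-! ### Equivalence of `LQC` with `IsQuasicoherent`. -/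

section Quasicoherent

section Spec

variable {R : CommRingCat.{u}} {M : (Spec R).Modules}

lemma smul_sec_Spec {U : (Spec R).Opens} (r : R) (x : Γ(M, U)) :
    r • x = (resO (le_top : U ≤ ⊤) ((Scheme.ΓSpecIso R).inv r) • (show Sec M U from x) : Sec M U) :=
  rfl

lemma isLocalizing_of_lqc (h : LQC M) : IsLocalizing (modulesSpecToSheaf.obj M) := by
  intro f
  refine ⟨?_, ?_, ?_⟩
  · rintro ⟨_, n, rfl⟩
    rw [map_pow]
    exact (Scheme.Modules.isUnit_algebraMap_end_of_le_basicOpen f le_rfl).pow n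
  · intro y
    obtain ⟨n, t, ht⟩ := h.ext (isAffineOpen_top (Spec R)) ((Scheme.ΓSpecIso R).inv f)
      (basicOpen_eq_of_affine f).symm le_top y
    refine ⟨⟨t, ⟨f ^ n, n, rfl⟩⟩, ?_⟩
    refine Eq.trans ?_ ht.symm
    refine (smul_sec_Spec (f ^ n) _).trans ?_
    rw [map_pow, map_pow]
  · intro x y hxy
    obtain ⟨n, hn⟩ := h.tors (isAffineOpen_top (Spec R)) ((Scheme.ΓSpecIso R).inv f)
      (basicOpen_eq_of_affine f).symm le_top ((show Sec M ⊤ from x) - (show Sec M ⊤ from y)) (by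
        rw [map_sub, sub_eq_zero]; exact hxy)
    rw [smul_sub, sub_eq_zero] at hn
    refine ⟨⟨f ^ n, n, rfl⟩, ?_⟩
    have h₀ (z : Sec M ⊤) : (show Γ(M, ⊤) from f ^ n • (show Γ(M, ⊤) from z)) =
        (Scheme.ΓSpecIso R).inv f ^ n • z := by
      rw [smul_sec_Spec, map_pow, resO_self]
    exact (h₀ x).trans (hn.trans (h₀ y).symm)

lemma ext_of_isLocalizing (h : IsLocalizing (modulesSpecToSheaf.obj M)) (f : R)
    {D : (Spec R).Opens} (hD : D = PrimeSpectrum.basicOpen f) (s : Sec M D) :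
    ∃ (n : ℕ) (t : Sec M ⊤), res (ab M) le_top t =
      resO (le_top : D ≤ ⊤) ((Scheme.ΓSpecIso R).inv f) ^ n • s := by
  subst hD
  obtain ⟨⟨t, ⟨_, n, rfl⟩⟩, hn⟩ := (h f).surj s
  refine ⟨n, t, Eq.trans hn.symm ?_⟩
  have := smul_sec_Spec (M := M) (f ^ n) s
  rw [map_pow, map_pow] at this
  exact this

lemma tors_of_isLocalizing (h : IsLocalizing (modulesSpecToSheaf.obj M)) (f : R)
    {D : (Spec R).Opens} (hD : D = PrimeSpectrum.basicOpen f) (t : Sec M ⊤)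
    (ht : res (ab M) (le_top : D ≤ ⊤) t = 0) :
    ∃ n : ℕ, (Scheme.ΓSpecIso R).inv f ^ n • t = 0 := by
  subst hD
  obtain ⟨⟨_, n, rfl⟩, hn⟩ := (h f).exists_of_eq (x₁ := t) (x₂ := 0) (by
    rw [map_zero]; exact ht)
  have := smul_sec_Spec (M := M) (f ^ n) t
  rw [map_pow, resO_self] at this
  rw [smul_zero] at hn
  exact ⟨n, this.symm.trans hn⟩

end Spec

variable {X : Scheme.{u}} {M : X.Modules}

/-- A presentation of the restriction of `M` to an open subscheme. -/
def presentationOver (U : X.Opens) (P : (M.restrict U.ι).Presentation) :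
    (M.over U).Presentation := by
  let e : SheafOfModules (X.ringCatSheaf.over U) ≌ SheafOfModules U.toScheme.ringCatSheaf :=
    Scheme.Modules.overEquiv U
  let i : e.inverse.obj (M.restrict U.ι) ≅ M.over U :=
    e.inverse.mapIso ((Scheme.Modules.overFunctorEquiv U).app M).symm ≪≫
      (e.unitIso.app (M.over U)).symm
  have : PreservesColimitsOfSize.{u, u} e.inverse :=
    e.symm.toAdjunction.leftAdjoint_preservesColimits
  let η : e.functor.obj (SheafOfModules.unit (X.ringCatSheaf.over U)) ≅
    SheafOfModules.unit U.toScheme.ringCatSheaf := Iso.refl _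
  exact SheafOfModules.Presentation.ofIsIso.{u, u, u} i.hom
    (P.map e.inverse (e.unitIso.app _ ≪≫ e.inverse.mapIso η))

/-- Needed to apply the definition of `cd` to the modules on `Y` produced by the proof, which are
known only to satisfy `LQC`. On an affine open subset, localization of sections identifies the
module with the sheaf associated with its global sections, which has a presentation. -/
lemma LQC.isQuasicoherent (h : LQC M) : M.IsQuasicoherent := by
  have key (U : X.affineOpens) : Nonempty (M.restrict U.1.ι).Presentation := by
    have hU : IsAffineOpen U.1 := U.2
    let N : (Spec Γ(X, U.1)).Modules := M.restrict hU.fromSpec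
    have hN : LQC N := h.restrict _
    have : IsIso N.fromTildeΓ := (isIso_fromTildeΓ_iff_isLocalizing N).mpr (isLocalizing_of_lqc hN)
    let P₁ := presentationTilde (moduleSpecΓFunctor.obj N) Set.univ Submodule.span_univ _
      (Submodule.span_eq _)
    let P₂ : N.Presentation := @SheafOfModules.Presentation.ofIsIso.{u, u, u} _ _ _ _ _ _ _ _
      N.fromTildeΓ this P₁
    let P₃ := Scheme.Modules.presentationRestrict hU.isoSpec.hom P₂
    have e : hU.isoSpec.hom ≫ hU.fromSpec = U.1.ι := by
      simp
    have i : (M.restrict hU.fromSpec).restrict hU.isoSpec.hom ≅ M.restrict U.1.ι :=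
      ((Scheme.Modules.restrictFunctorComp _ _).symm ≪≫
        Scheme.Modules.restrictFunctorCongr e).app M
    exact ⟨@SheafOfModules.Presentation.ofIsIso.{u, u, u} _ _ _ _ _ _ _ _ i.hom
      (inferInstanceAs (IsIso i.hom)) P₃⟩
  refine SheafOfModules.QuasicoherentData.isQuasicoherent.{u}
    { I := X.affineOpens
      X := fun U ↦ U.1
      coversTop := ?_
      presentation := fun U ↦ presentationOver U.1 (key U).some }
  rw [Opens.coversTop_iff]
  exact eq_top_iff.mpr fun p _ ↦ by
    obtain ⟨V, hV, hp, -⟩ := exists_affine_mem_le (X := X) (U := ⊤) (p := p) trivial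
    exact Opens.mem_iSup.mpr ⟨⟨V, hV⟩, hp⟩

lemma appIso_fromSpec_inv {U : X.Opens} (hU : IsAffineOpen U) (f : Γ(X, U))
    (D : (Spec Γ(X, U)).Opens) (h : hU.fromSpec ''ᵁ D ≤ U) :
    (hU.fromSpec.appIso D).inv (resO le_top ((Scheme.ΓSpecIso _).inv f)) = resO h f := by
  have : Function.Injective (hU.fromSpec.appIso D).hom :=
    (ConcreteCategory.bijective_of_isIso (hU.fromSpec.appIso D).hom).injective
  apply this
  rw [← ConcreteCategory.comp_apply, Iso.inv_hom_id, Scheme.Hom.appIso_hom]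
  have h₁ : resO h f = X.presheaf.map (homOfLE h).op f := rfl
  rw [h₁, ← ConcreteCategory.comp_apply, ← Category.assoc, hU.fromSpec.naturality,
    hU.fromSpec_app_self, Category.assoc, Category.assoc, ← Functor.map_comp, ← Functor.map_comp]
  rfl

lemma lqc_of_isQuasicoherent (M : X.Modules) [M.IsQuasicoherent] : LQC M := by
  have key {U : X.Opens} (hU : IsAffineOpen U) :
      IsLocalizing (modulesSpecToSheaf.obj (M.restrict hU.fromSpec)) := by
    have : (M.restrict hU.fromSpec).IsQuasicoherent :=
      Scheme.Modules.isQuasicoherent_restrictFunctor hU.fromSpec M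
    exact (isIso_fromTildeΓ_iff_isLocalizing (M.restrict hU.fromSpec)).mp
      ((isQuasicoherent_iff_isIso_fromTildeΓ _).mp this)
  have hV' {U : X.Opens} (hU : IsAffineOpen U) (f : Γ(X, U)) {V : X.Opens}
      (hV : V = X.basicOpen f) : ∃ D : (Spec Γ(X, U)).Opens, D = PrimeSpectrum.basicOpen f ∧
        hU.fromSpec ''ᵁ D = V :=
    ⟨_, rfl, hV ▸ hU.fromSpec_image_basicOpen f⟩
  have hU' {U : X.Opens} (hU : IsAffineOpen U) : hU.fromSpec ''ᵁ ⊤ = U := by simp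
  refine ⟨fun {U} hU f V hV h s ↦ ?_, fun {U} hU f V hV h t ht ↦ ?_⟩
  · obtain ⟨D, hD, hDV⟩ := hV' hU f hV
    obtain ⟨n, t, hn⟩ := ext_of_isLocalizing (key hU) f hD
      ((secRestrict hU.fromSpec M D).symm (res (ab M) hDV.le s))
    have hn' := congr(secRestrict hU.fromSpec M D $hn)
    rw [secRestrict_res, secRestrict_smul, AddEquiv.apply_symm_apply, map_pow,
      appIso_fromSpec_inv hU f _ (hDV.le.trans h)] at hn'
    refine ⟨n, res (ab M) (hU' hU).ge (secRestrict hU.fromSpec M ⊤ t), ?_⟩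
    have := congr(res (ab M) hDV.ge $hn')
    rw [res_res, res_smul, res_res, res_self, map_pow, resO_resO] at this
    rw [res_res, this]
  · obtain ⟨D, hD, hDV⟩ := hV' hU f hV
    obtain ⟨n, hn⟩ := tors_of_isLocalizing (key hU) f hD
      ((secRestrict hU.fromSpec M ⊤).symm (res (ab M) (hU' hU).le t)) (by
        apply (secRestrict hU.fromSpec M D).injective
        rw [secRestrict_res _ _ le_top, AddEquiv.apply_symm_apply, res_res,
          ← res_res _ hDV.le h, ht, map_zero, map_zero])
    have hn' := congr(secRestrict hU.fromSpec M ⊤ $hn)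
    have h₀ := appIso_fromSpec_inv hU f ⊤ (hU' hU).le
    rw [resO_self] at h₀
    rw [secRestrict_smul, AddEquiv.apply_symm_apply, map_pow, h₀, map_zero] at hn'
    have := congr(res (ab M) (hU' hU).ge $hn')
    rw [res_smul, res_res, res_self, map_pow, resO_resO, resO_self, map_zero] at this
    exact ⟨n, this⟩

end Quasicoherent

/-! ### Functoriality of the Čech construction. -/

section Functoriality

variable {X : Scheme.{u}}

/-- If `φ` is injective, a section which is locally in the image of `φ` is in the image of `φ`. -/
lemma exists_homSec_eq_of_locally {F G : X.Modules} (φ : F ⟶ G)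
    (hφ : ∀ U x, homSec φ U x = 0 → x = 0) {ι : Type*} {U : X.Opens} (V : ι → X.Opens)
    (hV : ∀ i, V i ≤ U) (hU : U ≤ ⨆ i, V i) (x : Sec G U)
    (h : ∀ i, ∃ y, homSec φ (V i) y = res (ab G) (hV i) x) : ∃ y, homSec φ U y = x := by
  choose s hs using h
  obtain ⟨y, hy⟩ := AbSheaf.exists_glue (ab F) V hV hU s fun i j ↦ by
    rw [← sub_eq_zero]
    apply hφ
    rw [map_sub, secMap_res, secMap_res, hs, hs, res_res, res_res, sub_self]
  exact ⟨y, AbSheaf.eq_of_locally_eq (ab G) V hV hU fun i ↦ by rw [← secMap_res, hy, hs]⟩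

lemma exists_homSec_eq_of_forall_mem {F G : X.Modules} (φ : F ⟶ G)
    (hφ : ∀ U x, homSec φ U x = 0 → x = 0) {U : X.Opens} (x : Sec G U)
    (h : ∀ p ∈ U, ∃ (V : X.Opens) (hV : V ≤ U), p ∈ V ∧ ∃ y, homSec φ V y = res (ab G) hV x) :
    ∃ y, homSec φ U y = x := by
  choose V hV hpV hy using fun p : U ↦ h p.1 p.2
  exact exists_homSec_eq_of_locally φ hφ V hV
    (fun p hp ↦ Opens.mem_iSup.mpr ⟨⟨p, hp⟩, hpV _⟩) x hy

lemma exists_pushResMap (W : X.Opens) {F G : X.Modules} (φ : F ⟶ G) :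
    ∃ ψ : pushRes W F ⟶ pushRes W G, ∀ U x,
      secPush W G U (homSec ψ U x) = homSec φ (W ⊓ U) (secPush W F U x) := by
  obtain ⟨ψ, hψ⟩ := exists_hom_of_linear (M := pushRes W F) (N := pushRes W G)
    ((pull (interFunctor W)).map ((abF X).map φ)) (fun U r x ↦ homSec_smul φ _ _)
  exact ⟨ψ, fun U x ↦ by rw [homSec, hψ]; rfl⟩

/-- Functoriality of `pushRes`. -/
def pushResMap (W : X.Opens) {F G : X.Modules} (φ : F ⟶ G) : pushRes W F ⟶ pushRes W G :=
  (exists_pushResMap W φ).choose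

lemma secPush_pushResMap (W : X.Opens) {F G : X.Modules} (φ : F ⟶ G) {U : X.Opens}
    (x : Sec (pushRes W F) U) :
    secPush W G U (homSec (pushResMap W φ) U x) = homSec φ (W ⊓ U) (secPush W F U x) :=
  (exists_pushResMap W φ).choose_spec U x

variable {N : ℕ} (D : Fin N → X.Opens) {F G : X.Modules} (φ : F ⟶ G)

/-- Functoriality of the sum of the `pushRes (D i) F`. -/
def cechObjMap : (⨁ fun i ↦ pushRes (D i) F) ⟶ ⨁ fun i ↦ pushRes (D i) G :=
  biproduct.map fun i ↦ pushResMap (D i) φ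

lemma π_cechObjMap (i : Fin N) {U : X.Opens} (x : Sec (⨁ fun i ↦ pushRes (D i) F) U) :
    homSec (biproduct.π _ i) U (homSec (cechObjMap D φ) U x) =
      homSec (pushResMap (D i) φ) U (homSec (biproduct.π _ i) U x) := by
  rw [← homSec_comp, cechObjMap, biproduct.map_π, homSec_comp]

lemma π_cechMap (i : Fin N) {U : X.Opens} (x : Sec F U) :
    homSec (biproduct.π _ i) U (homSec (cechMap F D) U x) = homSec (toPushRes F (D i)) U x := by
  rw [← homSec_comp, cechMap, biproduct.lift_π]

lemma cechMap_naturality : cechMap F D ≫ cechObjMap D φ = φ ≫ cechMap G D := by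
  refine Modules.hom_ext fun U x ↦ biproduct_sec_ext _ fun i ↦ ?_
  rw [homSec_comp, homSec_comp, π_cechObjMap, π_cechMap, π_cechMap]
  apply (secPush (D i) G U).injective
  rw [secPush_pushResMap, secPush_toPushRes, secPush_toPushRes, secMap_res]

end Functoriality

/-! ### Cohomology of increasing unions. -/

section Exhaustion

variable {X : Scheme.{u}}

/-- `N` is the increasing union of the submodules `P n`. -/
structure Exhausts (N : X.Modules) (P : ℕ → X.Modules) (φ : ∀ n, P n ⟶ N) : Prop where
  inj : ∀ n U x, homSec (φ n) U x = 0 → x = 0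
  mono : ∀ {n m}, n ≤ m → ∀ U x, ∃ y, homSec (φ m) U y = homSec (φ n) U x
  exh : ∀ U x, ∃ n y, homSec (φ n) U y = x

variable {N : X.Modules} {P : ℕ → X.Modules} {φ : ∀ n, P n ⟶ N} (h : Exhausts N P φ)
  {k : ℕ} (D : Fin k → X.Opens) (hD : ⊤ ≤ ⨆ i, D i)
include h

omit h in
lemma exists_cechObjMap_eq {U : X.Opens} (c : Sec (⨁ fun i ↦ pushRes (D i) N) U) {n : ℕ}
    (hc : ∀ i, ∃ y, homSec (φ n) (D i ⊓ U) y = secPush (D i) N U (homSec (biproduct.π _ i) U c)) :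
    ∃ c', homSec (cechObjMap D (φ n)) U c' = c := by
  choose y hy using hc
  obtain ⟨c', hc'⟩ := exists_biproduct_sec (fun i ↦ pushRes (D i) (P n))
    (fun i ↦ (secPush (D i) (P n) U).symm (y i))
  refine ⟨c', biproduct_sec_ext _ fun i ↦ (secPush (D i) N U).injective ?_⟩
  rw [π_cechObjMap, hc', secPush_pushResMap, AddEquiv.apply_symm_apply, hy]

lemma Exhausts.cechObjMap_inj (n : ℕ) (U : X.Opens) (c : Sec (⨁ fun i ↦ pushRes (D i) (P n)) U)
    (hc : homSec (cechObjMap D (φ n)) U c = 0) : c = 0 := by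
  refine biproduct_sec_ext _ fun i ↦ (secPush (D i) (P n) U).injective ?_
  rw [map_zero, map_zero]
  apply h.inj n
  rw [← secPush_pushResMap, ← π_cechObjMap, hc, map_zero, map_zero]

/-- The map induced on the cokernels of the maps `cechMap`. -/
def cechCokernelMap (φ : ∀ n, P n ⟶ N) (n : ℕ) :
    cokernel (cechMap (P n) D) ⟶ cokernel (cechMap N D) :=
  cokernel.map _ _ (φ n) (cechObjMap D (φ n)) (cechMap_naturality D (φ n))

omit h in
lemma cechCokernelMap_π (n : ℕ) {U : X.Opens} (c : Sec (⨁ fun i ↦ pushRes (D i) (P n)) U) :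
    homSec (cechCokernelMap D φ n) U (homSec (cokernel.π (cechMap (P n) D)) U c) =
      homSec (cokernel.π (cechMap N D)) U (homSec (cechObjMap D (φ n)) U c) := by
  rw [← homSec_comp, cechCokernelMap, cokernel.π_desc, homSec_comp]

include hD in
lemma Exhausts.cechCokernelMap_inj (n : ℕ) (U : X.Opens) (z : Sec (cokernel (cechMap (P n) D)) U)
    (hz : homSec (cechCokernelMap D φ n) U z = 0) : z = 0 := by
  have hs := ses_cokernel _ (injective_cechMap (P n) D hD)
  have hs' := ses_cokernel _ (injective_cechMap N D hD)
  choose V hV c hp hc using fun p : U ↦ hs.surj U z p.1 p.2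
  refine AbSheaf.eq_of_locally_eq _ V hV (fun p hp' ↦ Opens.mem_iSup.mpr ⟨⟨p, hp'⟩, hp _⟩)
    fun p ↦ ?_
  rw [← hc, map_zero]
  obtain ⟨x, hx⟩ := hs'.exact (V p) (homSec (cechObjMap D (φ n)) _ (c p)) (by
    rw [← cechCokernelMap_π, hc, secMap_res, hz, map_zero])
  -- The section `x` of `N` comes from `P n` on each member of the cover, since its Čech components
  -- there are those of `c p`. By gluing it comes from `P n` over `V p`.
  obtain ⟨x', rfl⟩ := exists_homSec_eq_of_locally (φ n) (h.inj n) (fun i ↦ D i ⊓ V p)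
    (fun i ↦ inf_le_right) (by rw [← iSup_inf_eq]; exact le_inf (le_top.trans hD) le_rfl) x
    (fun i ↦ ⟨secPush (D i) (P n) _ (homSec (biproduct.π _ i) _ (c p)), by
      rw [← secPush_pushResMap, ← π_cechObjMap, ← hx, π_cechMap, secPush_toPushRes]⟩)
  have : c p = homSec (cechMap (P n) D) _ x' := by
    rw [← sub_eq_zero]
    apply h.cechObjMap_inj D
    rw [map_sub, ← hx, ← homSec_comp, ← homSec_comp, cechMap_naturality, sub_self]
  rw [this, hs.zero]

lemma Exhausts.exists_le {U : X.Opens} (x : Sec N U) (n : ℕ)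
    (hx : ∃ y, homSec (φ n) U y = x) {m : ℕ} (hnm : n ≤ m) : ∃ y, homSec (φ m) U y = x := by
  obtain ⟨y, rfl⟩ := hx
  exact h.mono hnm U y

-- This is what lets the induction in `Exhausts.exists_ext` pass to cokernels. A section of the
-- cokernel for `N` lifts locally to the Čech sum, its finitely many components come from a common
-- `P n`, and finitely many such open subsets cover.
include hD in
lemma Exhausts.cokernel [NoetherianSpace X] :
    Exhausts (cokernel (cechMap N D)) (fun n ↦ cokernel (cechMap (P n) D))
      (cechCokernelMap D φ) := by
  have hmono {n m : ℕ} (hnm : n ≤ m) (U : X.Opens) (z : Sec (Limits.cokernel (cechMap (P n) D)) U) :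
      ∃ y, homSec (cechCokernelMap D φ m) U y = homSec (cechCokernelMap D φ n) U z := by
    refine exists_homSec_eq_of_forall_mem _ (h.cechCokernelMap_inj D hD m) _ fun p hp ↦ ?_
    obtain ⟨V, hV, c, hpV, hc⟩ := (ses_cokernel _ (injective_cechMap (P n) D hD)).surj U z p hp
    obtain ⟨c', hc'⟩ := exists_cechObjMap_eq D (homSec (cechObjMap D (φ n)) _ c) (n := m)
      (fun i ↦ by
        rw [π_cechObjMap, secPush_pushResMap]
        exact h.mono hnm _ _)
    refine ⟨V, hV, hpV, homSec (cokernel.π (cechMap (P m) D)) V c', ?_⟩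
    rw [cechCokernelMap_π, hc', ← cechCokernelMap_π, hc, secMap_res]
  refine ⟨h.cechCokernelMap_inj D hD, hmono, fun U z ↦ ?_⟩
  obtain ⟨K, V, hV, -, hc, hcov⟩ := exists_finite_cover exists_affineOpen_basis U
    (fun V hV ↦ ∃ n, ∃ y, homSec (cechCokernelMap D φ n) V y = res _ hV z)
    (fun h h' ⟨n, y, hy⟩ ↦ ⟨n, res _ h y, by rw [secMap_res, hy, res_res]⟩) (fun p hp ↦ by
      obtain ⟨V, hV, c, hpV, hc⟩ := (ses_cokernel _ (injective_cechMap N D hD)).surj U z p hp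
      obtain ⟨n, hn⟩ := exists_forall_of_finset Finset.univ (fun i n ↦ ∃ y,
          homSec (φ n) (D i ⊓ V) y = secPush (D i) N V (homSec (biproduct.π _ i) V c))
        (fun i n m hnm hy ↦ h.exists_le _ n hy hnm) (fun i _ ↦ h.exh _ _)
      obtain ⟨c', hc'⟩ := exists_cechObjMap_eq D c (n := n) fun i ↦ hn i (Finset.mem_univ i)
      refine ⟨V, hV, hpV, n, homSec (cokernel.π (cechMap (P n) D)) V c', ?_⟩
      rw [cechCokernelMap_π, hc', hc])
  obtain ⟨n, hn⟩ := exists_forall_of_finset Finset.univ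
    (fun i n ↦ ∃ y, homSec (cechCokernelMap D φ n) (V i) y = res _ (hV i) z)
    (fun i n m hnm ⟨y, hy⟩ ↦ by rw [← hy]; exact hmono hnm _ y) (fun i _ ↦ hc i)
  exact ⟨n, exists_homSec_eq_of_locally _ (h.cechCokernelMap_inj D hD n) V hV hcov z
    fun i ↦ hn i (Finset.mem_univ i)⟩

omit h in
/-- Cohomology classes of an increasing union of submodules come from one of the submodules. -/
theorem Exhausts.exists_ext [NoetherianSpace X] [X.IsSeparated] {N : X.Modules} {P : ℕ → X.Modules}
    {φ : ∀ n, P n ⟶ N} (h : Exhausts N P φ) (hN : LQC N) {t : ℕ}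
    (x : Abelian.Ext (freeSheaf ⊤) (ab N) t) :
    ∃ (n : ℕ) (y : Abelian.Ext (freeSheaf ⊤) (ab (P n)) t),
      y.comp (Abelian.Ext.mk₀ ((abF X).map (φ n))) (add_zero t) = x := by
  induction t generalizing N P with
  | zero =>
    obtain ⟨a, rfl⟩ := (Abelian.Ext.mk₀_bijective _ _).surjective x
    obtain ⟨n, y, hy⟩ := h.exh ⊤ (freeSheafEquiv _ _ a)
    refine ⟨n, Abelian.Ext.mk₀ ((freeSheafEquiv _ _).symm y), ?_⟩
    rw [Abelian.Ext.mk₀_comp_mk₀]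
    congr 1
    apply (freeSheafEquiv _ _).injective
    rw [freeSheafEquiv_comp, Equiv.apply_symm_apply, ← hy]
  | succ t ih =>
    obtain ⟨k, D, -, hD', hD⟩ := exists_affine_cover (⊤ : X.Opens)
    have hs := ses_cokernel _ (injective_cechMap N D hD)
    have hC : LQC (⨁ fun i ↦ pushRes (D i) N) := LQC.biproduct fun i ↦ hN.pushRes (D i)
    -- The Čech sum has no cohomology in positive degrees, so `x` is the image under the connecting
    -- map of a class of degree `t` of the cokernel.
    have hC' : Vanishes (t + 1) ⊤ (ab (⨁ fun i ↦ pushRes (D i) N)) :=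
      vanishes_biproduct _ fun i ↦ (hN.vanishes_pushRes (hD' i) (by omega) ⊤).mpr (by
        rw [inf_top_eq]; exact hN.vanishes_affine (by omega) (hD' i))
    obtain ⟨y, rfl⟩ := Abelian.Ext.covariant_sequence_exact₁ (freeSheaf ⊤) hs.shortExact x
      (vanishes_iff.mp hC' _) rfl
    obtain ⟨n, y', rfl⟩ := ih (h.cokernel D hD) (hs.lqc hN hC) y
    have hs' := ses_cokernel _ (injective_cechMap (P n) D hD)
    refine ⟨n, y'.comp hs'.shortExact.extClass rfl, ?_⟩
    let f : ShortComplex.mk _ _ hs'.w ⟶ ShortComplex.mk _ _ hs.w :=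
      { τ₁ := (abF X).map (φ n)
        τ₂ := (abF X).map (cechObjMap D (φ n))
        τ₃ := (abF X).map (cechCokernelMap D φ n)
        comm₁₂ := by
          dsimp only
          rw [← Functor.map_comp, ← Functor.map_comp, cechMap_naturality]
        comm₂₃ := by
          dsimp only
          rw [← Functor.map_comp, ← Functor.map_comp, cechCokernelMap, cokernel.π_desc] }
    have key := ShortComplex.ShortExact.extClass_naturality hs'.shortExact hs.shortExact f
    rw [Abelian.Ext.comp_assoc _ _ _ rfl (add_zero 1) (by omega),
      Abelian.Ext.comp_assoc _ _ _ (add_zero t) (zero_add 1) (by omega)]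
    exact congr(y'.comp $key rfl)

lemma Exhausts.vanishes [NoetherianSpace X] [X.IsSeparated] (hN : LQC N) {t : ℕ}
    (hP : ∀ n, Vanishes t ⊤ (ab (P n))) : Vanishes t ⊤ (ab N) :=
  vanishes_iff.mpr fun x ↦ by
    obtain ⟨n, y, rfl⟩ := h.exists_ext hN x
    rw [vanishes_iff.mp (hP n) y, Abelian.Ext.zero_comp]

end Exhaustion

/-! ### Modules killed by an ideal, as modules on the closed subscheme. -/

section Descent

variable {X : Scheme.{u}} (I : X.IdealSheafData)

/-- The largest open subset of `X` whose intersection with the closed subscheme is `V`. -/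
def extOpen (V : I.subscheme.Opens) : X.Opens :=
  ⟨(I.subschemeι '' (V : Set I.subscheme)ᶜ)ᶜ,
    (I.subschemeι.isClosedEmbedding.isClosedMap _ V.isOpen.isClosed_compl).isOpen_compl⟩

lemma mem_extOpen {V : I.subscheme.Opens} {p : X} :
    p ∈ extOpen I V ↔ ∀ q, I.subschemeι q = p → q ∈ V := by
  change ¬ (∃ q, q ∉ V ∧ _) ↔ _
  grind

lemma le_extOpen_iff {V : I.subscheme.Opens} {W : X.Opens} :
    W ≤ extOpen I V ↔ I.subschemeι ⁻¹ᵁ W ≤ V :=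
  ⟨fun h q hq ↦ (mem_extOpen I).mp (h hq) q rfl,
    fun h p hp ↦ (mem_extOpen I).mpr fun q hq ↦ h (by subst hq; exact hp)⟩

lemma extOpen_mono {V V' : I.subscheme.Opens} (h : V ≤ V') : extOpen I V ≤ extOpen I V' :=
  fun _ hp ↦ (mem_extOpen I).mpr fun q hq ↦ h ((mem_extOpen I).mp hp q hq)

/-- The complement of the closed subscheme. -/
def complOpen : X.Opens := I.support.compl

lemma mem_complOpen {p : X} : p ∈ complOpen I ↔ ∀ q, I.subschemeι q ≠ p := by
  change p ∉ (I.support : Set X) ↔ _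
  rw [← I.range_subschemeι]
  exact not_exists

lemma preimage_extOpen (V : I.subscheme.Opens) : I.subschemeι ⁻¹ᵁ extOpen I V = V := by
  ext q
  change I.subschemeι q ∈ extOpen I V ↔ _
  rw [mem_extOpen]
  exact ⟨fun h ↦ h q rfl, fun h q' hq' ↦ I.subschemeι.isClosedEmbedding.injective hq' ▸ h⟩

variable {I} {N : X.Modules} (hZ : ∀ (V : X.Opens), V ≤ complOpen I → ∀ x : Sec N V, x = 0)
include hZ

/-- Enlarging an open subset by points of the complement of the closed subscheme does not change the
sections of `N`: this lemma gives injectivity of restriction, the next one surjectivity. -/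
lemma eq_zero_of_res_of_le_sup {W O : X.Opens} (h : W ≤ O) (hO : O ≤ W ⊔ complOpen I) {x : Sec N O}
    (hx : res (ab N) h x = 0) : x = 0 := by
  refine AbSheaf.eq_of_locally_eq (ab N) (fun b : Bool ↦ bif b then W else O ⊓ complOpen I)
    (fun b ↦ by cases b; exacts [inf_le_left, h]) (fun p hp ↦ ?_) fun b ↦ ?_
  · rcases hO hp with hp' | hp'
    · exact Opens.mem_iSup.mpr ⟨true, hp'⟩
    · exact Opens.mem_iSup.mpr ⟨false, hp, hp'⟩
  · cases b
    · exact (hZ (O ⊓ complOpen I) inf_le_right _).trans (hZ _ inf_le_right _).symm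
    · exact hx.trans (map_zero _).symm

lemma exists_res_eq_of_le_sup {W O : X.Opens} (h : W ≤ O) (hO : O ≤ W ⊔ complOpen I)
    (x : Sec N W) : ∃ y : Sec N O, res (ab N) h y = x := by
  obtain ⟨y, hy⟩ := AbSheaf.exists_glue (ab N) (fun b : Bool ↦ bif b then W else O ⊓ complOpen I)
    (fun b ↦ by cases b; exacts [inf_le_left, h]) (fun p hp ↦ by
      rcases hO hp with hp' | hp'
      · exact Opens.mem_iSup.mpr ⟨true, hp'⟩
      · exact Opens.mem_iSup.mpr ⟨false, hp, hp'⟩)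
    (fun b ↦ match b with | true => x | false => 0) (fun b c ↦ by
      cases b <;> cases c
      · rfl
      · exact (hZ _ (inf_le_left.trans inf_le_right) _).trans
          (hZ _ (inf_le_left.trans inf_le_right) _).symm
      · exact (hZ _ (inf_le_right.trans inf_le_right) _).trans
          (hZ _ (inf_le_right.trans inf_le_right) _).symm
      · rfl)
  exact ⟨y, hy true⟩

omit hZ in
lemma extOpen_preimage_le (W : X.Opens) :
    extOpen I (I.subschemeι ⁻¹ᵁ W) ≤ W ⊔ complOpen I := by
  intro p hp
  rw [mem_extOpen] at hp
  by_cases h : p ∈ complOpen I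
  · exact Or.inr h
  · rw [mem_complOpen] at h
    push Not at h
    obtain ⟨q, hq⟩ := h
    exact Or.inl (hq ▸ hp q hq)

omit hZ in
lemma le_extOpen_preimage (W : X.Opens) : W ≤ extOpen I (I.subschemeι ⁻¹ᵁ W) :=
  (le_extOpen_iff I).mpr le_rfl

omit hZ in
lemma extOpen_iSup_le {ι : Type*} (V : ι → I.subscheme.Opens) :
    extOpen I (⨆ i, V i) ≤ (⨆ i, extOpen I (V i)) ⊔ complOpen I := by
  refine le_trans ?_ (sup_le_sup_right (a := ⨆ i, extOpen I (V i)) le_rfl _)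
  refine le_trans ?_ (extOpen_preimage_le _)
  refine extOpen_mono I (iSup_le fun i ↦ ?_)
  rw [← preimage_extOpen I (V i)]
  exact I.subschemeι.preimage_mono (le_iSup (fun i ↦ extOpen I (V i)) i)

/-- The union of the `extOpen I (V i)` differs from `extOpen I (iSup V)` at most by points of the
complement, where `N` vanishes. So gluing for `N` on `X` gives the sheaf property on the closed
subscheme. -/
lemma existsUnique_glue_extOpen {ι : Type*} (V : ι → I.subscheme.Opens)
    (s : ∀ i, Sec N (extOpen I (V i)))
    (hs : ∀ i j, res (ab N) (extOpen_mono I (inf_le_left : V i ⊓ V j ≤ V i)) (s i) =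
      res (ab N) (extOpen_mono I (inf_le_right : V i ⊓ V j ≤ V j)) (s j)) :
    ∃! z : Sec N (extOpen I (iSup V)), ∀ i, res (ab N) (extOpen_mono I (le_iSup V i)) z = s i := by
  have hle (i : ι) : extOpen I (V i) ≤ ⨆ i, extOpen I (V i) := le_iSup (fun i ↦ extOpen I (V i)) i
  have hle' : (⨆ i, extOpen I (V i)) ≤ extOpen I (iSup V) :=
    iSup_le fun i ↦ extOpen_mono I (le_iSup V i)
  have hinf (i j : ι) : extOpen I (V i) ⊓ extOpen I (V j) ≤ extOpen I (V i ⊓ V j) :=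
    fun p hp ↦ (mem_extOpen I).mpr fun q hq ↦
      ⟨(mem_extOpen I).mp hp.1 q hq, (mem_extOpen I).mp hp.2 q hq⟩
  obtain ⟨y, hy⟩ := AbSheaf.exists_glue (ab N) (fun i ↦ extOpen I (V i)) hle le_rfl s
    (fun i j ↦ by
      have := congr(res (ab N) (hinf i j) $(hs i j))
      rwa [res_res, res_res] at this)
  obtain ⟨z, hz⟩ := exists_res_eq_of_le_sup hZ hle' (extOpen_iSup_le V) y
  refine ⟨z, fun i ↦ ?_, fun w hw ↦ ?_⟩
  · rw [← hy, ← hz, res_res]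
  · refine sub_eq_zero.mp (eq_zero_of_res_of_le_sup hZ hle' (extOpen_iSup_le V) ?_)
    refine AbSheaf.eq_of_locally_eq (ab N) (fun i ↦ extOpen I (V i)) hle le_rfl fun i ↦ ?_
    rw [res_res, map_sub, hw, ← hy, ← hz, res_res, sub_self, map_zero]

variable (hK : ∀ (V : X.affineOpens), ∀ a ∈ I.ideal V, ∀ x : Sec N V.1, a • x = 0)
include hK

omit hZ in
lemma smul_eq_zero_of_app_eq_zero {W : X.Opens} (a : Γ(X, W)) (ha : I.subschemeι.app W a = 0)
    (x : Sec N W) : a • x = 0 := by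
  choose V hV hpV hVW using fun p : W ↦ exists_affine_mem_le p.2
  refine AbSheaf.eq_of_locally_eq (ab N) V hVW
    (fun p hp ↦ Opens.mem_iSup.mpr ⟨⟨p, hp⟩, hpV _⟩) fun p ↦ ?_
  rw [res_smul, map_zero]
  refine hK ⟨V p, hV p⟩ _ ?_ _
  rw [← I.ker_subschemeι_app, RingHom.mem_ker]
  have := congr($(I.subschemeι.naturality (homOfLE (hVW p)).op) a)
  refine this.trans ?_
  rw [ConcreteCategory.comp_apply, ha, map_zero]

-- Two lifts of `s` differ by a function in the ideal, which kills `N`; so multiplication by `s`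
-- does not depend on the lift.
omit hZ in
lemma smul_eq_of_app_eq {W W' O : X.Opens} (hW : O ≤ W) (hW' : O ≤ W') (a : Γ(X, W))
    (a' : Γ(X, W')) {V : I.subscheme.Opens} (s : Γ(I.subscheme, V)) (h : I.subschemeι ⁻¹ᵁ W ≤ V)
    (h' : I.subschemeι ⁻¹ᵁ W' ≤ V) (ha : I.subschemeι.app W a = resO h s)
    (ha' : I.subschemeι.app W' a' = resO h' s) (x : Sec N O) :
    resO hW a • x = resO hW' a' • x := by
  rw [← sub_eq_zero, ← sub_smul]
  apply smul_eq_zero_of_app_eq_zero hK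
  have h₁ : I.subschemeι.app O (resO hW a) = resO (I.subschemeι.preimage_mono hW)
    (I.subschemeι.app W a) := congr($(I.subschemeι.naturality (homOfLE hW).op) a)
  have h₂ : I.subschemeι.app O (resO hW' a') = resO (I.subschemeι.preimage_mono hW')
    (I.subschemeι.app W' a') := congr($(I.subschemeι.naturality (homOfLE hW').op) a')
  rw [map_sub, h₁, h₂, ha, ha', resO_resO, resO_resO, sub_self]

omit hZ hK in
lemma exists_app_eq {W : X.Opens} (hW : IsAffineOpen W) {V : I.subscheme.Opens}
    (s : Γ(I.subscheme, V)) (h : I.subschemeι ⁻¹ᵁ W ≤ V) :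
    ∃ a, I.subschemeι.app W a = resO h s :=
  I.subschemeι_app_surjective ⟨W, hW⟩ _

-- A function on the closed subscheme is known to lift to `X` only over affine open subsets. The
-- products with these local lifts agree on overlaps and glue.
omit hZ in
lemma exists_act {V : I.subscheme.Opens} (s : Γ(I.subscheme, V)) (x : Sec N (extOpen I V)) :
    ∃ y : Sec N (extOpen I V), ∀ (W : X.Opens) (hW : W ≤ extOpen I V) (a : Γ(X, W)),
      I.subschemeι.app W a = resO ((le_extOpen_iff I).mp hW) s →
        res (ab N) hW y = a • res (ab N) hW x := by
  choose W hW hpW hWV using fun p : extOpen I V ↦ exists_affine_mem_le p.2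
  choose a ha using fun p ↦ exists_app_eq (hW p) s ((le_extOpen_iff I).mp (hWV p))
  have hcov : extOpen I V ≤ ⨆ p, W p := fun p hp ↦ Opens.mem_iSup.mpr ⟨⟨p, hp⟩, hpW _⟩
  obtain ⟨y, hy⟩ := AbSheaf.exists_glue (ab N) W hWV hcov
    (fun p ↦ a p • res (ab N) (hWV p) x) (fun p q ↦ by
      rw [res_smul, res_smul, res_res, res_res]
      exact smul_eq_of_app_eq hK _ _ _ _ s _ _ (ha p) (ha q) _)
  refine ⟨y, fun O hO b hb ↦ AbSheaf.eq_of_locally_eq (ab N) (fun p ↦ O ⊓ W p)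
    (fun p ↦ inf_le_left) (by rw [← inf_iSup_eq]; exact le_inf le_rfl (hO.trans hcov)) fun p ↦ ?_⟩
  rw [res_res, ← res_res _ inf_le_right (hWV p), hy, res_smul, res_smul, res_res, res_res]
  exact smul_eq_of_app_eq hK _ _ _ _ s _ _ (ha p) hb _

omit hZ hK in
lemma eq_of_forall_affine {O : X.Opens} {x y : Sec N O}
    (h : ∀ (W : X.Opens) (hW : W ≤ O), IsAffineOpen W → res (ab N) hW x = res (ab N) hW y) :
    x = y := by
  choose W hW hpW hWV using fun p : O ↦ exists_affine_mem_le p.2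
  exact AbSheaf.eq_of_locally_eq (ab N) W hWV (fun p hp ↦ Opens.mem_iSup.mpr ⟨⟨p, hp⟩, hpW _⟩)
    fun p ↦ h _ _ (hW p)

/-- A module on `X` which is supported on the closed subscheme and killed by its ideal comes from a
module on the closed subscheme. -/
lemma exists_descent : ∃ (G : I.subscheme.Modules) (e : ∀ V, Sec G V ≃+ Sec N (extOpen I V)),
    (∀ {V V' : I.subscheme.Opens} (h : V ≤ V') (x : Sec G V'),
      e V (res (ab G) h x) = res (ab N) (extOpen_mono I h) (e V' x)) ∧
    ∀ {V : I.subscheme.Opens} (s : Γ(I.subscheme, V)) (x : Sec G V) {W : X.Opens}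
      (hW : W ≤ extOpen I V) (a : Γ(X, W)),
      I.subschemeι.app W a = resO ((le_extOpen_iff I).mp hW) s →
        res (ab N) hW (e V (s • x)) = a • res (ab N) hW (e V x) := by
  choose act hact using fun (V : I.subscheme.Opens) (s : Γ(I.subscheme, V))
    (x : Sec N (extOpen I V)) ↦ exists_act hK s x
  let θ : I.subscheme.Opens ⥤ X.Opens := 
    Monotone.functor (f := extOpen I) fun _ _ h ↦ extOpen_mono I h
  -- Equality is tested on affine open subsets `W`. Every function `s` lifts to `W`, so each module
  -- axiom reduces to the same axiom for `N`.
  have key {V : I.subscheme.Opens} {x y : Sec N (extOpen I V)} (h : ∀ (W : X.Opens)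
      (hW : W ≤ extOpen I V), (∀ s : Γ(I.subscheme, V), ∃ a, I.subschemeι.app W a =
        resO ((le_extOpen_iff I).mp hW) s) → res (ab N) hW x = res (ab N) hW y) : x = y :=
    eq_of_forall_affine fun W hW hW' ↦ h W hW fun s ↦ exists_app_eq hW' s _
  let mod (V : (I.subscheme.Opens)ᵒᵖ) : Module (I.subscheme.ringCatSheaf.obj.obj V)
      ((θ.op ⋙ (ab N).obj).obj V) :=
    { smul s x := act V.unop s x
      one_smul x := key (V := V.unop) fun W hW h ↦ by
        refine (hact V.unop 1 x W hW 1 (by rw [map_one, map_one])).trans (one_smul _ _)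
      mul_smul s t x := key (V := V.unop) fun W hW h ↦ by
        obtain ⟨a, ha⟩ := h s
        obtain ⟨b, hb⟩ := h t
        refine (hact V.unop (s * t) x W hW (a * b)
          (by rw [map_mul, ha, hb]; exact (map_mul _ s t).symm)).trans ?_
        refine Eq.trans ?_ (hact V.unop s (act V.unop t x) W hW a ha).symm
        rw [hact V.unop t x W hW b hb, mul_smul]
      smul_zero s := key (V := V.unop) fun W hW h ↦ by
        obtain ⟨a, ha⟩ := h s
        refine (hact V.unop s 0 W hW a ha).trans ?_
        rw [map_zero, smul_zero]
        exact (map_zero _).symm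
      smul_add s x y := key (V := V.unop) fun W hW h ↦ by
        obtain ⟨a, ha⟩ := h s
        refine (hact V.unop s (x + y) W hW a ha).trans ?_
        refine Eq.trans ?_ (map_add (res (ab N) hW) (act V.unop s x) (act V.unop s y)).symm
        rw [hact V.unop s x W hW a ha, hact V.unop s y W hW a ha, ← smul_add]
        exact congrArg (a • ·) (map_add (res (ab N) hW) x y)
      add_smul s t x := key (V := V.unop) fun W hW h ↦ by
        obtain ⟨a, ha⟩ := h s
        obtain ⟨b, hb⟩ := h t
        refine (hact V.unop (s + t) x W hW (a + b)
          (by rw [map_add, ha, hb]; exact (map_add _ s t).symm)).trans ?_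
        refine Eq.trans ?_ (map_add (res (ab N) hW) (act V.unop s x) (act V.unop t x)).symm
        rw [hact V.unop s x W hW a ha, hact V.unop t x W hW b hb, ← add_smul]
      zero_smul x := key (V := V.unop) fun W hW h ↦ by
        refine (hact V.unop 0 x W hW 0 (by rw [map_zero, map_zero])).trans ?_
        rw [zero_smul]
        exact (map_zero _).symm }
  have hsheaf : TopCat.Presheaf.IsSheaf (X := I.subscheme.toTopCat) (θ.op ⋙ (ab N).obj) := by
    rw [TopCat.Presheaf.isSheaf_iff_isSheafUniqueGluing]
    intro ι V s hs
    obtain ⟨z, hz, hz'⟩ := existsUnique_glue_extOpen hZ V s hs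
    exact ⟨z, hz, hz'⟩
  let G : I.subscheme.Modules := ⟨PresheafOfModules.ofPresheaf (R := I.subscheme.ringCatSheaf.obj)
    (θ.op ⋙ (ab N).obj) (fun {V V'} f s x ↦ by
      refine key (V := V'.unop) fun W hW h ↦ ?_
      have hVV' := leOfHom f.unop
      obtain ⟨a, ha⟩ := h (resO hVV' s)
      refine (res_res (ab N) hW (extOpen_mono I hVV') _).trans ?_
      refine (hact V.unop s x W _ a (ha.trans (resO_resO _ hVV' (show Γ(I.subscheme, V.unop) from s)))).trans ?_
      refine Eq.trans ?_ (hact V'.unop (resO hVV' s) _ W hW a ha).symm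
      exact congrArg (a • ·) (res_res (ab N) hW (extOpen_mono I hVV') x).symm), hsheaf⟩
  exact ⟨G, fun V ↦ AddEquiv.refl _, fun h x ↦ rfl, fun s x W hW a ha ↦ hact _ s x W hW a ha⟩

end Descent

/-! ### Cohomology of direct images along affine morphisms. -/

section Pushforward

variable {S Y : Scheme.{u}} [NoetherianSpace S] {G : S.Modules} (hG : LQC G) (f : S ⟶ Y)
  [IsAffineHom f]
include hG

/-- Affine morphisms preserve the cohomology of quasi-coherent modules. -/
lemma LQC.vanishes_pushforward {n : ℕ} (hn : 1 ≤ n) (U : Y.Opens) :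
    Vanishes n U (ab ((Scheme.Modules.pushforward f).obj G)) ↔ Vanishes n (f ⁻¹ᵁ U) (ab G) :=
  vanishes_pull_iff_of_basis (Opens.map f.base) {V : Y.Opens | IsAffineOpen V}
    exists_affineOpen_basis
    (fun _ hV _ hn ↦ hG.vanishes_affine hn (IsAffineOpen.preimage hV f)) hn U

end Pushforward

lemma isIso_of_bijective_secMap {T : TopCat.{u}} {F G : AbSheaf T} (φ : F ⟶ G)
    (hinj : ∀ U x, secMap φ U x = 0 → x = 0) (hsurj : ∀ U, Function.Surjective (secMap φ U)) :
    IsIso φ := by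
  have : Mono φ := mono_of_injective_secMap φ hinj
  have : Epi φ := (epi_iff_locally_surjective φ).mpr fun U z p hp ↦ by
    obtain ⟨x, hx⟩ := hsurj U z
    exact ⟨U, le_rfl, x, hp, by rw [hx, res_self]⟩
  exact isIso_of_mono_of_epi φ

/-! ### Cohomology of modules supported on a closed subscheme. -/

section Support

variable {X : Scheme.{u}} {I : X.IdealSheafData} {N : X.Modules} (hN : LQC N)
  (hZ : ∀ (V : X.Opens), V ≤ complOpen I → ∀ x : Sec N V, x = 0)

lemma app_resO {S : Scheme.{u}} (i : S ⟶ X) {W V : X.Opens} (h : W ≤ V) (a : Γ(X, V)) :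
    i.app W (resO h a) = resO (i.preimage_mono h) (i.app V a) :=
  congr($(i.naturality (homOfLE h).op) a)

section Killed

variable (hK : ∀ (V : X.affineOpens), ∀ a ∈ I.ideal V, ∀ x : Sec N V.1, a • x = 0)
include hN hZ hK

lemma exists_lqc_descent [NoetherianSpace X] : ∃ G : I.subscheme.Modules, LQC G ∧
    Nonempty (ab ((Scheme.Modules.pushforward I.subschemeι).obj G) ≅ ab N) := by
  obtain ⟨G, e, he, hsmul⟩ := exists_descent hZ hK
  have : NoetherianSpace I.subscheme :=
    I.subschemeι.isClosedEmbedding.isInducing.noetherianSpace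
  -- The localization properties of `N` transfer to `G` over the traces `W ∩ Z` of affine open
  -- subsets `W`: functions on such a trace lift to `W`, and the sections of `G` over it are those
  -- of `N` over `W`. These traces form a basis.
  have hB (U : I.subscheme.Opens) (p) (hp : p ∈ U) :
      ∃ V ∈ {V : I.subscheme.Opens | ∃ W : X.Opens, IsAffineOpen W ∧ V = I.subschemeι ⁻¹ᵁ W},
        p ∈ V ∧ V ≤ U := by
    obtain ⟨W, hW, hpW, hWU⟩ := exists_affine_mem_le (U := extOpen I U) (p := I.subschemeι p) (by
      rw [← preimage_extOpen I U] at hp; exact hp)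
    exact ⟨_, ⟨W, hW, rfl⟩, hpW, (le_extOpen_iff I).mp hWU⟩
  have hinj {W : X.Opens} {V : I.subscheme.Opens} (hV : V = I.subschemeι ⁻¹ᵁ W)
      (hW : W ≤ extOpen I V) {x : Sec G V} (hx : res (ab N) hW (e V x) = 0) : x = 0 := by
    subst hV
    have := eq_zero_of_res_of_le_sup hZ hW (extOpen_preimage_le W) hx
    rwa [AddEquiv.map_eq_zero_iff] at this
  have hsurj {W : X.Opens} {V : I.subscheme.Opens} (hV : V = I.subschemeι ⁻¹ᵁ W)
      (hW : W ≤ extOpen I V) (y : Sec N W) : ∃ x : Sec G V, res (ab N) hW (e V x) = y := by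
    subst hV
    obtain ⟨x, hx⟩ := exists_res_eq_of_le_sup hZ hW (extOpen_preimage_le W) y
    exact ⟨(e _).symm x, by rw [AddEquiv.apply_symm_apply, hx]⟩
  have htors : ∀ U ∈ {V : I.subscheme.Opens | ∃ W : X.Opens, IsAffineOpen W ∧
      V = I.subschemeι ⁻¹ᵁ W}, ∀ (f : Γ(I.subscheme, U)) {V : I.subscheme.Opens},
      V = I.subscheme.basicOpen f → ∀ (h : V ≤ U) (t : Sec G U), res (ab G) h t = 0 →
        ∃ n : ℕ, f ^ n • t = 0 := by
    rintro _ ⟨W, hW, rfl⟩ f V hV h t ht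
    obtain ⟨a, ha⟩ := I.subschemeι_app_surjective ⟨W, hW⟩ f
    have hV' : V = I.subschemeι ⁻¹ᵁ X.basicOpen a := by
      rw [hV, Scheme.preimage_basicOpen]; exact congr(I.subscheme.basicOpen $ha).symm
    have hle := le_extOpen_preimage (I := I) W
    have hle' : X.basicOpen a ≤ extOpen I V := (le_extOpen_iff I).mpr hV'.ge
    obtain ⟨n, hn⟩ := hN.tors hW a rfl (X.basicOpen_le a) (res (ab N) hle (e _ t)) (by
      rw [res_res, ← res_res _ hle' (extOpen_mono I h), ← he h, ht, map_zero, map_zero])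
    refine ⟨n, hinj rfl hle ?_⟩
    rw [hsmul (f ^ n) t hle (a ^ n) (by rw [map_pow, resO_self]; exact congr($ha ^ n)), hn]
  have hext : ∀ U ∈ {V : I.subscheme.Opens | ∃ W : X.Opens, IsAffineOpen W ∧
      V = I.subschemeι ⁻¹ᵁ W}, ∀ (f : Γ(I.subscheme, U)) {V : I.subscheme.Opens},
      V = I.subscheme.basicOpen f → ∀ (h : V ≤ U) (s : Sec G V), ∃ (n : ℕ) (t : Sec G U),
        res (ab G) h t = resO h f ^ n • s := by
    rintro _ ⟨W, hW, rfl⟩ f V hV h s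
    obtain ⟨a, ha⟩ := I.subschemeι_app_surjective ⟨W, hW⟩ f
    have hV' : V = I.subschemeι ⁻¹ᵁ X.basicOpen a := by
      rw [hV, Scheme.preimage_basicOpen]; exact congr(I.subscheme.basicOpen $ha).symm
    have hle := le_extOpen_preimage (I := I) W
    have hle' : X.basicOpen a ≤ extOpen I V := (le_extOpen_iff I).mpr hV'.ge
    obtain ⟨n, t, ht⟩ := hN.ext hW a rfl (X.basicOpen_le a) (res (ab N) hle' (e _ s))
    obtain ⟨t, rfl⟩ := hsurj rfl hle t
    refine ⟨n, t, sub_eq_zero.mp (hinj hV' hle' ?_)⟩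
    rw [map_sub, map_sub, he, res_res, ← res_res _ (X.basicOpen_le a) hle, ht,
      hsmul (resO h f ^ n) s hle' (resO (X.basicOpen_le a) a ^ n) (by
        rw [map_pow, map_pow, app_resO, resO_resO]
        exact congr(resO _ $ha ^ n)), sub_self]
  refine ⟨G, ⟨fun _ f _ hV h s ↦ ext_of_basis hB htors hext f hV h s,
    fun _ f _ hV h t ht ↦ tors_of_basis hB htors f hV h t ht⟩, ⟨?_⟩⟩
  have hnat {W' W : X.Opens} (h : W' ≤ W) (x : Sec G (I.subschemeι ⁻¹ᵁ W)) :
      res (ab N) (le_extOpen_preimage W') (e _ (res (ab G) (I.subschemeι.preimage_mono h) x)) =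
        res (ab N) h (res (ab N) (le_extOpen_preimage W) (e _ x)) := by
    rw [he, res_res, res_res]
  let φ : ab ((Scheme.Modules.pushforward I.subschemeι).obj G) ⟶ ab N :=
    ⟨{ app W := AddCommGrpCat.ofHom ((res (ab N) (le_extOpen_preimage W.unop)).comp
          (e (I.subschemeι ⁻¹ᵁ W.unop)).toAddMonoidHom)
       naturality W W' f := by
        ext x
        exact hnat (leOfHom f.unop) x }⟩
  have : IsIso φ := isIso_of_bijective_secMap φ
    (fun W x hx ↦ hinj rfl (le_extOpen_preimage W) hx)
    (fun W y ↦ hsurj rfl (le_extOpen_preimage W) y)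
  exact asIso φ

/-- `N` is the direct image of a module `G` on the closed subscheme. The closed immersion and `f`
are both affine, so the cohomology of `N` and that of `f_* G` on `Y` vanish together with that of
`G`. -/
lemma vanishes_of_killed [NoetherianSpace X] {Y : Scheme.{u}} (f : I.subscheme ⟶ Y) [IsAffineHom f]
    {q : ℕ} (hq : 1 ≤ q) (hY : ∀ G : Y.Modules, LQC G → Vanishes q ⊤ (ab G)) :
    Vanishes q ⊤ (ab N) := by
  obtain ⟨G, hG, ⟨i⟩⟩ := exists_lqc_descent hN hZ hK
  have : NoetherianSpace I.subscheme :=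
    I.subschemeι.isClosedEmbedding.isInducing.noetherianSpace
  have h₁ := (hG.vanishes_pushforward f hq ⊤).mp (hY _ (hG.pushforward f))
  exact ((hG.vanishes_pushforward I.subschemeι hq ⊤).mpr h₁).of_iso i

end Killed

section Torsion

variable (I N)

/-- The subsheaf of sections killed by the `n`-th power of the ideal. -/
lemma exists_torsion (n : ℕ) : ∃ (T : X.Modules) (ι : T ⟶ N),
    (∀ U x, homSec ι U x = 0 → x = 0) ∧ ∀ U m, (∃ x, homSec ι U x = m) ↔
      ∀ (W : X.affineOpens) (h : W.1 ≤ U), ∀ a ∈ I.ideal W ^ n, a • res (ab N) h m = 0 := by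
  obtain ⟨T, ι, hι, h⟩ := exists_subsheaf N (fun U ↦
    { carrier := {m | ∀ (W : X.affineOpens) (h : W.1 ≤ U), ∀ a ∈ I.ideal W ^ n,
        a • res (ab N) h m = 0}
      add_mem' := fun hx hy W h a ha ↦ by rw [map_add, smul_add, hx W h a ha, hy W h a ha, add_zero]
      zero_mem' := fun W h a ha ↦ by rw [map_zero, smul_zero]
      smul_mem' := fun r x hx W h a ha ↦ by
        rw [res_smul, smul_smul, mul_comm, mul_smul, hx W h a ha, smul_zero] })
    (fun {V U} hVU x hx W h a ha ↦ by rw [res_res]; exact hx W _ a ha)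
    (fun {U} x hx W h a ha ↦ by
      choose V hV hpV hVx using fun p : W.1 ↦ hx p.1 (h p.2)
      choose W' hW' hpW' hle using fun p : W.1 ↦
        exists_affine_mem_le (U := W.1 ⊓ V p) (p := p.1) ⟨p.2, hpV p⟩
      refine AbSheaf.eq_of_locally_eq (ab N) W' (fun p ↦ (hle p).trans inf_le_left)
        (fun p hp ↦ Opens.mem_iSup.mpr ⟨⟨p, hp⟩, hpW' _⟩) fun p ↦ ?_
      rw [res_smul, res_res, map_zero]
      have := hVx p ⟨W' p, hW' p⟩ ((hle p).trans inf_le_right)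
        (resO ((hle p).trans inf_le_left) a) (by
          have hm := I.map_ideal (U := ⟨W' p, hW' p⟩) (V := W) ((hle p).trans inf_le_left)
          rw [← hm, ← Ideal.map_pow]
          exact Ideal.mem_map_of_mem _ ha)
      rwa [res_res] at this)
  exact ⟨T, ι, hι, fun U m ↦ (h U m).symm⟩

variable {I N}

lemma torsion_of_affine {n : ℕ} (U : X.affineOpens) {x : Sec N U.1}
    (hx : ∀ a ∈ I.ideal U ^ n, a • x = 0) (W : X.affineOpens) (h : W.1 ≤ U.1)
    (a : Γ(X, W.1)) (ha : a ∈ I.ideal W ^ n) : a • res (ab N) h x = 0 := by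
  rw [← I.map_ideal (U := W) (V := U) h, ← Ideal.map_pow] at ha
  refine Submodule.span_induction ?_ ?_ ?_ ?_ ha
  · rintro _ ⟨b, hb, rfl⟩
    have := congr(res (ab N) h $(hx b hb))
    rw [res_smul, map_zero] at this
    exact this
  · rw [zero_smul]
  · intro a b _ _ h h'
    rw [add_smul, h, h', add_zero]
  · intro r a _ h
    rw [smul_eq_mul, mul_smul, h, smul_zero]

-- If `s` over `D(f)` is killed by `Iⁿ`, some `f ^ m • s` extends to a section `t` over `U`, and
-- each element of `Iⁿ` kills `t` up to a power of `f`. Finite generation of `Iⁿ` makes the exponent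
-- uniform.
include hN in
lemma lqc_torsion [IsLocallyNoetherian X] {n : ℕ} {T : X.Modules} {ι : T ⟶ N}
    (hι : ∀ U x, homSec ι U x = 0 → x = 0) (hT : ∀ U m, (∃ x, homSec ι U x = m) ↔
      ∀ (W : X.affineOpens) (h : W.1 ≤ U), ∀ a ∈ I.ideal W ^ n, a • res (ab N) h m = 0) :
    LQC T := by
  refine ⟨fun {U} hU f V hV h s ↦ ?_, fun {U} hU f V hV h t ht ↦ ?_⟩
  · have hVaff : IsAffineOpen V := hV ▸ hU.basicOpen f
    obtain ⟨m, t, ht⟩ := hN.ext hU f hV h (homSec ι V s)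
    have hnoeth : IsNoetherianRing Γ(X, U) := IsLocallyNoetherian.component_noetherian ⟨U, hU⟩
    obtain ⟨g, hg⟩ := (isNoetherianRing_iff_ideal_fg _).mp hnoeth (I.ideal ⟨U, hU⟩ ^ n)
    obtain ⟨k, hk⟩ := exists_forall_of_finset g (fun a k ↦ f ^ k • a • t = 0)
      (fun a n m hnm hn ↦ by
        obtain ⟨k, rfl⟩ := Nat.exists_eq_add_of_le' hnm
        rw [pow_add, mul_smul, hn, smul_zero])
      (fun a ha ↦ hN.tors hU f hV h (a • t) (by
        rw [res_smul, ht, smul_smul, mul_comm, mul_smul]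
        have h₁ := (hT V _).mp ⟨s, rfl⟩ ⟨V, hVaff⟩ le_rfl (resO h a) (by
          have hm := I.map_ideal (U := ⟨V, hVaff⟩) (V := ⟨U, hU⟩) h
          rw [← hm, ← Ideal.map_pow]
          exact Ideal.mem_map_of_mem _ (hg ▸ Ideal.subset_span ha))
        rw [res_self] at h₁
        rw [h₁, smul_zero]))
    obtain ⟨y, hy⟩ := (hT U (f ^ k • t)).mpr (torsion_of_affine ⟨U, hU⟩ fun a ha ↦ by
      rw [← hg] at ha
      refine Submodule.span_induction ?_ ?_ ?_ ?_ ha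
      · intro a ha
        rw [smul_smul, mul_comm, mul_smul, hk a ha]
      · rw [zero_smul]
      · intro a b _ _ h h'
        rw [add_smul, h, h', add_zero]
      · intro r a _ h
        rw [smul_eq_mul, mul_smul, h, smul_zero])
    refine ⟨k + m, y, sub_eq_zero.mp (hι V _ ?_)⟩
    rw [map_sub, secMap_res, hy, res_smul, ht, homSec_smul, map_pow, pow_add, mul_smul, sub_self]
  · obtain ⟨m, hm⟩ := hN.tors hU f hV h (homSec ι U t) (by rw [← secMap_res, ht, map_zero])
    exact ⟨m, hι _ _ (by rw [homSec_smul, hm])⟩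

variable [NoetherianSpace X] [IsLocallyNoetherian X] {Y : Scheme.{u}} (f : I.subscheme ⟶ Y)
  [IsAffineHom f] {q : ℕ} (hq : 1 ≤ q) (hY : ∀ G : Y.Modules, LQC G → Vanishes q ⊤ (ab G))
include hN hZ f hq hY

/-- Let `T` be the submodule killed by `Iⁿ`. As `Iⁿ⁺¹` kills `N`, multiplication by `I` sends `N`
into `T`, so `N / T` is killed by `I`. -/
lemma vanishes_of_pow_killed (n : ℕ)
    (hK : ∀ (V : X.affineOpens), ∀ a ∈ I.ideal V ^ n, ∀ x : Sec N V.1, a • x = 0) :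
    Vanishes q ⊤ (ab N) := by
  induction n generalizing N with
  | zero =>
    exact vanishes_of_killed hN hZ (fun V a _ x ↦ hK V a (by simp) x) f hq hY
  | succ n ih =>
    obtain ⟨T, ι, hι, hT⟩ := exists_torsion I N n
    have hs := ses_cokernel ι hι
    have hTq := lqc_torsion hN hι hT
    refine hs.vanishes_mid (ih hTq (fun V hV x ↦ hι _ _ (hZ V hV _)) fun V a ha x ↦ hι _ _ ?_)
      (vanishes_of_killed (hs.lqc hTq hN) (fun V hV z ↦ ?_) (fun V a ha z ↦ ?_) f hq hY)
    · have := (hT V.1 _).mp ⟨x, rfl⟩ V le_rfl a ha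
      rwa [res_self, ← homSec_smul] at this
    · choose W hW x hp hx using fun p : V ↦ hs.surj V z p.1 p.2
      refine AbSheaf.eq_of_locally_eq _ W hW (fun p hp' ↦ Opens.mem_iSup.mpr ⟨⟨p, hp'⟩, hp _⟩)
        fun p ↦ ?_
      rw [← hx, hZ _ ((hW p).trans hV) (x p), map_zero, map_zero]
    · obtain ⟨x, rfl⟩ := hs.lqc_surjective hTq hN V.2 z
      obtain ⟨y, hy⟩ := (hT V.1 (a • x)).mpr fun W h b hb ↦ by
        rw [res_smul, smul_smul]
        have hm := I.map_ideal (U := W) (V := V) h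
        have := hK W (b * resO h a) (by
          rw [pow_succ]
          refine Ideal.mul_mem_mul hb ?_
          rw [← hm]
          exact Ideal.mem_map_of_mem _ ha) (res (ab N) h x)
        exact this
      rw [← homSec_smul, ← hy, hs.zero]

/-- Quasi-coherent modules which vanish outside of a closed subscheme, whose reduction is affine
over `Y`, have no more cohomology than `Y`. -/
theorem vanishes_of_support [X.IsSeparated] : Vanishes q ⊤ (ab N) := by
  choose T ι hι hT using exists_torsion I N
  refine Exhausts.vanishes (P := T) (φ := ι) ⟨hι, fun {n m} hnm U x ↦ ?_, fun U x ↦ ?_⟩ hN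
    fun n ↦ ?_
  · rw [hT]
    exact fun W h a ha ↦ (hT n U _).mp ⟨x, rfl⟩ W h a (Ideal.pow_le_pow_right hnm ha)
  · obtain ⟨k, D, hD, hD', hcov⟩ := exists_affine_cover U
    obtain ⟨n, hn⟩ := exists_forall_of_finset Finset.univ
      (fun i n ↦ ∀ a ∈ I.ideal ⟨D i, hD' i⟩ ^ n, a • res (ab N) (hD i) x = 0)
      (fun i n m hnm h a ha ↦ h a (Ideal.pow_le_pow_right hnm ha))
      (fun i _ ↦ by
        have hnoeth : IsNoetherianRing Γ(X, D i) :=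
          IsLocallyNoetherian.component_noetherian ⟨D i, hD' i⟩
        -- `J` is the annihilator of `x` on `D i`. For `a` in the ideal, `x` vanishes on `D(a)`,
        -- which misses the support, so a power of `a` lies in `J`. A finitely generated ideal
        -- contained in the radical of `J` has a power contained in `J`.
        let J : Ideal Γ(X, D i) := LinearMap.ker
          (LinearMap.toSpanSingleton Γ(X, D i) (Sec N (D i)) (res (ab N) (hD i) x))
        have hJ (a : Γ(X, D i)) : a ∈ J ↔ a • res (ab N) (hD i) x = 0 := Iff.rfl
        obtain ⟨n, hn⟩ := Ideal.exists_pow_le_of_le_radical_of_fg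
          (I := I.ideal ⟨D i, hD' i⟩) (J := J) (fun a ha ↦ by
            obtain ⟨m, hm⟩ := hN.tors (hD' i) a rfl (X.basicOpen_le a) (res (ab N) (hD i) x)
              (hZ _ (fun p hp hp' ↦ by
                have h₁ := (I.mem_support_iff_of_mem (U := ⟨D i, hD' i⟩)
                  (X.basicOpen_le a hp)).mp hp'
                exact (X.mem_zeroLocus_iff _ _).mp h₁ a ha hp) _)
            exact ⟨m, hm⟩) ((isNoetherianRing_iff_ideal_fg _).mp hnoeth _)
        exact ⟨n, fun a ha ↦ hn ha⟩)
    refine ⟨n, exists_homSec_eq_of_locally (ι n) (hι n) D hD hcov x fun i ↦ (hT n _ _).mpr ?_⟩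
    exact torsion_of_affine ⟨D i, hD' i⟩ (hn i (Finset.mem_univ i))
  · refine vanishes_of_pow_killed (lqc_torsion hN (hι n) (hT n))
      (fun V hV x ↦ hι n _ _ (hZ V hV _)) f hq hY n fun V a ha x ↦ hι n _ _ ?_
    have := (hT n V.1 _).mp ⟨x, rfl⟩ V le_rfl a ha
    rwa [res_self, ← homSec_smul] at this

end Torsion
end Support

/-! ### Comparison over small open subsets, and unions of affine open subsets. -/

section Local

variable {X : Scheme.{u}}

lemma vanishes_of_eq_zero {T : TopCat.{u}} {F : AbSheaf T} (h : ∀ U (x : F.obj.obj (op U)), x = 0)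
    (n : ℕ) (U : Opens T) : Vanishes n U F := by
  have h0 : 𝟙 F = 0 := AbSheaf.hom_ext fun U x ↦ (h U _).trans (h U _).symm
  refine vanishes_iff.mpr fun x ↦ ?_
  have : x.comp (Abelian.Ext.mk₀ (𝟙 F)) (add_zero n) = x := by simp
  rw [← this, h0, Abelian.Ext.mk₀_zero, Abelian.Ext.comp_zero]

/-- Modules which agree on the open subset `U` have the same cohomology over open subsets
of `U`. -/
lemma vanishes_iff_of_bijective {F G : X.Modules} (φ : F ⟶ G) {U : X.Opens}
    (hinj : ∀ V ≤ U, ∀ x, homSec φ V x = 0 → x = 0)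
    (hsurj : ∀ V ≤ U, Function.Surjective (homSec φ V)) {n : ℕ} (hn : 1 ≤ n) {O : X.Opens}
    (hO : O ≤ U) : Vanishes n O (ab F) ↔ Vanishes n O (ab G) := by
  have hle (V : U.toScheme.Opens) : U.ι ''ᵁ V ≤ U := U.ι_image_le V
  let ψ : ab (F.restrict U.ι) ⟶ ab (G.restrict U.ι) :=
    (pull U.ι.opensFunctor).map ((abF X).map φ)
  have : IsIso ψ := isIso_of_bijective_secMap ψ (fun V x hx ↦ hinj _ (hle V) x hx)
    (fun V ↦ hsurj _ (hle V))
  have hO' : U.ι ''ᵁ (U.ι ⁻¹ᵁ O) = O := by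
    rw [Scheme.Hom.image_preimage_eq_opensRange_inf, Scheme.Opens.opensRange_ι, inf_eq_right.mpr hO]
  rw [← hO', ← vanishes_restrict U.ι F hn, ← vanishes_restrict U.ι G hn]
  exact ⟨fun h ↦ h.of_iso (asIso ψ), fun h ↦ h.of_iso (asIso ψ).symm⟩

lemma toPushRes_injective (F : X.Modules) (U V : X.Opens) (h : V ≤ U) (x : Sec F V)
    (hx : homSec (toPushRes F U) V x = 0) : x = 0 := by
  have := secPush_toPushRes F U x
  rw [hx, map_zero] at this
  have h' : V ≤ U ⊓ V := le_inf h le_rfl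
  have := congr(res (ab F) h' $this)
  rwa [map_zero, res_res, res_self, eq_comm] at this

lemma toPushRes_surjective (F : X.Modules) (U V : X.Opens) (h : V ≤ U) :
    Function.Surjective (homSec (toPushRes F U) V) := by
  intro y
  have h' : V ≤ U ⊓ V := le_inf h le_rfl
  refine ⟨res (ab F) h' (secPush U F V y), (secPush U F V).injective ?_⟩
  rw [secPush_toPushRes, res_res, res_self]

lemma vanishes_pushRes_iff_of_le (F : X.Modules) {U O : X.Opens} (h : O ≤ U) {n : ℕ} (hn : 1 ≤ n) :
    Vanishes n O (ab (pushRes U F)) ↔ Vanishes n O (ab F) :=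
  (vanishes_iff_of_bijective (toPushRes F U) (toPushRes_injective F U) (toPushRes_surjective F U)
    hn h).symm

variable [NoetherianSpace X] [X.IsSeparated] {F : X.Modules} (hF : LQC F)
include hF

/-- The union of `k` affine open subsets has cohomological dimension less than `k`. -/
lemma LQC.vanishes_iSup {k : ℕ} (D : Fin k → X.Opens) (hD : ∀ i, IsAffineOpen (D i)) {q : ℕ}
    (hq : 1 ≤ q) (hkq : k ≤ q) : Vanishes q (⨆ i, D i) (ab F) := by
  induction k generalizing q with
  | zero =>
    rw [iSup_of_empty]
    exact hF.vanishes_bot q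
  | succ k ih =>
    obtain ⟨m, rfl⟩ := Nat.exists_eq_add_of_le' hq
    have h₁ : (⨆ i, D i) = D 0 ⊔ ⨆ i : Fin k, D i.succ := by
      apply le_antisymm
      · refine iSup_le fun i ↦ Fin.cases le_sup_left (fun i ↦ ?_) i
        exact le_sup_of_le_right (le_iSup (fun i : Fin k ↦ D i.succ) i)
      · exact sup_le (le_iSup D 0) (iSup_le fun i ↦ le_iSup D i.succ)
    rw [h₁]
    -- Mayer–Vietoris for `D 0` and the union of the other members. Their intersection is a union of
    -- `k` affine open subsets, because `X` is separated, and is needed only in degree `m = q - 1`.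
    refine vanishes_sup (hF.vanishes_affine hq (hD 0)) (ih _ (fun i ↦ hD _) hq (by omega)) ?_
    rw [inf_iSup_eq]
    -- For `m = 0` the induction hypothesis is not available, but then `k = 0` and the intersection
    -- is empty, so even degree 0 vanishes.
    obtain rfl | hm := Nat.eq_zero_or_pos m
    · obtain rfl : k = 0 := by omega
      rw [iSup_of_empty]
      exact hF.vanishes_bot 0
    · exact ih _ (fun i ↦ (hD 0).inf (hD _)) hm (by omega)

end Local

/-! ### Passing from the complement of a stratum to the whole scheme. -/

section Step

variable {X : Scheme.{u}} [NoetherianSpace X] [X.IsSeparated] [IsLocallyNoetherian X]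
  {I : X.IdealSheafData} {Y : Scheme.{u}} (f : I.subscheme ⟶ Y) [IsAffineHom f] {d : ℕ}
  (hY : ∀ q, d < q → ∀ G : Y.Modules, LQC G → Vanishes q ⊤ (ab G))
include f hY

/-- This replaces the Leray spectral sequence of `j : U ⟶ X`. The hypothesis `hc` says that `Rⁱj_*
F|_U = 0` for `i > c`. In the inductive step `F₁ = j_* F|_U` embeds in a Čech sum without higher
cohomology, with quotient `Q`. Passing from `F` to `Q` lowers by one both the local bound `c` and
the degree `t`. For `c = 0`, comparison of cohomology gives the result directly, with no condition
relating `t` and `d`. -/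
lemma vanishes_pushRes_complOpen {B : Set X.Opens}
    (hB : ∀ (U : X.Opens), ∀ p ∈ U, ∃ V ∈ B, p ∈ V ∧ V ≤ U) (hB' : ∀ V ∈ B, IsAffineOpen V)
    (c : ℕ) {F : X.Modules} (hF : LQC F)
    (hc : ∀ V ∈ B, ∀ q, c + 1 ≤ q → Vanishes q (complOpen I ⊓ V) (ab F)) {t : ℕ} (ht : 1 ≤ t)
    (htc : c = 0 ∨ d + c + 2 ≤ t) (htU : Vanishes t (complOpen I) (ab F)) :
    Vanishes t ⊤ (ab (pushRes (complOpen I) F)) := by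
  induction c generalizing F t with
  | zero =>
    refine (vanishes_pull_iff_of_basis (interFunctor (complOpen I)) B hB
      (F := ab F) (fun V hV n hn ↦ hc V hV n (by omega)) ht ⊤).mpr ?_
    change Vanishes t (complOpen I ⊓ ⊤) _
    rwa [inf_top_eq]
  | succ c ih =>
    let U := complOpen I
    obtain ⟨k, D, hDU, hD, hcov⟩ := exists_affine_cover U
    let F₁ := pushRes U F
    have hF₁ : LQC F₁ := hF.pushRes U
    have hloc₁ (V : X.Opens) (x : Sec F₁ V) (hx : res (ab F₁) (inf_le_right : U ⊓ V ≤ V) x = 0) :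
        x = 0 := by
      apply (secPush U F V).injective
      have := congr(secPush U F _ $hx)
      rw [secPush_res, map_zero] at this
      have h' : U ⊓ V ≤ U ⊓ (U ⊓ V) := le_inf inf_le_left le_rfl
      have := congr(res (ab F) h' $this)
      rwa [map_zero, res_res, res_self] at this
    have hglob₁ (V : X.Opens) (x : Sec F₁ (U ⊓ V)) :
        ∃ y, res (ab F₁) (inf_le_right : U ⊓ V ≤ V) y = x := by
      have h' : U ⊓ V ≤ U ⊓ (U ⊓ V) := le_inf inf_le_left le_rfl
      refine ⟨(secPush U F V).symm (res (ab F) h' (secPush U F _ x)),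
        (secPush U F _).injective ?_⟩
      rw [secPush_res, AddEquiv.apply_symm_apply, res_res, res_self]
    have hinj (V : X.Opens) (x : Sec F₁ V) (hx : homSec (cechMap F₁ D) V x = 0) : x = 0 := by
      refine hloc₁ V x (AbSheaf.eq_of_locally_eq (ab F₁) (fun i ↦ D i ⊓ V)
        (fun i ↦ inf_le_inf_right V (hDU i)) ?_ fun i ↦ ?_)
      · rw [← iSup_inf_eq]
        exact inf_le_inf_right V hcov
      · rw [res_res, eq_zero_of_cechMap F₁ D hx, map_zero]
    have hs := ses_cokernel (cechMap F₁ D) hinj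
    have hC : LQC (⨁ fun i ↦ pushRes (D i) F₁) := LQC.biproduct fun i ↦ hF₁.pushRes (D i)
    have hC' (O : X.Opens) (hO : ∀ i, IsAffineOpen (D i ⊓ O)) (q : ℕ) (hq : 1 ≤ q) :
        Vanishes q O (ab (⨁ fun i ↦ pushRes (D i) F₁)) :=
      vanishes_biproduct _ fun i ↦ (hF₁.vanishes_pushRes (hD i) hq O).mpr
        (hF₁.vanishes_affine hq (hO i))
    have hlocC (V : X.Opens) (x : Sec (⨁ fun i ↦ pushRes (D i) F₁) V)
        (hx : res (ab _) (inf_le_right : U ⊓ V ≤ V) x = 0) : x = 0 := by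
      refine biproduct_sec_ext _ fun i ↦ (secPush (D i) F₁ V).injective ?_
      have := congr(secPush (D i) F₁ _ (homSec (biproduct.π _ i) _ $hx))
      rw [secMap_res, secPush_res, map_zero, map_zero] at this
      have h' : D i ⊓ V ≤ D i ⊓ (U ⊓ V) := le_inf inf_le_left (inf_le_inf_right V (hDU i))
      have := congr(res (ab F₁) h' $this)
      rw [map_zero, res_res, res_self] at this
      rw [map_zero, map_zero]
      exact this
    let Q := cokernel (cechMap F₁ D)
    have hQ : LQC Q := hs.lqc hF₁ hC
    -- `Q` has no nonzero sections vanishing on `U`: if a lift `x` of such a section comes from `F₁`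
    -- over `U ⊓ W`, it comes from `F₁` over `W`, since sections of `F₁`, like those of the Čech
    -- sum, are determined by their restrictions to `U`.
    have hφ (V : X.Opens) (z : Sec Q V) (hz : homSec (toPushRes Q U) V z = 0) : z = 0 := by
      have hz' := secPush_toPushRes Q U z
      rw [hz, map_zero] at hz'
      choose W hW x hpW hx using fun p : V ↦ hs.surj V z p.1 p.2
      refine AbSheaf.eq_of_locally_eq _ W hW (fun p hp ↦ Opens.mem_iSup.mpr ⟨⟨p, hp⟩, hpW _⟩)
        fun p ↦ ?_
      obtain ⟨y, hy⟩ := hs.exact _ (res (ab _) (inf_le_right : U ⊓ W p ≤ W p) (x p)) (by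
        rw [secMap_res, hx, res_res, ← res_res (ab Q) (inf_le_inf_left U (hW p)) inf_le_right, ← hz',
          map_zero])
      obtain ⟨y, rfl⟩ := hglob₁ _ y
      have : x p = homSec (cechMap F₁ D) _ y := by
        refine sub_eq_zero.mp (hlocC _ _ ?_)
        rw [map_sub, ← hy, secMap_res, sub_self]
      rw [← hx, this, hs.zero, map_zero]
    have hs' := ses_cokernel (toPushRes Q U) hφ
    -- The cokernel of `Q ⟶ j_* Q|_U` plays the role of `R¹j_* F|_U`. It vanishes on `U`, and `t - 2
    -- > d` by `htc`.
    have hR : Vanishes (t - 2) ⊤ (ab (cokernel (toPushRes Q U))) := by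
      refine vanishes_of_support (hs'.lqc hQ (hQ.pushRes U)) (fun V hV z ↦ ?_) f (by omega)
        (hY (t - 2) (by omega))
      choose W hW x hpW hx using fun p : V ↦ hs'.surj V z p.1 p.2
      refine AbSheaf.eq_of_locally_eq _ W hW (fun p hp ↦ Opens.mem_iSup.mpr ⟨⟨p, hp⟩, hpW _⟩)
        fun p ↦ ?_
      obtain ⟨y, hy⟩ := toPushRes_surjective Q U (W p) ((hW p).trans hV) (x p)
      rw [← hx, ← hy, hs'.zero, map_zero]
    -- The induction hypothesis applies to `Q`: over `U` and over `U ⊓ V`, vanishing for `Q` in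
    -- degree `q` follows from vanishing for `F` in degree `q + 1`.
    have hQU : Vanishes (t - 1) ⊤ (ab (pushRes U Q)) := by
      refine ih hQ (fun V hV q hq ↦ ?_) (by omega) (by omega) ?_
      · refine hs.vanishes_right (hC' _ (fun i ↦ ?_) q (by omega)) ?_
        · rw [← inf_assoc, inf_eq_left.mpr (hDU i)]
          exact (hD i).inf (hB' V hV)
        · exact (vanishes_pushRes_iff_of_le F inf_le_left (by omega)).mpr
            (hc V hV (q + 1) (by omega))
      · refine hs.vanishes_right (hC' _ (fun i ↦ ?_) _ (by omega)) ?_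
        · rw [inf_eq_left.mpr (hDU i)]
          exact hD i
        · rw [show t - 1 + 1 = t by omega]
          exact (vanishes_pushRes_iff_of_le F le_rfl (by omega)).mpr htU
    have hQ' : Vanishes (t - 1) ⊤ (ab Q) := by
      have := hs'.vanishes_left (n := t - 2) hR (by rwa [show t - 2 + 1 = t - 1 by omega])
      rwa [show t - 2 + 1 = t - 1 by omega] at this
    have := hs.vanishes_left (n := t - 1) hQ' (hC' ⊤ (fun i ↦ by rw [inf_top_eq]; exact hD i) _
      (by omega))
    rwa [show t - 1 + 1 = t by omega] at this

omit f hY in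
/-- Affine open subsets on which the ideal is the unit ideal or is generated by `c` sections. -/
def lciBasis (I : X.IdealSheafData) (c : ℕ) : Set X.Opens :=
  {V | IsAffineOpen V ∧ (V ≤ complOpen I ∨
    ∃ (h : IsAffineOpen V) (g : Fin c → Γ(X, V)), I.ideal ⟨V, h⟩ = Ideal.span (Set.range g))}

omit f hY [NoetherianSpace X] [X.IsSeparated] [IsLocallyNoetherian X] in
lemma exists_mem_lciBasis {c : ℕ} (hI : ∀ p ∈ I.support, ∃ V : X.affineOpens, p ∈ V.1 ∧
      ∃ g : Fin c → Γ(X, V.1), I.ideal V = Ideal.span (Set.range g))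
    (U : X.Opens) (p : X) (hp : p ∈ U) : ∃ V ∈ lciBasis I c, p ∈ V ∧ V ≤ U := by
  by_cases h : p ∈ I.support
  · obtain ⟨V, hpV, g, hg⟩ := hI p h
    obtain ⟨W, hW, hpW, hWU⟩ := exists_affine_mem_le (U := U ⊓ V.1) (p := p) ⟨hp, hpV⟩
    have hWV := hWU.trans inf_le_right
    refine ⟨W, ⟨hW, Or.inr ⟨hW, fun i ↦ resO hWV (g i), ?_⟩⟩, hpW, hWU.trans inf_le_left⟩
    rw [← I.map_ideal (U := ⟨W, hW⟩) (V := V) hWV, hg, Ideal.map_span, ← Set.range_comp]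
    rfl
  · obtain ⟨W, hW, hpW, hWU⟩ := exists_affine_mem_le (U := U ⊓ complOpen I) (p := p) ⟨hp, h⟩
    exact ⟨W, ⟨hW, Or.inl (hWU.trans inf_le_right)⟩, hpW, hWU.trans inf_le_left⟩

omit f hY [NoetherianSpace X] [X.IsSeparated] [IsLocallyNoetherian X] in
lemma complOpen_inf_eq_iSup {c : ℕ} {V : X.Opens} (h : IsAffineOpen V) (g : Fin c → Γ(X, V))
    (hg : I.ideal ⟨V, h⟩ = Ideal.span (Set.range g)) :
    complOpen I ⊓ V = ⨆ i, X.basicOpen (g i) := by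
  ext p
  simp only [Opens.coe_inf, Set.mem_inter_iff, SetLike.mem_coe, Opens.mem_iSup]
  constructor
  · rintro ⟨hp, hpV⟩
    by_contra! hne
    refine hp ((I.mem_support_iff_of_mem (U := ⟨V, h⟩) hpV).mpr ?_)
    rw [hg, Scheme.zeroLocus_span, Scheme.mem_zeroLocus_iff]
    rintro _ ⟨i, rfl⟩
    exact hne i
  · rintro ⟨i, hi⟩
    have hpV := X.basicOpen_le _ hi
    refine ⟨fun hp ↦ ?_, hpV⟩
    have := (I.mem_support_iff_of_mem (U := ⟨V, h⟩) hpV).mp hp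
    rw [Scheme.mem_zeroLocus_iff] at this
    exact this (g i) (hg ▸ Ideal.subset_span ⟨i, rfl⟩) hi

/-- Vanishing of cohomology on the complement of a local complete intersection of codimension `c`,
which is affine over `Y`, implies vanishing of cohomology in degrees greater than
`cd Y + c`. -/
theorem vanishes_top_of_lci {c : ℕ} (hI : ∀ p ∈ I.support, ∃ V : X.affineOpens, p ∈ V.1 ∧
      ∃ g : Fin c → Γ(X, V.1), I.ideal V = Ideal.span (Set.range g))
    {F : X.Modules} (hF : LQC F) {t : ℕ} (ht : d + c < t)
    (htU : Vanishes t (complOpen I) (ab F)) : Vanishes t ⊤ (ab F) := by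
  let U := complOpen I
  have hB' : ∀ V ∈ lciBasis I c, IsAffineOpen V := fun V hV ↦ hV.1
  have hpush : Vanishes t ⊤ (ab (pushRes U F)) := by
    -- The truncated `c - 1` is the last degree in which a local contribution may survive: over a
    -- basic set, `U` is affine or a union of `c` affine open subsets. For `c ≤ 1` the base case
    -- applies.
    refine vanishes_pushRes_complOpen f hY (exists_mem_lciBasis hI) hB' (c - 1) hF
      (fun V hV q hq ↦ ?_) (by omega) (by omega) htU
    obtain ⟨hV, hV' | ⟨hV', g, hg⟩⟩ := hV
    · rw [inf_eq_right.mpr hV']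
      exact hF.vanishes_affine (by omega) hV
    · rw [complOpen_inf_eq_iSup hV' g hg]
      exact hF.vanishes_iSup _ (fun i ↦ hV'.basicOpen _) (by omega) (by omega)
  obtain ⟨K, J, C, k, e, i, π, h₁, h₂, hfac⟩ := exists_ses_image (toPushRes F U)
  have hcomp (V : X.Opens) (x : Sec F V) : homSec i V (homSec e V x) =
      homSec (toPushRes F U) V x := by rw [← hfac, homSec_comp]
  have hpF : LQC (pushRes U F) := hF.pushRes U
  have hK : LQC K := LQC.of_kernel (φ := k) (ψ := toPushRes F U) h₁.inj
    (fun V x ↦ by rw [← hcomp, h₁.zero, map_zero])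
    (fun V x hx ↦ h₁.exact V x (h₂.inj V _ (by rw [← hx, ← hcomp]))) hF hpF
  have hJ : LQC J := h₁.lqc hK hF
  have hC : LQC C := h₂.lqc hJ hpF
  have hKz : Vanishes t ⊤ (ab K) := by
    refine vanishes_of_support hK (fun V hV x ↦ h₁.inj V x ?_) f (by omega) (hY t (by omega))
    refine toPushRes_injective F U V hV _ ?_
    rw [← hcomp, h₁.zero, map_zero]
  have hCz : Vanishes (t - 1) ⊤ (ab C) := by
    have hzero (W : X.Opens) (x : Sec (pushRes U F) W)
        (h : ∃ y, homSec (toPushRes F U) W y = x) : homSec π W x = 0 := by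
      obtain ⟨y, rfl⟩ := h
      rw [← hcomp, h₂.zero]
    -- For `c = 0` the degree `t - 1` need not exceed `d`. But then each basic set lies in `U` or is
    -- disjoint from `U`, so `F ⟶ j_* F|_U` is surjective and `C` is zero.
    obtain rfl | hc := Nat.eq_zero_or_pos c
    · refine vanishes_of_eq_zero (fun V z ↦ ?_) _ _
      choose W hW x hpW hx using fun p : V ↦ h₂.surj V z p.1 p.2
      choose W' hW' hpW' hWW' using fun p : V ↦ exists_mem_lciBasis hI (W p) p.1 (hpW p)
      refine AbSheaf.eq_of_locally_eq (ab C) W' (fun p ↦ (hWW' p).trans (hW p))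
        (fun p hp ↦ Opens.mem_iSup.mpr ⟨⟨p, hp⟩, hpW' _⟩) fun p ↦ ?_
      rw [← res_res _ (hWW' p) (hW p), ← hx, ← secMap_res, map_zero]
      refine hzero _ _ ?_
      obtain ⟨hV, hV' | ⟨hV', g, hg⟩⟩ := hW' p
      · exact toPushRes_surjective F U _ hV' _
      · refine ⟨0, (secPush U F _).injective ?_⟩
        have hbot : U ⊓ W' p = ⊥ := by
          rw [complOpen_inf_eq_iSup hV' g hg, iSup_of_empty]
        exact AbSheaf.eq_of_locally_eq (ab F) (ι := Empty) (fun _ ↦ ⊥) nofun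
          (by rw [hbot]; exact bot_le) nofun
    · refine vanishes_of_support hC (fun V hV z ↦ ?_) f (by omega) (hY _ (by omega))
      choose W hW x hpW hx using fun p : V ↦ h₂.surj V z p.1 p.2
      refine AbSheaf.eq_of_locally_eq (ab C) W hW (fun p hp ↦ Opens.mem_iSup.mpr ⟨⟨p, hp⟩, hpW _⟩)
        fun p ↦ ?_
      rw [← hx, map_zero]
      exact hzero _ _ (toPushRes_surjective F U _ ((hW p).trans hV) _)
  have hJz : Vanishes t ⊤ (ab J) := by
    have := h₂.vanishes_left (n := t - 1) hCz (by rwa [show t - 1 + 1 = t by omega])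
    rwa [show t - 1 + 1 = t by omega] at this
  exact h₁.vanishes_mid hKz hJz

end Step

-- Finiteness and separatedness of quasi-projective varieties.

attribute [local instance] MvPolynomial.gradedAlgebra

lemma isNoetherianRing_homogeneousSubmodule_zero (k : Type u) [Field k] (n : ℕ) :
    IsNoetherianRing (MvPolynomial.homogeneousSubmodule (Fin (n + 1)) k 0) := by
  refine isNoetherianRing_of_surjective k _
    (algebraMap k (MvPolynomial.homogeneousSubmodule (Fin (n + 1)) k 0)) ?_
  rintro ⟨x, hx⟩
  rw [MvPolynomial.homogeneousSubmodule_zero] at hx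
  obtain ⟨a, rfl⟩ := Submodule.mem_one.mp hx
  exact ⟨a, rfl⟩

instance finiteType_homogeneousSubmodule_zero (k : Type u) [Field k] (n : ℕ) :
    Algebra.FiniteType
      (MvPolynomial.homogeneousSubmodule (Fin (n + 1)) k 0) (MvPolynomial (Fin (n + 1)) k) :=
  have : IsScalarTower k (MvPolynomial.homogeneousSubmodule (Fin (n + 1)) k 0)
    (MvPolynomial (Fin (n + 1)) k) := ⟨fun a b c ↦ smul_mul_assoc a b.1 c⟩
  Algebra.FiniteType.of_restrictScalars_finiteType k _ _

/-- The ring of degree-zero forms is a quotient of `k`, hence noetherian, and `Proj` is proper over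
its spectrum, so of finite type. -/
instance isNoetherian_projectiveSpace (k : Type u) [Field k] (n : ℕ) :
    IsNoetherian (projectiveSpace k n) := by
  have := isNoetherianRing_homogeneousSubmodule_zero k n
  let f : projectiveSpace k n ⟶ _ :=
    Proj.toSpecZero (MvPolynomial.homogeneousSubmodule (Fin (n + 1)) k)
  have hf : IsProper f :=
    inferInstanceAs (IsProper
      (Proj.toSpecZero (MvPolynomial.homogeneousSubmodule (Fin (n + 1)) k)))
  have : IsLocallyNoetherian (projectiveSpace k n) := LocallyOfFiniteType.isLocallyNoetherian f
  have : CompactSpace (projectiveSpace k n) := QuasiCompact.compactSpace_of_compactSpace f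
  exact {}

lemma isSeparated_of_hom {X Y : Scheme.{u}} (f : X ⟶ Y) [IsSeparated f] [Y.IsSeparated] :
    X.IsSeparated := by
  rw [Scheme.isSeparated_iff, ← terminal.comp_from f]
  infer_instance

section

variable {k : Type u} [Field k] {X : Scheme.{u}} {s : X ⟶ Spec (.of k)}

lemma IsQuasiProjectiveVariety.isLocallyNoetherian (h : IsQuasiProjectiveVariety k s) :
    IsLocallyNoetherian X := by
  obtain ⟨n, i, hi, -⟩ := h.exists_immersion
  exact LocallyOfFiniteType.isLocallyNoetherian i

lemma IsQuasiProjectiveVariety.noetherianSpace (h : IsQuasiProjectiveVariety k s) :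
    NoetherianSpace X := by
  obtain ⟨n, i, hi, -⟩ := h.exists_immersion
  exact i.isEmbedding.isInducing.noetherianSpace

lemma IsQuasiProjectiveVariety.isSeparated (h : IsQuasiProjectiveVariety k s) :
    X.IsSeparated := by
  obtain ⟨n, i, hi, -⟩ := h.exists_immersion
  have : (projectiveSpace k n).IsSeparated :=
    inferInstanceAs (Scheme.IsSeparated (Proj (MvPolynomial.homogeneousSubmodule (Fin (n + 1)) k)))
  exact isSeparated_of_hom i

end

/-! ### Cohomological dimension and the geometry of strata. -/

lemma lqc_unit (X : Scheme.{u}) : LQC (X := X) (SheafOfModules.unit X.ringCatSheaf) := by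
  refine ⟨fun {U} hU f V hV h s ↦ ?_, fun {U} hU f V hV h t ht ↦ ?_⟩
  · subst hV
    have := hU.isLocalization_basicOpen f
    obtain ⟨n, a, ha⟩ := IsLocalization.Away.surj (S := Γ(X, X.basicOpen f)) f s
    exact ⟨n, a, ha.symm.trans (mul_comm _ _)⟩
  · subst hV
    have := hU.isLocalization_basicOpen f
    obtain ⟨n, hn⟩ := IsLocalization.Away.exists_of_eq (S := Γ(X, X.basicOpen f)) f
      (show algebraMap Γ(X, U) Γ(X, X.basicOpen f) t = algebraMap Γ(X, U) _ 0 from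
        ht.trans (map_zero _).symm)
    exact ⟨n, hn.trans (mul_zero _)⟩

lemma vanishes_top_of_cd_lt {Y : Scheme.{u}} {q : ℕ} (hq : cd Y < (q : WithBot ℕ∞))
    (G : Y.Modules) (hG : LQC G) : Vanishes q ⊤ (ab G) := by
  obtain ⟨n, hn, hnq⟩ := sInf_lt_iff.mp hq
  exact (subsingleton_H_iff_vanishes _ _).mp (hn G hG.isQuasicoherent q hnq)

/-- Vanishing in degree 0 applies to the structure sheaf, so `1 = 0` on `Y`. -/
lemma isEmpty_of_cd_eq_bot {Y : Scheme.{u}} (h : cd Y = ⊥) : IsEmpty Y := by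
  have h₀ := vanishes_top_of_cd_lt (q := 0) (h ▸ WithBot.bot_lt_coe _) _ (lqc_unit Y)
  rw [vanishes_zero_iff] at h₀
  have : Subsingleton Γ(Y, ⊤) := h₀
  refine not_nonempty_iff.mp fun ⟨y⟩ ↦ ?_
  have : Nonempty (⊤ : Y.Opens) := ⟨⟨y, trivial⟩⟩
  exact not_subsingleton Γ(Y, ⊤) inferInstance

lemma mem_support_stratumIdeal {X : Scheme.{u}} (A B : Closeds X)
    (x : (closedCompl B).toScheme) : x ∈ (stratumIdeal A B).support ↔ x.1 ∈ A := by
  change x ∈ ((stratumIdeal A B).support : Set _) ↔ _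
  rw [stratumIdeal, Scheme.IdealSheafData.coe_support_vanishingIdeal]
  rfl

lemma image_complOpen_stratumIdeal {X : Scheme.{u}} {A B : Closeds X} (h : B ≤ A) :
    (closedCompl B).ι ''ᵁ complOpen (stratumIdeal A B) = closedCompl A := by
  ext x
  refine ⟨?_, fun hx ↦ ?_⟩
  · rintro ⟨y, hy, rfl⟩
    exact fun hA ↦ hy ((mem_support_stratumIdeal A B y).mpr hA)
  · exact ⟨⟨x, fun hB ↦ hx (h hB)⟩, fun hA ↦ hx ((mem_support_stratumIdeal A B _).mp hA), rfl⟩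

/-- A quasi-coherent module on `U` is the restriction of its direct image on `X`, which is again
quasi-coherent because `U` is noetherian. -/
lemma subsingleton_cohomology_opens {X : Scheme.{u}} [NoetherianSpace X] (U : X.Opens) {t : ℕ}
    (h : ∀ F : X.Modules, LQC F → Vanishes t U (ab F)) (F : U.toScheme.Modules)
    (hF : F.IsQuasicoherent) : Subsingleton (cohomology F t) := by
  have := noetherianSpace_opens U
  refine (subsingleton_H_iff_vanishes (ab F) t).mpr ?_
  let G := (Scheme.Modules.pushforward U.ι).obj F
  have hG : Vanishes t U (ab G) := h G ((lqc_of_isQuasicoherent F).pushforward U.ι)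
  let e : G.restrict U.ι ≅ F := (Scheme.Modules.restrictFunctorAdjCounitIso U.ι).app F
  refine Vanishes.of_iso ((abF _).mapIso e) ?_
  obtain rfl | ht := Nat.eq_zero_or_pos t
  · rw [vanishes_zero_iff] at hG ⊢
    rw [← U.ι_image_top] at hG
    exact hG
  · exact (vanishes_affine_iff_top G ht U).mp hG

section

variable {X : Scheme.{u}} [NoetherianSpace X] [X.IsSeparated] [IsLocallyNoetherian X]

lemma vanishes_closedCompl_of_stratum {A B : Closeds X} (hBA : B ≤ A) (hlci : IsLci A B)
    {Y : Scheme.{u}} (f : stratum A B ⟶ Y) [IsAffineHom f] {t : ℕ}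
    (ht : cd Y + (codim ((A : Set X) \ B) : WithBot ℕ∞) < (t : WithBot ℕ∞))
    {F : X.Modules} (hF : LQC F) (hA : Vanishes t (closedCompl A) (ab F)) :
    Vanishes t (closedCompl B) (ab F) := by
  -- An empty stratum changes nothing. This case is separated because then the codimension is `⊤`
  -- and no number of equations is available.
  by_cases hAB : (A : Set X) ⊆ B
  · rwa [le_antisymm hBA hAB]
  obtain ⟨x, hxA, hxB⟩ := Set.not_subset.mp hAB
  obtain ⟨V₀, hx, c, hc, g₀, hg₀⟩ := hlci ⟨x, hxB⟩ hxA
  -- The stratum has a point and maps to `Y`, so `Y` is nonempty. This excludes `⊥`, for which `ht`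
  -- would carry no numerical information; `ht` itself excludes `⊤`, so `cd Y` is a natural number.
  have hY : cd Y ≠ ⊥ := by
    intro h
    have := isEmpty_of_cd_eq_bot h
    have hx' := (mem_support_stratumIdeal A B ⟨x, hxB⟩).mpr hxA
    obtain ⟨q, -⟩ := (stratumIdeal A B).range_subschemeι.ge hx'
    exact this.elim (f q)
  rw [← hc] at ht
  obtain ⟨d, hd⟩ : ∃ d : ℕ, cd Y = (d : ℕ∞) := by
    obtain ⟨d', hd'⟩ := WithBot.ne_bot_iff_exists.mp hY
    rw [← hd'] at ht
    have ht' : d' + c < (t : ℕ∞) := by exact_mod_cast ht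
    obtain ⟨d, rfl⟩ := ENat.ne_top_iff_exists.mp (show d' ≠ ⊤ by rintro rfl; simp at ht')
    exact ⟨d, hd'.symm⟩
  have hdt : d + c < t := by
    rw [hd] at ht
    exact_mod_cast ht
  have := noetherianSpace_opens (closedCompl B)
  have : (closedCompl B).toScheme.IsSeparated := isSeparated_of_hom (closedCompl B).ι
  let f' : (stratumIdeal A B).subscheme ⟶ Y := f
  have : IsAffineHom f' := ‹IsAffineHom f›
  rw [vanishes_affine_iff_top _ (by omega)]
  refine vanishes_top_of_lci (I := stratumIdeal A B) f' (d := d)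
    (fun q hq ↦ vanishes_top_of_cd_lt (by rw [hd]; exact_mod_cast hq)) (c := c) ?_
    (hF.restrict _) hdt ?_
  · intro p hp
    obtain ⟨V, hp, c', hc', g, hg⟩ := hlci p ((mem_support_stratumIdeal A B p).mp hp)
    obtain rfl : c' = c := by exact_mod_cast hc'.trans hc.symm
    exact ⟨V, hp, g, hg⟩
  · rwa [vanishes_restrict _ _ (by omega), image_complOpen_stratumIdeal hBA]

end

end CdLci

end

open CdLci
theorem mainTheorem1 (k : Type u) [Field k] [IsAlgClosed k] {X : Scheme.{u}}
    (s : X ⟶ Spec (.of k)) (hX : IsQuasiProjectiveVariety k s)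
    {r : ℕ} (hr : 1 ≤ r) (Z : Fin (r + 1) → Closeds X)
    (Y : Fin r → Scheme.{u}) (t : ∀ j, Y j ⟶ Spec (.of k))
    (h : IsLciAffineBundleStratification k s Z Y t) :
    cd (closedCompl (Z ⟨1, Nat.lt_succ_of_le hr⟩)).toScheme ≤
      ⨆ (j : Fin r) (_ : 1 ≤ (j : ℕ)),
        (cd (Y j) + (codim ((Z j.succ : Set X) \ Z j.castSucc) : WithBot ℕ∞)) := by
  have := hX.noetherianSpace
  have := hX.isSeparated
  have := hX.isLocallyNoetherian
  refine sInf_le fun F hF n hn ↦ subsingleton_cohomology_opens _ (fun G hG ↦ ?_) F hF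
  -- The module `G` and the degree `n` stay fixed throughout the descending induction on `j`: each
  -- step needs vanishing over the smaller open subset only for this module and in this degree.
  suffices ∀ j : Fin (r + 1), 1 ≤ (j : ℕ) → Vanishes n (closedCompl (Z j)) (ab G) from
    this ⟨1, _⟩ le_rfl
  intro j
  induction j using Fin.reverseInduction with
  | last =>
    intro _
    rw [h.eq_top]
    have : closedCompl (⊤ : Closeds X) = ⊥ := by ext; simp [closedCompl]
    rw [this]
    exact hG.vanishes_bot n
  | cast j ih =>
    intro hj
    obtain ⟨f, -, hf⟩ := h.exists_isAffineHom j
    exact vanishes_closedCompl_of_stratum (h.monotone j.castSucc_le_succ) (h.isLci j hj) f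
      ((le_iSup₂_of_le j hj le_rfl).trans_lt hn) hG (ih (by simp))
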